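/- Let $\ell:\mathbb R\to\mathbb R$ be one of the following losses, with the attached numbers $q_0,\mathbf q,\bar{\mathbf q}_0=2\lceil q_0\mathbf q/2\rceil$: the squared loss $\ell(t)=t^2$ ($q_0=2$, $\mathbf q=3/2$, $\bar{\mathbf q}_0=4$); the absolute loss $\ell(t)=|t|$ ($q_0=1$, $\mathbf q=0$, $\bar{\mathbf q}_0=0$); the Huber loss with fixed threshold $\eta>0$, $\ell(t)=t^2/2$ for $|t|\le\eta$ and $\ell(t)=\eta|t|-\eta^2/2$ for $|t|>\eta$ ($q_0=1$, $\mathbf q=0$, $\bar{\mathbf q}_0=0$). Put $q^*=2^{(\bar{\mathbf q}_0+4)/2}$. For every $n\ge1$ let $p=p_n\in\mathbb N$ with $\tau\le p/n\le1/\tau$, where $\tau\in(0,1)$ is fixed. Let $X_1,\dots,X_n$ be i.i.d. random vectors in $\mathbb R^p$ with $\mathbb E[X_i]=0$ and $\mathbb E[X_iX_i^\top]=\Sigma/n$ with $\Sigma=\Sigma_n$ positive definite, and let $G_1,\dots,G_n$ be i.i.d. with law $N(0,\Sigma/n)$; let $\mathbf X$, $\mathbf G$ be the design matrices with these rows. Let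 $\xi=(\xi_1,\dots,\xi_n)$ be a noise vector (random or deterministic) which is independent of $\mathbf X$ and independent of $\mathbf G$. Assume that, for a constant $M<\infty$ not depending on $n$, $\mathbb E[|\sqrt n\,X_{i,j}|^{q^*}]^{1/q^*}\le M$ for all $i,j$ and $\lambda_{\max}(\Sigma)\le M$. Assume that $X_i$ is $d$-block dependent with $d=d_n$: there are $k\le p$ and a partition of $\{1,\dots,p\}$ into cells $B_1,\dots,B_k$ with at most $d$ elements each such that the subvectors $(X_{i,j})_{j\in B_1},\dots,(X_{i,j})_{j\in B_k}$ are independent. With $\ell_i(x)=\ell(x-\xi_i)$, let $L_{\ell_i}\ge1$ be (possibly $\xi$-dependent) numbers with $\sup_{x}|\ell_i(x)|/(1+|x|^{q_0})\le L_{\ell_i}$, and assume $\frac1n\sum_{i=1}^nL_{\ell_i}^{\mathbf q}=O(1)$ (in probability, if $\xi$ is random). Let $R=R_n:\mathbb R^p\to\mathbb R$ be convex. For a design $\mathbf A$ with rows $A_i$ set $H_\ell(w,\mathbf A)=\frac1n\sum_{i=1}^n\ell_i(A_i^\top w)+R(w)$, and let $\hat w_{\mathbf X}$, $\hat w_{\mathbf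 G}$ be random vectors that almost surely minimize $H_\ell(\cdot,\mathbf X)$, $H_\ell(\cdot,\mathbf G)$ over $\mathbb R^p$. Let $\mathcal S_n\subset\mathbb R^p$ be measurable, $\varepsilon_n\in[0,1/4)$, $L_n\ge1$, $z=z_n\in\mathbb R$, and let $\rho_0>0$ be fixed, such that for all $n$ (i) $\max\{\Pr(\|\hat w_{\mathbf G}\|_\infty>L_n),\Pr(\|\hat w_{\mathbf X}\|_\infty>L_n)\}\le\varepsilon_n$; (ii) $\max\{\Pr(\inf_{w\in\mathbb R^p}H_\ell(w,\mathbf G)\ge z+\rho_0),\ \Pr(\inf_{w\in\mathcal S_n}H_\ell(w,\mathbf G)\le z+2\rho_0)\}\le\varepsilon_n$ (the infimum over the empty set being $+\infty$). Let $\alpha\in[0,1/(2\bar{\mathbf q}_0+6)]$ and $\kappa\ge0$, and suppose that, as $n\to\infty$, $L_n=O(n^\alpha\log^\kappa n)$ and $d=o\bigl(n^{1/4-(\bar{\mathbf q}_0+3)\alpha/2}/\log^{6+(2\bar{\mathbf q}_0+6)\kappa}n\bigr)$. Then, as $n\to\infty$, $$|\Pr(\hat w_{\mathbf X}\in\mathcal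 S_n)-\Pr(\hat w_{\mathbf G}\in\mathcal S_n)|\le4\varepsilon_n+o(1).$$ -/

import Mathlib

open MeasureTheory ProbabilityTheory Filter Topology Asymptotics

noncomputable section

namespace BlockUniversality

/-- The three loss functions: squared, absolute and Huber (with threshold `η > 0`). -/
inductive RegressionLoss : Type
  | squared : RegressionLoss
  | absolute : RegressionLoss
  | huber (η : ℝ) (hη : 0 < η) : RegressionLoss

namespace RegressionLoss

/-- The loss as a function of the residual `t`. -/
def fn : RegressionLoss → ℝ → ℝ
  | squared, t => t ^ 2
  | absolute, t => |t|
  | huber η _, t => if |t| ≤ η then t ^ 2 / 2 else η * |t| - η ^ 2 / 2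

/-- The growth exponent `q₀` of the loss. -/
def qZero : RegressionLoss → ℝ
  | squared => 2
  | absolute => 1
  | huber _ _ => 1

/-- The exponent `q₁` in the self-bounding property of the first derivative. -/
def qOne : RegressionLoss → ℝ
  | squared => 1 / 2
  | absolute => 0
  | huber _ _ => 0

/-- The exponent `q₂` in the self-bounding property of the second derivative. -/
def qTwo : RegressionLoss → ℝ
  | squared => 0
  | absolute => 0
  | huber _ _ => 0

/-- The exponent `q₃` in the self-bounding property of the third derivative. -/
def qThree : RegressionLoss → ℝ
  | squared => 0
  | absolute => 0
  | huber _ _ => 0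

/-- `𝐪 = max {3 q₁, q₁ + q₂, q₃}`. -/
def qBold (l : RegressionLoss) : ℝ :=
  max (3 * l.qOne) (max (l.qOne + l.qTwo) l.qThree)

/-- `q̄₀ = 2 ⌈q₀ 𝐪 / 2⌉`. -/
def qBar (l : RegressionLoss) : ℝ := 2 * (⌈l.qZero * l.qBold / 2⌉ : ℝ)

/-- The order `q* = 2 ^ ((q̄₀ + 4) / 2)` of the moments of the rescaled covariates. -/
def qStar (l : RegressionLoss) : ℝ := (2 : ℝ) ^ ((l.qBar + 4) / 2)

end RegressionLoss

/-- The empirical risk `H(w, A) = n⁻¹ ∑ᵢ ℓ(Aᵢᵀ w - ξᵢ) + R(w)` of a design `A` with rows `Aᵢ`. -/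
def risk {n p : ℕ} (l : RegressionLoss) (R : (Fin p → ℝ) → ℝ)
    (A : Fin n → Fin p → ℝ) (ξ : Fin n → ℝ) (w : Fin p → ℝ) : ℝ :=
  (1 / (n : ℝ)) * ∑ i, l.fn ((∑ j, A i j * w j) - ξ i) + R w

/-- The minimal value of the risk over `S`, in the extended reals
(so that it is `⊤` for empty `S`, and `⊥` if the risk is unbounded below on `S`). -/
def minRisk {n p : ℕ} (l : RegressionLoss) (R : (Fin p → ℝ) → ℝ)
    (A : Fin n → Fin p → ℝ) (ξ : Fin n → ℝ) (S : Set (Fin p → ℝ)) : EReal :=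
  ⨅ w ∈ S, ((risk l R A ξ w : ℝ) : EReal)

/-- `d`-block dependence of a random vector: the coordinates can be partitioned into at most `p`
cells, each of size at most `d`, such that the subvectors on the cells are independent. -/
def BlockDependent {Ω : Type*} [MeasurableSpace Ω] (P : Measure Ω) {p : ℕ}
    (Z : Ω → Fin p → ℝ) (d : ℕ) : Prop :=
  ∃ k : ℕ, k ≤ p ∧ ∃ B : Fin k → Finset (Fin p),
    Pairwise (fun a b => Disjoint (B a) (B b)) ∧
    (∀ j : Fin p, ∃ a, j ∈ B a) ∧
    (∀ a, (B a).card ≤ d) ∧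
    iIndepFun (fun (a : Fin k) (ω : Ω) (j : {j : Fin p // j ∈ B a}) => Z ω j) P

/-- The largest eigenvalue of a (symmetric) real matrix. -/
def lambdaMax {p : ℕ} (A : Matrix (Fin p) (Fin p) ℝ) : ℝ := sSup (spectrum ℝ A)

/-- The rows `Xᵢ` of a random design are i.i.d. random vectors with mean `0` and
`E[Xᵢ Xᵢᵀ] = Σ / n`. -/
structure IsDesign {Ω : Type*} [MeasurableSpace Ω] (P : Measure Ω) {n p : ℕ}
    (X : Ω → Fin n → Fin p → ℝ) (Sig : Matrix (Fin p) (Fin p) ℝ) : Prop where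
  measurable : Measurable X
  indep : iIndepFun (fun i ω => X ω i) P
  identDistrib : ∀ i i', IdentDistrib (fun ω => X ω i) (fun ω => X ω i') P P
  mean : ∀ i j, ∫ ω, X ω i j ∂P = 0
  cov : ∀ i j k, ∫ ω, X ω i j * X ω i k ∂P = Sig j k / n

/-- The rows `Gᵢ` of a random design are i.i.d. with law `N(0, Σ / n)`. -/
structure IsGaussianDesign {Ω : Type*} [MeasurableSpace Ω] (P : Measure Ω) {n p : ℕ}
    (G : Ω → Fin n → Fin p → ℝ) (Sig : Matrix (Fin p) (Fin p) ℝ) : Prop where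
  measurable : Measurable G
  indep : iIndepFun (fun i ω => G ω i) P
  law : ∀ i, P.map (fun ω => WithLp.toLp 2 (G ω i)) =
    multivariateGaussian 0 ((1 / (n : ℝ)) • Sig)

/-- A sequence of real random variables is `O(1)` in probability. -/
def BoundedInProbability {Ω : ℕ → Type*} [∀ n, MeasurableSpace (Ω n)]
    (P : ∀ n, Measure (Ω n)) (A : ∀ n, Ω n → ℝ) : Prop :=
  ∀ η : ℝ, 0 < η → ∃ K : ℝ, ∀ᶠ n in atTop, (P n).real {ω | K < |A n ω|} ≤ η

end BlockUniversality

end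

/-! Lindeberg's replacement argument, carried out one independent block of one row at a time. Smooth
the loss, and replace the minimal risk over a finite set of parameters by the soft minimum `-(1/β)
log ∑ exp (-β H)`. Since the blocks of `X` and of `G` have the same first two moments, only the
third-order Taylor remainder changes when one is exchanged for the other. The derivatives of the
soft minimum are cumulants under its Gibbs measure, so this remainder is a Gibbs average of
derivatives of one row's loss. For the squared loss these grow with the residual; that row's own
loss can nevertheless be dropped from the Gibbs weight, by Chebyshev's association inequality, and
what remains is independent of the row. With logarithmically large `β`, the total error is of order
`d² L ^ (q̄₀ + 3) (log n)² / √n → 0`.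

Hence the minimal risks of the two designs over a bounded set are comparable in distribution. The
sets to compare are the ball of radius `L` and its intersection with `S`: at a level strictly
between `z + ρ₀` and `z + 2ρ₀` they decide, up to the given probabilities, whether the minimizer
lies in `S`. -/

noncomputable section

namespace BlockUniversality

section Calculus

/-- `f₁`, `f₂` and `f₃` are the first three derivatives of `f` on the real line. The derivatives are
explicit data because each of them is bounded separately in the expansion of the test functions. -/
structure HasThreeDerivs (f f₁ f₂ f₃ : ℝ → ℝ) : Prop where
  deriv₁ : ∀ t, HasDerivAt f (f₁ t) t
  deriv₂ : ∀ t, HasDerivAt f₁ (f₂ t) t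
  deriv₃ : ∀ t, HasDerivAt f₂ (f₃ t) t

lemma abs_sub_le_of_abs_deriv_le {F F' : ℝ → ℝ} {C : ℝ} (hF : ∀ t, HasDerivAt F (F' t) t)
    (hF' : ∀ t ∈ Set.Icc (0 : ℝ) 1, |F' t| ≤ C) {t : ℝ} (ht : t ∈ Set.Icc (0 : ℝ) 1) :
    |F t - F 0| ≤ C := by
  have hlip := (convex_Icc (0 : ℝ) 1).norm_image_sub_le_of_norm_hasDerivWithin_le
    (fun x _ => (hF x).hasDerivWithinAt) hF' (Set.left_mem_Icc.2 zero_le_one) ht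
  have hC : 0 ≤ C := (abs_nonneg _).trans (hF' t ht)
  calc |F t - F 0| ≤ C * |t - 0| := hlip
    _ ≤ C := by
        rw [sub_zero, abs_of_nonneg ht.1]
        exact mul_le_of_le_one_right hC ht.2

namespace HasThreeDerivs

variable {f f₁ f₂ f₃ u u₁ u₂ u₃ : ℝ → ℝ}

lemma abs_taylor_two_le {C : ℝ} (h : HasThreeDerivs f f₁ f₂ f₃)
    (hC : ∀ t ∈ Set.Icc (0 : ℝ) 1, |f₃ t| ≤ C) : |f 1 - f 0 - (f₁ 0 + f₂ 0 / 2)| ≤ C := by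
  have hf₂ : ∀ t ∈ Set.Icc (0 : ℝ) 1, |f₂ t - f₂ 0| ≤ C := fun t ht =>
    abs_sub_le_of_abs_deriv_le h.deriv₃ hC ht
  have hf₁ : ∀ t ∈ Set.Icc (0 : ℝ) 1, |f₁ t - f₁ 0 - f₂ 0 * t| ≤ C := fun t ht => by
    have := abs_sub_le_of_abs_deriv_le (F := fun t => f₁ t - f₂ 0 * t) (fun t =>
      ((h.deriv₂ t).sub ((hasDerivAt_id t).const_mul (f₂ 0))).congr_deriv (by ring)) hf₂ ht
    convert this using 2
    ring
  have hderiv (t : ℝ) : HasDerivAt (fun t => f t - f₁ 0 * t - f₂ 0 / 2 * t ^ 2)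
      (f₁ t - f₁ 0 - f₂ 0 * t) t := by
    refine (((h.deriv₁ t).sub ((hasDerivAt_id t).const_mul (f₁ 0))).sub
      ((hasDerivAt_pow 2 t).const_mul (f₂ 0 / 2))).congr_deriv ?_
    push_cast
    ring
  convert abs_sub_le_of_abs_deriv_le hderiv hf₁ (Set.right_mem_Icc.2 zero_le_one) using 2
  ring

lemma comp (hf : HasThreeDerivs f f₁ f₂ f₃) (hu : HasThreeDerivs u u₁ u₂ u₃) :
    HasThreeDerivs (fun t => f (u t)) (fun t => f₁ (u t) * u₁ t)
      (fun t => f₂ (u t) * u₁ t ^ 2 + f₁ (u t) * u₂ t)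
      (fun t => f₃ (u t) * u₁ t ^ 3 + 3 * f₂ (u t) * u₁ t * u₂ t + f₁ (u t) * u₃ t) where
  deriv₁ t := (hf.deriv₁ (u t)).comp t (hu.deriv₁ t)
  deriv₂ t := by
    refine (((hf.deriv₂ (u t)).comp t (hu.deriv₁ t)).mul (hu.deriv₂ t)).congr_deriv ?_
    simp only [Function.comp_apply]
    ring
  deriv₃ t := by
    refine ((((hf.deriv₃ (u t)).comp t (hu.deriv₁ t)).mul ((hu.deriv₂ t).pow 2)).add
      (((hf.deriv₂ (u t)).comp t (hu.deriv₁ t)).mul (hu.deriv₃ t))).congr_deriv ?_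
    simp only [Function.comp_apply, Pi.pow_apply]
    push_cast
    ring

lemma comp_affine (hf : HasThreeDerivs f f₁ f₂ f₃) (a b : ℝ) :
    HasThreeDerivs (fun t => f (b * t + a)) (fun t => f₁ (b * t + a) * b)
      (fun t => f₂ (b * t + a) * b ^ 2) (fun t => f₃ (b * t + a) * b ^ 3) := by
  have hline (t : ℝ) : HasDerivAt (fun t => b * t + a) b t := by
    simpa using ((hasDerivAt_id t).const_mul b).add_const a
  refine ⟨fun t => (hf.deriv₁ _).comp t (hline t), fun t => ?_, fun t => ?_⟩
  · exact (((hf.deriv₂ _).comp t (hline t)).mul_const b).congr_deriv (by ring)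
  · exact (((hf.deriv₃ _).comp t (hline t)).mul_const (b ^ 2)).congr_deriv (by ring)

lemma const_add_const_mul (hf : HasThreeDerivs f f₁ f₂ f₃) (r θ : ℝ) :
    HasThreeDerivs (fun t => r + θ * f t) (fun t => θ * f₁ t) (fun t => θ * f₂ t)
      (fun t => θ * f₃ t) where
  deriv₁ t := ((hf.deriv₁ t).const_mul θ).const_add r
  deriv₂ t := (hf.deriv₂ t).const_mul θ
  deriv₃ t := (hf.deriv₃ t).const_mul θ

lemma sigmoid :
    HasThreeDerivs Real.sigmoid (fun t => Real.sigmoid t * (1 - Real.sigmoid t))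
      (fun t => Real.sigmoid t * (1 - Real.sigmoid t) * (1 - 2 * Real.sigmoid t))
      (fun t => Real.sigmoid t * (1 - Real.sigmoid t) *
        (1 - 6 * Real.sigmoid t + 6 * Real.sigmoid t ^ 2)) where
  deriv₁ t := Real.hasDerivAt_sigmoid t
  deriv₂ t := by
    have h := Real.hasDerivAt_sigmoid t
    exact (h.mul (h.const_sub 1)).congr_deriv (by ring)
  deriv₃ t := by
    have h := Real.hasDerivAt_sigmoid t
    refine ((h.mul (h.const_sub 1)).mul ((h.const_mul 2).const_sub 1)).congr_deriv ?_
    simp only [Pi.mul_apply]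
    ring

end HasThreeDerivs

lemma exists_hasThreeDerivs_sigmoid_affine {k : ℝ} (hk : |k| ≤ 1) (m : ℝ) :
    ∃ φ₁ φ₂ φ₃ : ℝ → ℝ, HasThreeDerivs (fun y => Real.sigmoid (k * y + m)) φ₁ φ₂ φ₃ ∧
      ∀ y, |φ₁ y| ≤ |k| ∧ |φ₂ y| ≤ |k| ∧ |φ₃ y| ≤ |k| := by
  refine ⟨_, _, _, HasThreeDerivs.sigmoid.comp_affine m k, fun y => ?_⟩
  set S := Real.sigmoid (k * y + m)
  have hS₀ : 0 ≤ S := Real.sigmoid_nonneg _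
  have hS₁ : S ≤ 1 := Real.sigmoid_le_one _
  have hS : |S * (1 - S)| ≤ 1 := abs_le.2 ⟨by nlinarith, by nlinarith⟩
  have h₂ : |1 - 2 * S| ≤ 1 := abs_le.2 ⟨by linarith, by linarith⟩
  have h₃ : |1 - 6 * S + 6 * S ^ 2| ≤ 1 :=
    abs_le.2 ⟨by nlinarith [sq_nonneg (2 * S - 1)], by nlinarith⟩
  have hpow (j : ℕ) (hj : j ≠ 0) : |k| ^ j ≤ |k| := pow_le_of_le_one (abs_nonneg k) hk hj
  simp only [abs_mul _ k, abs_mul _ (k ^ _), abs_mul _ (1 - 2 * S), abs_mul _ (_ + 6 * S ^ 2),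
    abs_pow]
  refine ⟨mul_le_of_le_one_left (abs_nonneg k) hS, ?_, ?_⟩
  · exact (mul_le_of_le_one_left (by positivity) (mul_le_one₀ hS (abs_nonneg _) h₂)).trans
      (hpow 2 two_ne_zero)
  · exact (mul_le_of_le_one_left (by positivity) (mul_le_one₀ hS (abs_nonneg _) h₃)).trans
      (hpow 3 three_ne_zero)

lemma abs_add_pow_three_le (a b : ℝ) : |a + b| ^ 3 ≤ 4 * (|a| ^ 3 + |b| ^ 3) :=
  calc |a + b| ^ 3 ≤ (|a| + |b|) ^ 3 := pow_le_pow_left₀ (abs_nonneg _) (abs_add_le a b) 3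
    _ ≤ 2 ^ (3 - 1) * (|a| ^ 3 + |b| ^ 3) := add_pow_le (abs_nonneg a) (abs_nonneg b) 3
    _ = 4 * (|a| ^ 3 + |b| ^ 3) := by norm_num

end Calculus

section Gibbs

variable {κ : Type*} {s : Finset κ}

/-- The partition function `∑ exp (-E w)` of the energies `E` on the finite set `s`. Its logarithm
is the soft minimum of `E` up to sign. -/
def partitionFn (s : Finset κ) (E : κ → ℝ) : ℝ := ∑ w ∈ s, Real.exp (-E w)

/-- The average of `φ` under the Gibbs measure on `s` with energies `E`. -/
def gibbs (s : Finset κ) (E φ : κ → ℝ) : ℝ :=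
  (∑ w ∈ s, Real.exp (-E w) * φ w) / partitionFn s E

lemma partitionFn_pos (hs : s.Nonempty) (E : κ → ℝ) : 0 < partitionFn s E :=
  Finset.sum_pos (fun _ _ => Real.exp_pos _) hs

lemma gibbs_eq_sum_weights (s : Finset κ) (E φ : κ → ℝ) :
    gibbs s E φ = ∑ w ∈ s, Real.exp (-E w) / partitionFn s E * φ w := by
  unfold gibbs
  rw [Finset.sum_div]
  exact Finset.sum_congr rfl fun w _ => by ring

lemma gibbs_mono (E : κ → ℝ) {φ ψ : κ → ℝ} (h : ∀ w ∈ s, φ w ≤ ψ w) :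
    gibbs s E φ ≤ gibbs s E ψ := by
  unfold gibbs partitionFn
  gcongr with w hw
  exact h w hw

lemma gibbs_add (s : Finset κ) (E φ ψ : κ → ℝ) :
    gibbs s E (fun w => φ w + ψ w) = gibbs s E φ + gibbs s E ψ := by
  simp only [gibbs, mul_add, Finset.sum_add_distrib, add_div]

lemma gibbs_const_mul (s : Finset κ) (E φ : κ → ℝ) (c : ℝ) :
    gibbs s E (fun w => c * φ w) = c * gibbs s E φ := by
  simp only [gibbs, ← mul_div_assoc, Finset.mul_sum, mul_left_comm c]

lemma gibbs_const (hs : s.Nonempty) (E : κ → ℝ) (c : ℝ) : gibbs s E (fun _ => c) = c := by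
  unfold gibbs
  rw [← Finset.sum_mul]
  exact mul_div_cancel_left₀ c (partitionFn_pos hs E).ne'

lemma gibbs_nonneg (E : κ → ℝ) {φ : κ → ℝ} (h : ∀ w ∈ s, 0 ≤ φ w) : 0 ≤ gibbs s E φ :=
  div_nonneg (Finset.sum_nonneg fun w hw => mul_nonneg (Real.exp_pos _).le (h w hw))
    (Finset.sum_nonneg fun _ _ => (Real.exp_pos _).le)

lemma abs_gibbs_le_mul (E : κ → ℝ) {φ ψ : κ → ℝ} {c : ℝ} (h : ∀ w ∈ s, |φ w| ≤ c * ψ w) :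
    |gibbs s E φ| ≤ c * gibbs s E ψ := by
  rw [← gibbs_const_mul]
  refine abs_le.2 ⟨?_, gibbs_mono E fun w hw => (le_abs_self _).trans (h w hw)⟩
  rw [neg_eq_neg_one_mul, ← gibbs_const_mul]
  exact gibbs_mono E fun w hw => by linarith [neg_abs_le (φ w), h w hw]

lemma gibbs_pow_three_le (hs : s.Nonempty) (E : κ → ℝ) {V : κ → ℝ} (hV : ∀ w ∈ s, 0 ≤ V w) :
    gibbs s E V ^ 3 ≤ gibbs s E (fun w => V w ^ 3) := by
  set x := gibbs s E V with hx
  have hx₀ : 0 ≤ x := gibbs_nonneg E hV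
  have h : gibbs s E (fun w => 3 * x ^ 2 * V w + -2 * x ^ 3) ≤ gibbs s E (fun w => V w ^ 3) :=
    gibbs_mono E fun w hw => by
      have := add_nonneg (hV w hw) (mul_nonneg zero_le_two hx₀)
      nlinarith [mul_nonneg (sq_nonneg (V w - x)) this]
  rw [gibbs_add, gibbs_const_mul, gibbs_const hs, ← hx] at h
  linarith

lemma gibbs_mul_gibbs_sq_le (hs : s.Nonempty) (E : κ → ℝ) {V : κ → ℝ} (hV : ∀ w ∈ s, 0 ≤ V w) :
    gibbs s E V * gibbs s E (fun w => V w ^ 2) ≤ gibbs s E (fun w => V w ^ 3) := by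
  set x := gibbs s E V
  have hx₀ : 0 ≤ x := gibbs_nonneg E hV
  have h : gibbs s E (fun w => 3 * x * V w ^ 2) ≤ gibbs s E (fun w => 2 * V w ^ 3 + x ^ 3) :=
    gibbs_mono E fun w hw => by
      have := add_nonneg (mul_nonneg zero_le_two (hV w hw)) hx₀
      nlinarith [mul_nonneg (sq_nonneg (V w - x)) this]
  rw [gibbs_add, gibbs_const_mul, gibbs_const_mul, gibbs_const hs] at h
  linarith [gibbs_pow_three_le hs E hV]

lemma exp_neg_sub_mul_sub_nonneg {x y a b : ℝ} (h : 0 ≤ (x - y) * (a - b)) :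
    0 ≤ (Real.exp (-y) - Real.exp (-x)) * (a - b) := by
  rcases lt_trichotomy x y with hlt | rfl | hgt
  · have hab : a - b ≤ 0 := by nlinarith
    exact mul_nonneg_of_nonpos_of_nonpos
      (sub_nonpos.2 (Real.exp_le_exp.2 (neg_le_neg hlt.le))) hab
  · rw [sub_self, zero_mul]
  · have hab : 0 ≤ a - b := by nlinarith
    exact mul_nonneg (sub_nonneg.2 (Real.exp_le_exp.2 (neg_le_neg hgt.le))) hab

-- Chebyshev's association inequality, obtained by symmetrizing the double sum of the two averages.
lemma gibbs_add_energy_le (hs : s.Nonempty) (E F V : κ → ℝ)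
    (h : ∀ w ∈ s, ∀ w' ∈ s, 0 ≤ (F w - F w') * (V w - V w')) :
    gibbs s (fun w => E w + F w) V ≤ gibbs s E V := by
  set a : κ → ℝ := fun w => Real.exp (-E w) with ha
  set b : κ → ℝ := fun w => Real.exp (-F w) with hb
  have hab (w : κ) : Real.exp (-(E w + F w)) = a w * b w := by
    rw [ha, hb, ← Real.exp_add, neg_add]
  have hsymm : 0 ≤ ∑ w ∈ s, ∑ w' ∈ s, a w * a w' * ((b w' - b w) * (V w - V w')) :=
    Finset.sum_nonneg fun w hw => Finset.sum_nonneg fun w' hw' =>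
      mul_nonneg (mul_nonneg (Real.exp_pos _).le (Real.exp_pos _).le)
        (exp_neg_sub_mul_sub_nonneg (h w hw w' hw'))
  have hexpand : ∑ w ∈ s, ∑ w' ∈ s, a w * a w' * ((b w' - b w) * (V w - V w')) =
      2 * ((∑ w ∈ s, a w * V w) * ∑ w ∈ s, a w * b w) -
      2 * ((∑ w ∈ s, a w * b w * V w) * ∑ w ∈ s, a w) := by
    rw [two_mul, two_mul]
    nth_rewrite 2 [mul_comm (∑ w ∈ s, a w * V w)]
    nth_rewrite 2 [mul_comm (∑ w ∈ s, a w * b w * V w)]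
    simp only [Finset.sum_mul_sum, ← Finset.sum_add_distrib, ← Finset.sum_sub_distrib]
    exact Finset.sum_congr rfl fun w _ => Finset.sum_congr rfl fun w' _ => by ring
  unfold gibbs
  rw [div_le_div_iff₀ (partitionFn_pos hs _) (partitionFn_pos hs _)]
  unfold partitionFn
  simp_rw [hab]
  linarith

section Derivatives

variable {t : ℝ} {E φ : ℝ → κ → ℝ} {x φ' : κ → ℝ}

lemma hasDerivAt_sum_exp_mul (hE : ∀ w ∈ s, HasDerivAt (fun t => -E t w) (x w) t)
    (hφ : ∀ w ∈ s, HasDerivAt (fun t => φ t w) (φ' w) t) :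
    HasDerivAt (fun t => ∑ w ∈ s, Real.exp (-E t w) * φ t w)
      (∑ w ∈ s, Real.exp (-E t w) * (x w * φ t w + φ' w)) t :=
  HasDerivAt.fun_sum fun w hw => ((hE w hw).exp.mul (hφ w hw)).congr_deriv (by ring)

lemma hasDerivAt_partitionFn (hE : ∀ w ∈ s, HasDerivAt (fun t => -E t w) (x w) t) :
    HasDerivAt (fun t => partitionFn s (E t)) (∑ w ∈ s, Real.exp (-E t w) * x w) t :=
  HasDerivAt.fun_sum fun w hw => (hE w hw).exp

lemma hasDerivAt_log_partitionFn (hs : s.Nonempty)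
    (hE : ∀ w ∈ s, HasDerivAt (fun t => -E t w) (x w) t) :
    HasDerivAt (fun t => Real.log (partitionFn s (E t))) (gibbs s (E t) x) t :=
  (hasDerivAt_partitionFn hE).log (partitionFn_pos hs _).ne'

lemma hasDerivAt_gibbs (hs : s.Nonempty) (hE : ∀ w ∈ s, HasDerivAt (fun t => -E t w) (x w) t)
    (hφ : ∀ w ∈ s, HasDerivAt (fun t => φ t w) (φ' w) t) :
    HasDerivAt (fun t => gibbs s (E t) (φ t))
      (gibbs s (E t) (fun w => x w * φ t w + φ' w) - gibbs s (E t) x * gibbs s (E t) (φ t)) t := by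
  have hZ := (partitionFn_pos hs (E t)).ne'
  refine ((hasDerivAt_sum_exp_mul hE hφ).div (hasDerivAt_partitionFn hE) hZ).congr_deriv ?_
  unfold gibbs
  field_simp

lemma hasThreeDerivs_log_partitionFn {x₁ x₂ x₃ : ℝ → κ → ℝ} (hs : s.Nonempty)
    (hE : ∀ w ∈ s, HasThreeDerivs (fun t => -E t w) (fun t => x₁ t w) (fun t => x₂ t w)
      (fun t => x₃ t w)) :
    HasThreeDerivs (fun t => Real.log (partitionFn s (E t))) (fun t => gibbs s (E t) (x₁ t))
      (fun t => gibbs s (E t) (fun w => x₁ t w ^ 2 + x₂ t w) - gibbs s (E t) (x₁ t) ^ 2)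
      (fun t => gibbs s (E t) (fun w => x₁ t w ^ 3 + 3 * x₁ t w * x₂ t w + x₃ t w) -
        3 * gibbs s (E t) (fun w => x₁ t w ^ 2 + x₂ t w) * gibbs s (E t) (x₁ t) +
        2 * gibbs s (E t) (x₁ t) ^ 3) := by
  have hE₁ (t : ℝ) : ∀ w ∈ s, HasDerivAt (fun t => -E t w) (x₁ t w) t := fun w hw =>
    (hE w hw).deriv₁ t
  have hx₁ (t : ℝ) : ∀ w ∈ s, HasDerivAt (fun t => x₁ t w) (x₂ t w) t := fun w hw =>
    (hE w hw).deriv₂ t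
  have hx₁₂ (t : ℝ) : ∀ w ∈ s, HasDerivAt (fun t => x₁ t w ^ 2 + x₂ t w)
      (2 * x₁ t w * x₂ t w + x₃ t w) t := fun w hw => by
    refine ((((hE w hw).deriv₂ t).pow 2).add ((hE w hw).deriv₃ t)).congr_deriv ?_
    push_cast
    ring
  refine ⟨fun t => hasDerivAt_log_partitionFn hs (hE₁ t), fun t => ?_, fun t => ?_⟩
  · refine (hasDerivAt_gibbs hs (hE₁ t) (hx₁ t)).congr_deriv ?_
    simp only [← sq]
  · refine ((hasDerivAt_gibbs hs (hE₁ t) (hx₁₂ t)).sub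
      ((hasDerivAt_gibbs hs (hE₁ t) (hx₁ t)).pow 2)).congr_deriv ?_
    have hcube : (fun w => x₁ t w * (x₁ t w ^ 2 + x₂ t w) + (2 * x₁ t w * x₂ t w + x₃ t w)) =
        fun w => x₁ t w ^ 3 + 3 * x₁ t w * x₂ t w + x₃ t w := by
      ext w
      ring
    simp only [hcube, ← sq]
    push_cast
    ring

end Derivatives

end Gibbs

section Expansion

variable {κ : Type*} {s : Finset κ}

/-- A loss with three derivatives dominated by the powers of a weight `V`, where `V` increases with
the loss and `V ^ 3` grows at most like `1 + c |t| ^ 3`. For Lipschitz losses `V = 1` and `c = 0`,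
for the squared loss `V` is `1 + |t|` and `c = 1`. -/
structure IsTame (g g₁ g₂ g₃ V : ℝ → ℝ) (c C : ℝ) : Prop extends HasThreeDerivs g g₁ g₂ g₃ where
  one_le : 1 ≤ C
  c_nonneg : 0 ≤ c
  V_nonneg : ∀ t, 0 ≤ V t
  bound₁ : ∀ t, |g₁ t| ≤ C * V t
  bound₂ : ∀ t, |g₂ t| ≤ C * V t ^ 2
  bound₃ : ∀ t, |g₃ t| ≤ C * V t ^ 3
  comono : ∀ s t, 0 ≤ (g s - g t) * (V s ^ 3 - V t ^ 3)
  growth : ∀ t, V t ^ 3 ≤ C * (1 + c * |t| ^ 3)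

/-- `Q` is a quadratic polynomial without constant term in the coordinates indexed by `s`. The mean
of such a function of a random vector depends only on the first two moments of the vector. -/
def IsQuadratic (s : Finset κ) (Q : (κ → ℝ) → ℝ) : Prop :=
  ∃ (u : κ → ℝ) (v : κ → κ → ℝ), ∀ b, Q b =
    ∑ w ∈ s, u w * b w + ∑ w ∈ s, ∑ w' ∈ s, v w w' * (b w * b w')

namespace IsQuadratic

variable {Q Q' : (κ → ℝ) → ℝ}

lemma add (hQ : IsQuadratic s Q) (hQ' : IsQuadratic s Q') :
    IsQuadratic s fun b => Q b + Q' b := by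
  obtain ⟨u, v, h⟩ := hQ
  obtain ⟨u', v', h'⟩ := hQ'
  refine ⟨fun w => u w + u' w, fun w w' => v w w' + v' w w', fun b => ?_⟩
  simp only [h, h', add_mul, Finset.sum_add_distrib]
  ring

lemma const_mul (c : ℝ) (hQ : IsQuadratic s Q) : IsQuadratic s fun b => c * Q b := by
  obtain ⟨u, v, h⟩ := hQ
  refine ⟨fun w => c * u w, fun w w' => c * v w w', fun b => ?_⟩
  simp only [h, mul_add, Finset.mul_sum, mul_assoc]

lemma sum_mul (s : Finset κ) (u : κ → ℝ) : IsQuadratic s fun b => ∑ w ∈ s, u w * b w :=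
  ⟨u, 0, fun b => by simp⟩

lemma sum_mul_sq (s : Finset κ) (u : κ → ℝ) : IsQuadratic s fun b => ∑ w ∈ s, u w * b w ^ 2 := by
  classical
  refine ⟨0, fun w w' => if w = w' then u w else 0, fun b => ?_⟩
  simp only [Pi.zero_apply, zero_mul, Finset.sum_const_zero, zero_add, ite_mul, Finset.sum_ite_eq]
  exact Finset.sum_congr rfl fun w hw => by rw [if_pos hw, sq]

lemma sq_sum_mul (s : Finset κ) (u : κ → ℝ) :
    IsQuadratic s fun b => (∑ w ∈ s, u w * b w) ^ 2 := by
  refine ⟨0, fun w w' => u w * u w', fun b => ?_⟩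
  simp only [Pi.zero_apply, zero_mul, Finset.sum_const_zero, zero_add, sq, Finset.sum_mul_sum]
  exact Finset.sum_congr rfl fun w _ => Finset.sum_congr rfl fun w' _ => by ring

end IsQuadratic

section Cumulants

variable {E W x₁ x₂ x₃ : κ → ℝ} {q : ℝ}

lemma abs_gibbs_moment_two_le (hx₁ : ∀ w ∈ s, |x₁ w| ≤ q * W w)
    (hx₂ : ∀ w ∈ s, |x₂ w| ≤ q ^ 2 * W w ^ 2) :
    |gibbs s E (fun w => x₁ w ^ 2 + x₂ w)| ≤ 2 * q ^ 2 * gibbs s E (fun w => W w ^ 2) := by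
  refine abs_gibbs_le_mul E fun w hw => ?_
  calc |x₁ w ^ 2 + x₂ w| ≤ |x₁ w| ^ 2 + |x₂ w| := by
        rw [← abs_pow]
        exact abs_add_le _ _
    _ ≤ (q * W w) ^ 2 + q ^ 2 * W w ^ 2 := by
        gcongr
        exacts [hx₁ w hw, hx₂ w hw]
    _ = 2 * q ^ 2 * W w ^ 2 := by ring

lemma abs_gibbs_moment_three_le (hx₁ : ∀ w ∈ s, |x₁ w| ≤ q * W w)
    (hx₂ : ∀ w ∈ s, |x₂ w| ≤ q ^ 2 * W w ^ 2) (hx₃ : ∀ w ∈ s, |x₃ w| ≤ q ^ 3 * W w ^ 3) :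
    |gibbs s E (fun w => x₁ w ^ 3 + 3 * x₁ w * x₂ w + x₃ w)| ≤
      5 * q ^ 3 * gibbs s E (fun w => W w ^ 3) := by
  refine abs_gibbs_le_mul E fun w hw => ?_
  calc |x₁ w ^ 3 + 3 * x₁ w * x₂ w + x₃ w| ≤ |x₁ w| ^ 3 + 3 * |x₁ w| * |x₂ w| + |x₃ w| := by
        refine (abs_add_three _ _ _).trans_eq ?_
        rw [abs_pow, abs_mul, abs_mul, abs_of_pos (zero_lt_three' ℝ)]
    _ ≤ (q * W w) ^ 3 + 3 * (q * W w) * (q ^ 2 * W w ^ 2) + q ^ 3 * W w ^ 3 := by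
        have hqW : 0 ≤ q * W w := (abs_nonneg _).trans (hx₁ w hw)
        gcongr
        exacts [hx₁ w hw, hx₁ w hw, hx₂ w hw, hx₃ w hw]
    _ = 5 * q ^ 3 * W w ^ 3 := by ring

lemma abs_third_deriv_comp_le {K φ₁ φ₂ φ₃ a b c : ℝ} (h₁ : |φ₁| ≤ K) (h₂ : |φ₂| ≤ K)
    (h₃ : |φ₃| ≤ K) :
    |φ₃ * a ^ 3 + 3 * φ₂ * a * b + φ₁ * c| ≤ K * (|a| ^ 3 + 3 * (|a| * |b|) + |c|) := by
  calc |φ₃ * a ^ 3 + 3 * φ₂ * a * b + φ₁ * c|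
      ≤ |φ₃| * |a| ^ 3 + 3 * |φ₂| * |a| * |b| + |φ₁| * |c| := by
        refine (abs_add_three _ _ _).trans_eq ?_
        simp only [abs_mul, abs_pow, abs_of_pos (zero_lt_three' ℝ)]
    _ ≤ K * |a| ^ 3 + 3 * K * |a| * |b| + K * |c| := by gcongr
    _ = K * (|a| ^ 3 + 3 * (|a| * |b|) + |c|) := by ring

lemma abs_cumulants_le {A D F m₁ m₂ m₃ : ℝ} (hq : 0 ≤ q) (hm₁ : 0 ≤ m₁) (hA : |A| ≤ q * m₁)
    (hD : |D| ≤ 2 * q ^ 2 * m₂) (hF : |F| ≤ 5 * q ^ 3 * m₃) (hcube : m₁ ^ 3 ≤ m₃)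
    (hmul : m₁ * m₂ ≤ m₃) :
    |A| ^ 3 + 3 * (|A| * |D - A ^ 2|) + |F - 3 * D * A + 2 * A ^ 3| ≤ 23 * (q ^ 3 * m₃) := by
  have hA₃ : |A| ^ 3 ≤ q ^ 3 * m₃ := by
    calc |A| ^ 3 ≤ (q * m₁) ^ 3 := by gcongr
      _ = q ^ 3 * m₁ ^ 3 := by ring
      _ ≤ q ^ 3 * m₃ := by gcongr
  have hAD : |A| * |D| ≤ 2 * (q ^ 3 * m₃) := by
    calc |A| * |D| ≤ (q * m₁) * (2 * q ^ 2 * m₂) := by gcongr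
      _ = 2 * (q ^ 3 * (m₁ * m₂)) := by ring
      _ ≤ 2 * (q ^ 3 * m₃) := by gcongr
  have hvar : |A| * |D - A ^ 2| ≤ 3 * (q ^ 3 * m₃) := by
    calc |A| * |D - A ^ 2| ≤ |A| * (|D| + |A| ^ 2) := by
          rw [← abs_pow]
          gcongr
          exact abs_sub _ _
      _ = |A| * |D| + |A| ^ 3 := by ring
      _ ≤ 3 * (q ^ 3 * m₃) := by linarith
  have hcumulant : |F - 3 * D * A + 2 * A ^ 3| ≤ 13 * (q ^ 3 * m₃) := by
    calc |F - 3 * D * A + 2 * A ^ 3| ≤ |F| + 3 * (|A| * |D|) + 2 * |A| ^ 3 := by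
          rw [sub_eq_add_neg]
          refine (abs_add_three _ _ _).trans_eq ?_
          simp only [abs_neg, abs_mul, abs_pow, abs_of_pos (zero_lt_three' ℝ),
            abs_of_pos (zero_lt_two' ℝ)]
          ring
      _ ≤ 13 * (q ^ 3 * m₃) := by linarith
  linarith

lemma abs_third_deriv_comp_log_partitionFn_le {K φ₁ φ₂ φ₃ : ℝ} (hs : s.Nonempty) (hq : 0 ≤ q)
    (hW : ∀ w ∈ s, 0 ≤ W w) (hx₁ : ∀ w ∈ s, |x₁ w| ≤ q * W w)
    (hx₂ : ∀ w ∈ s, |x₂ w| ≤ q ^ 2 * W w ^ 2) (hx₃ : ∀ w ∈ s, |x₃ w| ≤ q ^ 3 * W w ^ 3)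
    (h₁ : |φ₁| ≤ K) (h₂ : |φ₂| ≤ K) (h₃ : |φ₃| ≤ K) :
    |φ₃ * gibbs s E x₁ ^ 3 + 3 * φ₂ * gibbs s E x₁ *
        (gibbs s E (fun w => x₁ w ^ 2 + x₂ w) - gibbs s E x₁ ^ 2) +
      φ₁ * (gibbs s E (fun w => x₁ w ^ 3 + 3 * x₁ w * x₂ w + x₃ w) -
        3 * gibbs s E (fun w => x₁ w ^ 2 + x₂ w) * gibbs s E x₁ + 2 * gibbs s E x₁ ^ 3)| ≤
      23 * K * (q ^ 3 * gibbs s E (fun w => W w ^ 3)) := by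
  have hcumulants := abs_cumulants_le hq (gibbs_nonneg E hW) (abs_gibbs_le_mul E hx₁)
    (abs_gibbs_moment_two_le (E := E) hx₁ hx₂) (abs_gibbs_moment_three_le (E := E) hx₁ hx₂ hx₃)
    (gibbs_pow_three_le hs E hW) (gibbs_mul_gibbs_sq_le hs E hW)
  refine (abs_third_deriv_comp_le h₁ h₂ h₃).trans ?_
  exact (mul_le_mul_of_nonneg_left hcumulants ((abs_nonneg _).trans h₁)).trans_eq (by ring)

end Cumulants

section Segment

variable {g g₁ g₂ g₃ V : ℝ → ℝ} {c C θ : ℝ}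

lemma abs_neg_mul_mul_pow_le {x v B b : ℝ} {j : ℕ} (hj : j ≠ 0) (hθC : 1 ≤ θ * C) (hθ : 0 ≤ θ)
    (hx : |x| ≤ C * v ^ j) (hv : 0 ≤ v) (hb : |b| ≤ B) :
    |-(θ * (x * b ^ j))| ≤ (θ * C * B) ^ j * v ^ j := by
  have hB : 0 ≤ B := (abs_nonneg b).trans hb
  have hCv : 0 ≤ C * v ^ j := (abs_nonneg x).trans hx
  rw [abs_neg, abs_mul, abs_mul, abs_pow, abs_of_nonneg hθ]
  calc θ * (|x| * |b| ^ j) ≤ θ * (C * v ^ j * B ^ j) := by gcongr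
    _ = θ * C * (B * v) ^ j := by ring
    _ ≤ (θ * C) ^ j * (B * v) ^ j := by
        gcongr
        exact le_self_pow₀ hθC hj
    _ = (θ * C * B) ^ j * v ^ j := by ring

lemma IsTame.hasThreeDerivs_neg_energy (hg : IsTame g g₁ g₂ g₃ V c C) (θ r a b : ℝ) :
    HasThreeDerivs (fun t => -(r + θ * g (b * t + a))) (fun t => -(θ * (g₁ (b * t + a) * b)))
      (fun t => -(θ * (g₂ (b * t + a) * b ^ 2))) (fun t => -(θ * (g₃ (b * t + a) * b ^ 3))) := by
  have h := (hg.toHasThreeDerivs.comp_affine a b).const_add_const_mul r θ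
  exact ⟨fun t => (h.deriv₁ t).neg, fun t => (h.deriv₂ t).neg, fun t => (h.deriv₃ t).neg⟩

lemma IsTame.gibbs_cube_le (hg : IsTame g g₁ g₂ g₃ V c C) (hs : s.Nonempty) (hθ : 0 ≤ θ)
    {r a b : κ → ℝ} {B t : ℝ} (hb : ∀ w ∈ s, |b w| ≤ B) (ht : t ∈ Set.Icc (0 : ℝ) 1) :
    gibbs s (fun w => r w + θ * g (b w * t + a w)) (fun w => V (b w * t + a w) ^ 3) ≤
      C * (1 + 4 * c * (gibbs s r (fun w => |a w| ^ 3) + B ^ 3)) := by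
  have hassoc : gibbs s (fun w => r w + θ * g (b w * t + a w)) (fun w => V (b w * t + a w) ^ 3) ≤
      gibbs s r (fun w => V (b w * t + a w) ^ 3) :=
    gibbs_add_energy_le hs r _ _ fun w _ w' _ => by
      rw [← mul_sub, mul_assoc]
      exact mul_nonneg hθ (hg.comono _ _)
  have hgrowth : ∀ w ∈ s, V (b w * t + a w) ^ 3 ≤
      4 * C * c * |a w| ^ 3 + (C + 4 * C * c * B ^ 3) := fun w hw => by
    have hC := hg.one_le
    have hc := hg.c_nonneg
    have hbt : |b w * t| ≤ B := by
      rw [abs_mul, abs_of_nonneg ht.1]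
      exact (mul_le_of_le_one_right (abs_nonneg _) ht.2).trans (hb w hw)
    calc V (b w * t + a w) ^ 3 ≤ C * (1 + c * |b w * t + a w| ^ 3) := hg.growth _
      _ ≤ C * (1 + c * (4 * (|b w * t| ^ 3 + |a w| ^ 3))) := by
          gcongr
          exact abs_add_pow_three_le _ _
      _ ≤ C * (1 + c * (4 * (B ^ 3 + |a w| ^ 3))) := by gcongr
      _ = 4 * C * c * |a w| ^ 3 + (C + 4 * C * c * B ^ 3) := by ring
  refine hassoc.trans ((gibbs_mono r hgrowth).trans_eq ?_)
  rw [gibbs_add, gibbs_const_mul, gibbs_const hs]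
  ring

lemma isQuadratic_comp_log_partitionFn (s : Finset κ) (E y₁ y₂ : κ → ℝ) (φ₁ φ₂ : ℝ) :
    IsQuadratic s fun b => φ₁ * gibbs s E (fun w => y₁ w * b w) +
      (φ₂ * gibbs s E (fun w => y₁ w * b w) ^ 2 + φ₁ *
        (gibbs s E (fun w => (y₁ w * b w) ^ 2 + y₂ w * b w ^ 2) -
          gibbs s E (fun w => y₁ w * b w) ^ 2)) / 2 := by
  set q : κ → ℝ := fun w => Real.exp (-E w) / partitionFn s E
  have hlin (b : κ → ℝ) : gibbs s E (fun w => y₁ w * b w) = ∑ w ∈ s, q w * y₁ w * b w := by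
    simp only [gibbs_eq_sum_weights, q, mul_assoc]
  have hsq (b : κ → ℝ) : gibbs s E (fun w => (y₁ w * b w) ^ 2 + y₂ w * b w ^ 2) =
      ∑ w ∈ s, q w * (y₁ w ^ 2 + y₂ w) * b w ^ 2 := by
    simp only [gibbs_eq_sum_weights, q, mul_assoc, mul_pow, add_mul]
  have h := (((IsQuadratic.sum_mul s fun w => q w * y₁ w).const_mul φ₁).add
    ((IsQuadratic.sq_sum_mul s fun w => q w * y₁ w).const_mul ((φ₂ - φ₁) / 2))).add
    ((IsQuadratic.sum_mul_sq s fun w => q w * (y₁ w ^ 2 + y₂ w)).const_mul (φ₁ / 2))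
  convert h using 2 with b
  rw [hlin, hsq]
  ring

-- The polynomial does not depend on the perturbation `b`, so that it has the same mean for two
-- random perturbations with the same first two moments.
lemma IsTame.exists_isQuadratic_expansion (hg : IsTame g g₁ g₂ g₃ V c C) (hs : s.Nonempty) {k : ℝ}
    (m : ℝ) (hθ : 1 ≤ θ) (hk : |k| ≤ 1) (r a : κ → ℝ) :
    ∃ Q, IsQuadratic s Q ∧ ∀ (b : κ → ℝ) (B : ℝ), (∀ w ∈ s, |b w| ≤ B) →
      |Real.sigmoid (k * Real.log (partitionFn s fun w => r w + θ * g (b w + a w)) + m) -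
        Real.sigmoid (k * Real.log (partitionFn s fun w => r w + θ * g (a w)) + m) - Q b| ≤
      23 * |k| * ((θ * C * B) ^ 3 *
        (C * (1 + 4 * c * (gibbs s r (fun w => |a w| ^ 3) + B ^ 3)))) := by
  obtain ⟨φ₁, φ₂, φ₃, hφ, hφk⟩ := exists_hasThreeDerivs_sigmoid_affine hk m
  set L₀ := Real.log (partitionFn s fun w => r w + θ * g (a w))
  refine ⟨_, isQuadratic_comp_log_partitionFn s (fun w => r w + θ * g (a w))
    (fun w => -(θ * g₁ (a w))) (fun w => -(θ * g₂ (a w))) (φ₁ L₀) (φ₂ L₀), fun b B hb => ?_⟩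
  have hθ₀ : 0 ≤ θ := zero_le_one.trans hθ
  have hθC : 1 ≤ θ * C := one_le_mul_of_one_le_of_one_le hθ hg.one_le
  have hB : 0 ≤ B := hs.elim fun w hw => (abs_nonneg _).trans (hb w hw)
  have hf := hφ.comp (hasThreeDerivs_log_partitionFn hs fun w _ =>
    hg.hasThreeDerivs_neg_energy θ (r w) (a w) (b w))
  have htaylor := hf.abs_taylor_two_le (C := 23 * |k| * ((θ * C * B) ^ 3 *
    (C * (1 + 4 * c * (gibbs s r (fun w => |a w| ^ 3) + B ^ 3))))) fun t ht => ?_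
  · simp only [mul_one, mul_zero, zero_add] at htaylor
    simpa only [neg_mul, mul_assoc] using htaylor
  · refine (abs_third_deriv_comp_log_partitionFn_le hs (q := θ * C * B)
      (W := fun w => V (b w * t + a w)) (by positivity) (fun w _ => hg.V_nonneg _)
      (fun w hw => ?_) (fun w hw => ?_) (fun w hw => ?_) (hφk _).1 (hφk _).2.1 (hφk _).2.2).trans ?_
    · simpa only [pow_one] using abs_neg_mul_mul_pow_le one_ne_zero hθC hθ₀
        (by simpa only [pow_one] using hg.bound₁ (b w * t + a w)) (hg.V_nonneg _) (hb w hw)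
    · exact abs_neg_mul_mul_pow_le two_ne_zero hθC hθ₀ (hg.bound₂ _) (hg.V_nonneg _) (hb w hw)
    · exact abs_neg_mul_mul_pow_le three_ne_zero hθC hθ₀ (hg.bound₃ _) (hg.V_nonneg _) (hb w hw)
    · gcongr
      exact hg.gibbs_cube_le hs hθ₀ hb ht

end Segment

end Expansion

section ProductMeasure

variable {ι : Type*} {E : Type*} [MeasurableSpace E]

lemma measurable_update_prod [DecidableEq ι] (c : ι) :
    Measurable fun z : E × (ι → E) => Function.update z.2 c z.1 := by
  refine measurable_pi_iff.2 fun i => ?_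
  rcases eq_or_ne i c with rfl | h
  · simpa using measurable_fst
  · simp only [Function.update_of_ne h]
    fun_prop

variable [Fintype ι]

section Update

variable [DecidableEq ι]

lemma pi_update_eq_map (m : ι → Measure E) [∀ i, IsProbabilityMeasure (m i)] (c : ι)
    (μ : Measure E) [IsProbabilityMeasure μ] :
    Measure.pi (Function.update m c μ) =
      (μ.prod (Measure.pi m)).map fun z => Function.update z.2 c z.1 := by
  have : ∀ i, IsProbabilityMeasure (Function.update m c μ i) := fun i => by
    rcases eq_or_ne i c with rfl | h
    · simpa using ‹IsProbabilityMeasure μ›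
    · simpa [h] using inferInstanceAs (IsProbabilityMeasure (m i))
  have hmeas := measurable_update_prod (E := E) c
  refine Measure.pi_eq fun s hs => ?_
  rw [Measure.map_apply hmeas (MeasurableSet.univ_pi hs)]
  have hpre : (fun z : E × (ι → E) => Function.update z.2 c z.1) ⁻¹' Set.pi Set.univ s =
      s c ×ˢ Set.pi Set.univ (Function.update s c Set.univ) := by
    ext z
    simp only [Set.mem_preimage, Set.mem_pi, Set.mem_univ, true_implies, Set.mem_prod]
    constructor
    · intro h
      refine ⟨by simpa using h c, fun i => ?_⟩
      rcases eq_or_ne i c with rfl | hi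
      · simp
      · simpa [hi] using h i
    · rintro ⟨h1, h2⟩ i
      rcases eq_or_ne i c with rfl | hi
      · simpa using h1
      · simpa [hi] using h2 i
  rw [hpre, Measure.prod_prod, Measure.pi_pi,
    ← Finset.mul_prod_erase Finset.univ (fun i => Function.update m c μ i (s i))
      (Finset.mem_univ c),
    ← Finset.mul_prod_erase Finset.univ (fun i => m i (Function.update s c Set.univ i))
      (Finset.mem_univ c)]
  simp only [Function.update_self, measure_univ, one_mul]
  congr 1
  exact Finset.prod_congr rfl fun i hi => by
    simp only [Function.update_of_ne (Finset.ne_of_mem_erase hi)]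

section Swap

variable (m : ι → Measure E) [∀ i, IsProbabilityMeasure (m i)] (c : ι) (μ : Measure E)
  [IsProbabilityMeasure μ] {f : (ι → E) → ℝ}

lemma integrable_prod_update (hf : Measurable f) (hf₁ : ∀ y, |f y| ≤ 1) :
    Integrable (fun z : E × (ι → E) => f (Function.update z.2 c z.1)) (μ.prod (Measure.pi m)) :=
  Integrable.of_bound (hf.comp (measurable_update_prod c)).aestronglyMeasurable 1
    (ae_of_all _ fun _ => hf₁ _)

lemma integral_pi_update (hf : Measurable f) (hf₁ : ∀ y, |f y| ≤ 1) :
    ∫ y, f y ∂(Measure.pi (Function.update m c μ)) =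
      ∫ y, ∫ x, f (Function.update y c x) ∂μ ∂(Measure.pi m) := by
  rw [pi_update_eq_map, integral_map (measurable_update_prod c).aemeasurable
    hf.aestronglyMeasurable, integral_prod_symm _ (integrable_prod_update m c μ hf hf₁)]

lemma abs_integral_pi_update_sub_le (ν : Measure E) [IsProbabilityMeasure ν] (hf : Measurable f)
    (hf₁ : ∀ y, |f y| ≤ 1) {q : (ι → E) → ℝ} (hq : Integrable q (Measure.pi m))
    (h : ∀ y, |∫ x, f (Function.update y c x) ∂μ - ∫ x, f (Function.update y c x) ∂ν| ≤ q y) :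
    |∫ y, f y ∂(Measure.pi (Function.update m c μ)) -
      ∫ y, f y ∂(Measure.pi (Function.update m c ν))| ≤ ∫ y, q y ∂(Measure.pi m) := by
  have hμ := (integrable_prod_update m c μ hf hf₁).integral_prod_right
  have hν := (integrable_prod_update m c ν hf hf₁).integral_prod_right
  rw [integral_pi_update m c μ hf hf₁, integral_pi_update m c ν hf hf₁, ← integral_sub hμ hν]
  exact abs_integral_le_integral_abs.trans (integral_mono (hμ.sub hν).abs hq h)

end Swap

lemma abs_integral_pi_sub_le_sum (μ ν : ι → Measure E) (f : (ι → E) → ℝ) (err : ι → ℝ)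
    (h : ∀ (c : ι) (m : ι → Measure E), (∀ i, m i = μ i ∨ m i = ν i) →
      |∫ y, f y ∂(Measure.pi (Function.update m c (μ c))) -
        ∫ y, f y ∂(Measure.pi (Function.update m c (ν c)))| ≤ err c) :
    |∫ y, f y ∂(Measure.pi μ) - ∫ y, f y ∂(Measure.pi ν)| ≤ ∑ c, err c := by
  have hybrid : ∀ T : Finset ι, |∫ y, f y ∂(Measure.pi μ) -
      ∫ y, f y ∂(Measure.pi fun i => if i ∈ T then ν i else μ i)| ≤ ∑ c ∈ T, err c := by
    intro T
    induction T using Finset.induction_on with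
    | empty => simp
    | insert c T hc ih =>
      rw [Finset.sum_insert hc, add_comm]
      have hswap := h c (fun i => if i ∈ T then ν i else μ i) fun i => by
        by_cases hi : i ∈ T <;> simp [hi]
      have update_old : Function.update (fun i => if i ∈ T then ν i else μ i) c (μ c) =
          fun i => if i ∈ T then ν i else μ i := by
        refine Function.update_eq_iff.2 ⟨by simp [hc], fun _ _ => rfl⟩
      have update_new : Function.update (fun i => if i ∈ T then ν i else μ i) c (ν c) =
          fun i => if i ∈ insert c T then ν i else μ i := by
        refine Function.update_eq_iff.2 ⟨by simp, fun i hi => by simp [hi]⟩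
      rw [update_old, update_new] at hswap
      exact (abs_sub_le _ _ _).trans (add_le_add ih hswap)
  simpa using hybrid Finset.univ

end Update

lemma indepFun_pi_of_disjoint [Zero E] (m : ι → Measure E) [∀ i, IsProbabilityMeasure (m i)]
    {S T : Finset ι} (hST : Disjoint S T) {F₁ F₂ : (ι → E) → ℝ} (h₁ : Measurable F₁)
    (h₂ : Measurable F₂) (hS : ∀ y y', (∀ c ∈ S, y c = y' c) → F₁ y = F₁ y')
    (hT : ∀ y y', (∀ c ∈ T, y c = y' c) → F₂ y = F₂ y') :
    IndepFun F₁ F₂ (Measure.pi m) := by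
  classical
  have hind : iIndepFun (fun (i : ι) (ω : ι → E) => ω i) (Measure.pi m) :=
    iIndepFun_pi (X := fun _ => id) fun _ => aemeasurable_id
  have h := hind.indepFun_finset S T hST fun i => measurable_pi_apply i
  have ext_meas : ∀ U : Finset ι, Measurable fun (z : U → E) (c : ι) =>
      if hc : c ∈ U then z ⟨c, hc⟩ else 0 := by
    intro U
    refine measurable_pi_iff.2 fun c => ?_
    by_cases hc : c ∈ U
    · simpa [hc] using measurable_pi_apply _
    · simp [hc]
  have := h.comp (h₁.comp (ext_meas S)) (h₂.comp (ext_meas T))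
  convert this using 1
  · ext y
    exact hS _ _ fun c hc => by simp [hc]
  · ext y
    exact hT _ _ fun c hc => by simp [hc]

end ProductMeasure

section Moments

variable {Ω : Type*} [MeasurableSpace Ω] {P : Measure Ω} [IsProbabilityMeasure P]

lemma integrable_pow_of_memLp {f : Ω → ℝ} {q : ENNReal} (hf : MemLp f q P) {k : ℕ}
    (hk : (k : ENNReal) ≤ q) : Integrable (fun ω => f ω ^ k) P := by
  refine (hf.mono_exponent hk).integrable_norm_pow'.mono' (hf.1.pow k) (ae_of_all _ fun ω => ?_)
  rw [norm_pow]

lemma integral_add_pow_of_indepFun {X Y : Ω → ℝ} (hXY : IndepFun X Y P) {n : ℕ}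
    (hX : MemLp X n P) (hY : MemLp Y n P) :
    ∫ ω, (X ω + Y ω) ^ n ∂P =
      ∑ k ∈ Finset.range (n + 1), (∫ ω, X ω ^ k ∂P) * (∫ ω, Y ω ^ (n - k) ∂P) * n.choose k := by
  have hXk : ∀ k ∈ Finset.range (n + 1), Integrable (fun ω => X ω ^ k) P := fun k hk =>
    integrable_pow_of_memLp hX (mod_cast Finset.mem_range_succ_iff.1 hk)
  have hYk (k : ℕ) : Integrable (fun ω => Y ω ^ (n - k)) P :=
    integrable_pow_of_memLp hY (mod_cast Nat.sub_le n k)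
  have hind (k : ℕ) : IndepFun (fun ω => X ω ^ k) (fun ω => Y ω ^ (n - k)) P :=
    hXY.comp (measurable_id.pow_const k) (measurable_id.pow_const (n - k))
  have h_int : ∀ k ∈ Finset.range (n + 1),
      Integrable (fun ω => X ω ^ k * Y ω ^ (n - k) * (n.choose k : ℝ)) P := fun k hk =>
    ((hind k).integrable_mul (hXk k hk) (hYk k)).mul_const _
  simp_rw [add_pow]
  rw [integral_finsetSum _ h_int]
  refine Finset.sum_congr rfl fun k hk => ?_
  rw [integral_mul_const, (hind k).integral_fun_mul_eq_mul_integral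
    (hXk k hk).aestronglyMeasurable (hYk k).aestronglyMeasurable]

section Sum

variable {ι : Type*} {Z : ι → Ω → ℝ} {S : Finset ι}

lemma integral_sum_eq_zero (hL : ∀ i ∈ S, MemLp (Z i) 4 P) (h₀ : ∀ i ∈ S, ∫ ω, Z i ω ∂P = 0) :
    ∫ ω, ∑ i ∈ S, Z i ω ∂P = 0 := by
  rw [integral_finsetSum _ fun i hi => (hL i hi).integrable (by norm_num)]
  exact Finset.sum_eq_zero h₀

lemma integral_sum_sq_eq (hZ : iIndepFun Z P) (hm : ∀ i, Measurable (Z i))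
    (hL : ∀ i ∈ S, MemLp (Z i) 4 P) (h₀ : ∀ i ∈ S, ∫ ω, Z i ω ∂P = 0) :
    ∫ ω, (∑ i ∈ S, Z i ω) ^ 2 ∂P = ∑ i ∈ S, ∫ ω, Z i ω ^ 2 ∂P := by
  classical
  induction S using Finset.induction_on with
  | empty => simp
  | insert c S hc ih =>
    rw [Finset.forall_mem_insert] at hL h₀
    have hcS : IndepFun (Z c) (fun ω => ∑ i ∈ S, Z i ω) P := by
      simpa only [← Finset.sum_fn] using (hZ.indepFun_finsetSum_of_notMem hm hc).symm
    have hbinomial := integral_add_pow_of_indepFun hcS (n := 2)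
      (hL.1.mono_exponent (by norm_num)) ((memLp_finsetSum S hL.2).mono_exponent (by norm_num))
    simp_rw [Finset.sum_insert hc, hbinomial, ← ih hL.2 h₀.2]
    simp [Finset.sum_range_succ, h₀.1]
    ring

lemma integral_sum_pow_four_le (hZ : iIndepFun Z P) (hm : ∀ i, Measurable (Z i))
    (hL : ∀ i ∈ S, MemLp (Z i) 4 P) (h₀ : ∀ i ∈ S, ∫ ω, Z i ω ∂P = 0) :
    ∫ ω, (∑ i ∈ S, Z i ω) ^ 4 ∂P ≤
      3 * (∑ i ∈ S, ∫ ω, Z i ω ^ 2 ∂P) ^ 2 + ∑ i ∈ S, ∫ ω, Z i ω ^ 4 ∂P := by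
  classical
  induction S using Finset.induction_on with
  | empty => simp
  | insert c S hc ih =>
    rw [Finset.forall_mem_insert] at hL h₀
    have hcS : IndepFun (Z c) (fun ω => ∑ i ∈ S, Z i ω) P := by
      simpa only [← Finset.sum_fn] using (hZ.indepFun_finsetSum_of_notMem hm hc).symm
    have hbinomial : ∫ ω, (Z c ω + ∑ i ∈ S, Z i ω) ^ 4 ∂P = ∫ ω, Z c ω ^ 4 ∂P +
        6 * ((∫ ω, Z c ω ^ 2 ∂P) * ∑ i ∈ S, ∫ ω, Z i ω ^ 2 ∂P) +
        ∫ ω, (∑ i ∈ S, Z i ω) ^ 4 ∂P := by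
      rw [integral_add_pow_of_indepFun hcS hL.1 (memLp_finsetSum S hL.2),
        ← integral_sum_sq_eq hZ hm hL.2 h₀.2]
      simp [Finset.sum_range_succ, h₀.1, integral_sum_eq_zero hL.2 h₀.2, Nat.choose]
      ring
    simp_rw [Finset.sum_insert hc, hbinomial]
    nlinarith [ih hL.2 h₀.2, sq_nonneg (∫ ω, Z c ω ^ 2 ∂P)]

end Sum

end Moments

section GibbsIntegral

variable {Ω : Type*} [MeasurableSpace Ω]

section RandomGibbs

variable {κ : Type*} {s : Finset κ} {P : Measure Ω} {E φ : Ω → κ → ℝ}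

lemma measurable_partitionFn (s : Finset κ) (hE : ∀ w, Measurable fun ω => E ω w) :
    Measurable fun ω => partitionFn s (E ω) :=
  Finset.measurable_fun_sum s fun w _ => (hE w).neg.exp

lemma measurable_gibbs_weight (s : Finset κ) (hE : ∀ w, Measurable fun ω => E ω w) (w : κ) :
    Measurable fun ω => Real.exp (-E ω w) / partitionFn s (E ω) :=
  (hE w).neg.exp.div (measurable_partitionFn s hE)

lemma gibbs_weight_nonneg (hs : s.Nonempty) (F : κ → ℝ) (w : κ) :
    0 ≤ Real.exp (-F w) / partitionFn s F :=
  div_nonneg (Real.exp_pos _).le (partitionFn_pos hs _).le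

lemma gibbs_weight_le_one (hs : s.Nonempty) (F : κ → ℝ) {w : κ} (hw : w ∈ s) :
    Real.exp (-F w) / partitionFn s F ≤ 1 := by
  rw [div_le_one (partitionFn_pos hs _)]
  exact Finset.single_le_sum (f := fun w => Real.exp (-F w)) (fun _ _ => (Real.exp_pos _).le) hw

lemma integrable_gibbs_weight [IsFiniteMeasure P] (hs : s.Nonempty)
    (hE : ∀ w, Measurable fun ω => E ω w) {w : κ} (hw : w ∈ s) :
    Integrable (fun ω => Real.exp (-E ω w) / partitionFn s (E ω)) P :=
  Integrable.of_bound (measurable_gibbs_weight s hE w).aestronglyMeasurable 1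
    (ae_of_all _ fun ω => by
      rw [Real.norm_eq_abs, abs_of_nonneg (gibbs_weight_nonneg hs _ _)]
      exact gibbs_weight_le_one hs _ hw)

lemma integrable_gibbs_weight_mul [IsFiniteMeasure P] (hs : s.Nonempty)
    (hE : ∀ w, Measurable fun ω => E ω w) (hφ : ∀ w ∈ s, Integrable (fun ω => φ ω w) P)
    (hind : ∀ w ∈ s, IndepFun (fun ω => Real.exp (-E ω w) / partitionFn s (E ω))
      (fun ω => φ ω w) P) :
    ∀ w ∈ s, Integrable (fun ω => Real.exp (-E ω w) / partitionFn s (E ω) * φ ω w) P :=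
  fun w hw => (hind w hw).integrable_mul (integrable_gibbs_weight hs hE hw) (hφ w hw)

lemma integrable_gibbs [IsFiniteMeasure P] (hs : s.Nonempty) (hE : ∀ w, Measurable fun ω => E ω w)
    (hφ : ∀ w ∈ s, Integrable (fun ω => φ ω w) P)
    (hind : ∀ w ∈ s, IndepFun (fun ω => Real.exp (-E ω w) / partitionFn s (E ω))
      (fun ω => φ ω w) P) :
    Integrable (fun ω => gibbs s (E ω) (φ ω)) P := by
  simp_rw [gibbs_eq_sum_weights]
  exact integrable_finsetSum _ (integrable_gibbs_weight_mul hs hE hφ hind)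

lemma integral_gibbs_le [IsProbabilityMeasure P] {K : ℝ} (hs : s.Nonempty)
    (hE : ∀ w, Measurable fun ω => E ω w) (hφ : ∀ w ∈ s, Integrable (fun ω => φ ω w) P)
    (hK : ∀ w ∈ s, ∫ ω, φ ω w ∂P ≤ K)
    (hind : ∀ w ∈ s, IndepFun (fun ω => Real.exp (-E ω w) / partitionFn s (E ω))
      (fun ω => φ ω w) P) :
    ∫ ω, gibbs s (E ω) (φ ω) ∂P ≤ K := by
  have hweight := fun w (hw : w ∈ s) => integrable_gibbs_weight (P := P) hs hE hw
  simp_rw [gibbs_eq_sum_weights]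
  rw [integral_finsetSum _ (integrable_gibbs_weight_mul hs hE hφ hind)]
  calc ∑ w ∈ s, ∫ ω, Real.exp (-E ω w) / partitionFn s (E ω) * φ ω w ∂P
      ≤ ∑ w ∈ s, (∫ ω, Real.exp (-E ω w) / partitionFn s (E ω) ∂P) * K := by
        refine Finset.sum_le_sum fun w hw => ?_
        rw [(hind w hw).integral_fun_mul_eq_mul_integral (hweight w hw).aestronglyMeasurable
          (hφ w hw).aestronglyMeasurable]
        exact mul_le_mul_of_nonneg_left (hK w hw)
          (integral_nonneg fun ω => gibbs_weight_nonneg hs (E ω) w)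
    _ = K := by
        have hsum : ∀ ω, ∑ w ∈ s, Real.exp (-E ω w) / partitionFn s (E ω) = 1 := fun ω => by
          rw [← Finset.sum_div]
          exact div_self (partitionFn_pos hs _).ne'
        rw [← Finset.sum_mul, ← integral_finsetSum _ hweight]
        simp [hsum]

end RandomGibbs

variable {F Q D : Ω → ℝ} {F₀ d : ℝ}

lemma abs_integral_sub_sub_le {m : Measure Ω} [IsProbabilityMeasure m] (hF : Integrable F m)
    (hQ : Integrable Q m) (hD : Integrable D m) (h : ∀ x, |F x - F₀ - Q x| ≤ D x) :
    |∫ x, F x ∂m - F₀ - ∫ x, Q x ∂m| ≤ ∫ x, D x ∂m := by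
  have hFF₀ : Integrable (fun x => F x - F₀) m := hF.sub (integrable_const _)
  have hintegral : ∫ x, (F x - F₀ - Q x) ∂m = ∫ x, F x ∂m - F₀ - ∫ x, Q x ∂m := by
    rw [integral_sub hFF₀ hQ, integral_sub hF (integrable_const _)]
    simp
  rw [← hintegral]
  exact abs_integral_le_integral_abs.trans (integral_mono (hFF₀.sub hQ).abs hD h)

lemma abs_integral_sub_le_of_expansion {μ ν : Measure Ω} [IsProbabilityMeasure μ]
    [IsProbabilityMeasure ν] (hFμ : Integrable F μ) (hFν : Integrable F ν) (hQμ : Integrable Q μ)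
    (hQν : Integrable Q ν) (hQ : ∫ x, Q x ∂μ = ∫ x, Q x ∂ν) (hDμ : Integrable D μ)
    (hDν : Integrable D ν) (hdμ : ∫ x, D x ∂μ ≤ d) (hdν : ∫ x, D x ∂ν ≤ d)
    (h : ∀ x, |F x - F₀ - Q x| ≤ D x) :
    |∫ x, F x ∂μ - ∫ x, F x ∂ν| ≤ 2 * d := by
  obtain ⟨hμ_lower, hμ_upper⟩ := abs_le.1 (abs_integral_sub_sub_le hFμ hQμ hDμ h)
  obtain ⟨hν_lower, hν_upper⟩ := abs_le.1 (abs_integral_sub_sub_le hFν hQν hDν h)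
  exact abs_le.2 ⟨by linarith, by linarith⟩

end GibbsIntegral

section Energy

variable {n p : ℕ}

/-- The rescaled regularized empirical risk `ρ(w) + θ ∑ᵢ g(Aᵢᵀ w - eᵢ)`, as the energy of a Gibbs
measure on the weight vectors `w`. -/
def energy (g : ℝ → ℝ) (θ : ℝ) (ρ : (Fin p → ℝ) → ℝ) (e : Fin n → ℝ) (A : Fin n → Fin p → ℝ)
    (w : Fin p → ℝ) : ℝ :=
  ρ w + ∑ i, θ * g (A i ⬝ᵥ w - e i)

/-- The energy without the contribution of the `i`-th row. -/
def offRowEnergy (g : ℝ → ℝ) (θ : ℝ) (ρ : (Fin p → ℝ) → ℝ) (e : Fin n → ℝ) (i : Fin n)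
    (A : Fin n → Fin p → ℝ) (w : Fin p → ℝ) : ℝ :=
  ρ w + ∑ i' ∈ Finset.univ.erase i, θ * g (A i' ⬝ᵥ w - e i')

/-- A smooth step function of the soft minimum of the energy over the finite set `s`; the slope is
`k` and the soft minimum is minus the logarithm of the partition function. -/
def softTest (s : Finset (Fin p → ℝ)) (g : ℝ → ℝ) (θ : ℝ) (ρ : (Fin p → ℝ) → ℝ) (k m : ℝ)
    (e : Fin n → ℝ) (A : Fin n → Fin p → ℝ) : ℝ :=
  Real.sigmoid (k * Real.log (partitionFn s (energy g θ ρ e A)) + m)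

variable {s : Finset (Fin p → ℝ)} {g : ℝ → ℝ} (hg : Continuous g) (θ : ℝ) (ρ : (Fin p → ℝ) → ℝ)

lemma abs_softTest_le_one (s : Finset (Fin p → ℝ)) (g : ℝ → ℝ) (k m : ℝ) (e : Fin n → ℝ)
    (A : Fin n → Fin p → ℝ) : |softTest s g θ ρ k m e A| ≤ 1 := by
  rw [softTest, abs_of_nonneg (Real.sigmoid_nonneg _)]
  exact Real.sigmoid_le_one _

lemma continuous_dotProduct_right (w : Fin p → ℝ) : Continuous fun x : Fin p → ℝ => x ⬝ᵥ w :=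
  continuous_id.dotProduct continuous_const

include hg

lemma continuous_energy (w : Fin p → ℝ) :
    Continuous fun z : (Fin n → Fin p → ℝ) × (Fin n → ℝ) => energy g θ ρ z.2 z.1 w := by
  unfold energy dotProduct
  fun_prop

lemma continuous_offRowEnergy (e : Fin n → ℝ) (i : Fin n) (w : Fin p → ℝ) :
    Continuous fun A : Fin n → Fin p → ℝ => offRowEnergy g θ ρ e i A w := by
  unfold offRowEnergy dotProduct
  fun_prop

lemma continuous_softTest (hs : s.Nonempty) (k m : ℝ) :
    Continuous fun z : (Fin n → Fin p → ℝ) × (Fin n → ℝ) => softTest s g θ ρ k m z.2 z.1 := by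
  refine continuous_sigmoid.comp ((continuous_const.mul (Continuous.log ?_ fun z =>
    (partitionFn_pos hs _).ne')).add continuous_const)
  exact continuous_finsetSum _ fun w _ => (continuous_energy hg θ ρ w).neg.rexp

end Energy

section Assemble

variable {ι : Type*} [Fintype ι] {n p : ℕ} (row : ι → Fin n)

/-- The design whose `i`-th row is the sum of the cells `c` with `row c = i`. -/
def assemble (y : ι → Fin p → ℝ) (i : Fin n) (j : Fin p) : ℝ :=
  ∑ c, if row c = i then y c j else 0

lemma continuous_assemble :
    Continuous (assemble row : (ι → Fin p → ℝ) → Fin n → Fin p → ℝ) := by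
  refine continuous_pi fun i => continuous_pi fun j => continuous_finsetSum _ fun c _ => ?_
  by_cases h : row c = i
  · simp only [h, if_true]
    fun_prop
  · simp only [h, if_false]
    exact continuous_const

lemma assemble_dotProduct (y : ι → Fin p → ℝ) (i : Fin n) (w : Fin p → ℝ) :
    assemble row y i ⬝ᵥ w = ∑ c with row c = i, y c ⬝ᵥ w := by
  simp only [assemble, dotProduct, Finset.sum_mul, ite_mul, zero_mul]
  rw [Finset.sum_comm, Finset.sum_filter]
  refine Finset.sum_congr rfl fun c _ => ?_
  by_cases h : row c = i <;> simp [h]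

lemma offRowEnergy_assemble_congr (g : ℝ → ℝ) (θ : ℝ) (ρ : (Fin p → ℝ) → ℝ) (e : Fin n → ℝ)
    {i : Fin n} {y y' : ι → Fin p → ℝ} (h : ∀ c, row c ≠ i → y c = y' c) :
    offRowEnergy g θ ρ e i (assemble row y) = offRowEnergy g θ ρ e i (assemble row y') := by
  funext w
  refine congrArg (ρ w + ·) (Finset.sum_congr rfl fun i' hi' => ?_)
  have hrow : ∑ c with row c = i', y c ⬝ᵥ w = ∑ c with row c = i', y' c ⬝ᵥ w :=
    Finset.sum_congr rfl fun c hc => by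
      rw [h c ((Finset.mem_filter.1 hc).2.trans_ne (Finset.ne_of_mem_erase hi'))]
  simp only [assemble_dotProduct, hrow]

variable [DecidableEq ι]

/-- The cells other than `c` in the row of `c`. -/
def siblings (c : ι) : Finset ι := (Finset.univ.filter fun c' => row c' = row c).erase c

/-- The residual of the row of `c` when the cell `c` itself is left out. -/
def rowResidual (e : Fin n → ℝ) (c : ι) (y : ι → Fin p → ℝ) (w : Fin p → ℝ) : ℝ :=
  ∑ c' ∈ siblings row c, y c' ⬝ᵥ w - e (row c)

lemma energy_assemble_update (g : ℝ → ℝ) (θ : ℝ) (ρ : (Fin p → ℝ) → ℝ) (e : Fin n → ℝ)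
    (y : ι → Fin p → ℝ) (c : ι) (x w : Fin p → ℝ) :
    energy g θ ρ e (assemble row (Function.update y c x)) w =
      offRowEnergy g θ ρ e (row c) (assemble row y) w +
        θ * g (x ⬝ᵥ w + rowResidual row e c y w) := by
  have hoff := congrFun (offRowEnergy_assemble_congr row g θ ρ e (i := row c) (y := y)
    (y' := Function.update y c x) fun c' hc' => by
      rw [Function.update_of_ne fun h => hc' (congrArg row h)]) w
  have hrow : assemble row (Function.update y c x) (row c) ⬝ᵥ w =
      x ⬝ᵥ w + ∑ c' ∈ siblings row c, y c' ⬝ᵥ w := by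
    rw [assemble_dotProduct, ← Finset.add_sum_erase _ _ (by simp : c ∈ Finset.univ.filter
      fun c' => row c' = row c), Function.update_self]
    exact congrArg _ (Finset.sum_congr rfl fun c' hc' => by
      rw [Function.update_of_ne (Finset.ne_of_mem_erase hc')])
  rw [hoff, energy, ← Finset.add_sum_erase _ _ (Finset.mem_univ (row c)), hrow, offRowEnergy,
    rowResidual]
  ring_nf

end Assemble

section CellBounds

variable {p : ℕ}

/-- Moment bounds for the law `μ` of a cell: `v₂`, `v₄` bound the second and fourth moments of its
linear functionals indexed by the finite set `s`, while `b` bounds the third moment of an envelope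
`B` of these functionals and, for losses of quadratic growth (`c = 1`), its sixth moment. -/
structure HasCellBounds (μ : Measure (Fin p → ℝ)) (s : Finset (Fin p → ℝ)) (B : (Fin p → ℝ) → ℝ)
    (c v₂ v₄ b : ℝ) : Prop extends IsProbabilityMeasure μ where
  memLp : ∀ w ∈ s, MemLp (fun x => x ⬝ᵥ w) 4 μ
  mean : ∀ w ∈ s, ∫ x, x ⬝ᵥ w ∂μ = 0
  sq_le : ∀ w ∈ s, ∫ x, (x ⬝ᵥ w) ^ 2 ∂μ ≤ v₂
  four_le : ∀ w ∈ s, ∫ x, (x ⬝ᵥ w) ^ 4 ∂μ ≤ v₄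
  integrable_three : Integrable (fun x => B x ^ 3) μ
  integrable_six : Integrable (fun x => c * B x ^ 6) μ
  three_le : ∫ x, B x ^ 3 ∂μ ≤ b
  six_le : ∫ x, c * B x ^ 6 ∂μ ≤ b

namespace HasCellBounds

variable {μ ν : Measure (Fin p → ℝ)} {s : Finset (Fin p → ℝ)} {B : (Fin p → ℝ) → ℝ}
  {c v₂ v₄ b : ℝ}

section Quadratic

variable (hμ : HasCellBounds μ s B c v₂ v₄ b) (u : (Fin p → ℝ) → ℝ)
  (v : (Fin p → ℝ) → (Fin p → ℝ) → ℝ)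

include hμ

lemma integrable_linear : ∀ w ∈ s, Integrable (fun x => u w * (x ⬝ᵥ w)) μ := fun w hw =>
  have := hμ.toIsProbabilityMeasure
  ((hμ.memLp w hw).integrable (by norm_num)).const_mul _

lemma integrable_bilinear :
    ∀ w ∈ s, ∀ w' ∈ s, Integrable (fun x => v w w' * ((x ⬝ᵥ w) * (x ⬝ᵥ w'))) μ := by
  have := hμ.toIsProbabilityMeasure
  have hL₂ : ∀ w ∈ s, MemLp (fun x => x ⬝ᵥ w) 2 μ := fun w hw =>
    (hμ.memLp w hw).mono_exponent (by norm_num)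
  exact fun w hw w' hw' => ((hL₂ w hw).integrable_mul (hL₂ w' hw')).const_mul _

lemma integrable_isQuadratic {Q : ((Fin p → ℝ) → ℝ) → ℝ} (hQ : IsQuadratic s Q) :
    Integrable (fun x => Q fun w => x ⬝ᵥ w) μ := by
  obtain ⟨u, v, hQ⟩ := hQ
  simp_rw [hQ]
  exact (integrable_finsetSum _ (hμ.integrable_linear u)).add (integrable_finsetSum _ fun w hw =>
    integrable_finsetSum _ (hμ.integrable_bilinear v w hw))

lemma integral_quadratic :
    ∫ x, (∑ w ∈ s, u w * (x ⬝ᵥ w) + ∑ w ∈ s, ∑ w' ∈ s, v w w' * ((x ⬝ᵥ w) * (x ⬝ᵥ w'))) ∂μ =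
      ∑ w ∈ s, ∑ w' ∈ s, v w w' * ∫ x, (x ⬝ᵥ w) * (x ⬝ᵥ w') ∂μ := by
  have hlinear := hμ.integrable_linear u
  have hbilinear := hμ.integrable_bilinear v
  rw [integral_add (integrable_finsetSum _ hlinear) (integrable_finsetSum _ fun w hw =>
    integrable_finsetSum _ (hbilinear w hw)), integral_finsetSum _ hlinear,
    integral_finsetSum _ fun w hw => integrable_finsetSum _ (hbilinear w hw)]
  have hzero : ∑ w ∈ s, ∫ x, u w * (x ⬝ᵥ w) ∂μ = 0 := Finset.sum_eq_zero fun w hw => by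
    rw [integral_const_mul, hμ.mean w hw, mul_zero]
  rw [hzero, zero_add]
  refine Finset.sum_congr rfl fun w hw => ?_
  rw [integral_finsetSum _ (hbilinear w hw)]
  exact Finset.sum_congr rfl fun w' _ => integral_const_mul _ _

end Quadratic

lemma integral_isQuadratic_eq (hμ : HasCellBounds μ s B c v₂ v₄ b)
    (hν : HasCellBounds ν s B c v₂ v₄ b)
    (hcov : ∀ w ∈ s, ∀ w' ∈ s,
      ∫ x, (x ⬝ᵥ w) * (x ⬝ᵥ w') ∂μ = ∫ x, (x ⬝ᵥ w) * (x ⬝ᵥ w') ∂ν)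
    {Q : ((Fin p → ℝ) → ℝ) → ℝ} (hQ : IsQuadratic s Q) :
    ∫ x, Q (fun w => x ⬝ᵥ w) ∂μ = ∫ x, Q (fun w => x ⬝ᵥ w) ∂ν := by
  obtain ⟨u, v, hQ⟩ := hQ
  simp_rw [hQ]
  rw [hμ.integral_quadratic, hν.integral_quadratic]
  exact Finset.sum_congr rfl fun w hw => Finset.sum_congr rfl fun w' hw' => by
    rw [hcov w hw w' hw']

section Remainder

variable (hμ : HasCellBounds μ s B c v₂ v₄ b) {K : ℝ} (Ψ : ℝ)

include hμ

lemma integrable_remainder (K : ℝ) :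
    Integrable (fun x => K * (1 + 4 * c * Ψ) * B x ^ 3 + K * 4 * (c * B x ^ 6)) μ :=
  (hμ.integrable_three.const_mul _).add (hμ.integrable_six.const_mul _)

lemma integral_remainder_le (hK : 0 ≤ K) (hc : 0 ≤ c) (hΨ : 0 ≤ Ψ) :
    ∫ x, (K * (1 + 4 * c * Ψ) * B x ^ 3 + K * 4 * (c * B x ^ 6)) ∂μ ≤
      K * b * (5 + 4 * c * Ψ) := by
  rw [integral_add (hμ.integrable_three.const_mul _) (hμ.integrable_six.const_mul _),
    integral_const_mul, integral_const_mul]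
  calc K * (1 + 4 * c * Ψ) * ∫ x, B x ^ 3 ∂μ + K * 4 * ∫ x, c * B x ^ 6 ∂μ
      ≤ K * (1 + 4 * c * Ψ) * b + K * 4 * b := by
        gcongr
        exacts [hμ.three_le, hμ.six_le]
    _ = K * b * (5 + 4 * c * Ψ) := by ring

end Remainder

end HasCellBounds

end CellBounds

section RowResidual

variable {ι : Type*} [Fintype ι] [DecidableEq ι] {n p : ℕ} {row : ι → Fin n}
  {m : ι → Measure (Fin p → ℝ)} [∀ i, IsProbabilityMeasure (m i)] {s : Finset (Fin p → ℝ)}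
  {B : (Fin p → ℝ) → ℝ} {c₀ : ℝ} {v₂ v₄ b : ι → ℝ} {V₂ V₄ : ℝ} {w : Fin p → ℝ}

omit [Fintype ι] [DecidableEq ι] in
lemma measurable_cell_dotProduct (c : ι) (w : Fin p → ℝ) :
    Measurable fun y : ι → Fin p → ℝ => y c ⬝ᵥ w :=
  (continuous_dotProduct_right w).measurable.comp (measurable_pi_apply c)

lemma measurable_rowResidual (row : ι → Fin n) (e : Fin n → ℝ) (c : ι) (w : Fin p → ℝ) :
    Measurable fun y => rowResidual row e c y w :=
  (Finset.measurable_fun_sum _ fun c' _ => measurable_cell_dotProduct c' w).sub_const _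

lemma sum_siblings_le {a v : ι → ℝ} {V : ℝ} (ha₀ : ∀ c, 0 ≤ a c) (ha : ∀ c, a c ≤ v c)
    (hV : ∀ i, ∑ c with row c = i, v c ≤ V) (c : ι) : ∑ c' ∈ siblings row c, a c' ≤ V :=
  (Finset.sum_le_sum fun c' _ => ha c').trans <|
    (Finset.sum_le_sum_of_subset_of_nonneg (Finset.erase_subset _ _) fun c' _ _ =>
      (ha₀ c').trans (ha c')).trans (hV (row c))

variable (hm : ∀ i, HasCellBounds (m i) s B c₀ (v₂ i) (v₄ i) (b i)) (hw : w ∈ s)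
  (e : Fin n → ℝ) (c : ι)

include hm hw

omit [DecidableEq ι] in
lemma memLp_cell_dotProduct (c' : ι) :
    MemLp (fun y : ι → Fin p → ℝ => y c' ⬝ᵥ w) 4 (Measure.pi m) :=
  ((hm c').memLp w hw).comp_measurePreserving (measurePreserving_eval m c')

lemma memLp_sum_siblings :
    MemLp (fun y : ι → Fin p → ℝ => ∑ c' ∈ siblings row c, y c' ⬝ᵥ w) 4 (Measure.pi m) :=
  memLp_finsetSum _ fun c' _ => memLp_cell_dotProduct hm hw c'

lemma memLp_rowResidual : MemLp (fun y => rowResidual row e c y w) 4 (Measure.pi m) :=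
  (memLp_sum_siblings hm hw c).sub (memLp_const _)

lemma integrable_abs_rowResidual_pow_three :
    Integrable (fun y => |rowResidual row e c y w| ^ 3) (Measure.pi m) := by
  simp_rw [← abs_pow]
  exact (integrable_pow_of_memLp (memLp_rowResidual hm hw e c) (by norm_num)).abs

variable (hV₂ : ∀ i, ∑ c with row c = i, v₂ c ≤ V₂) (hV₄ : ∀ i, ∑ c with row c = i, v₄ c ≤ V₄)

include hV₂ hV₄

lemma integral_sum_siblings_pow_four_le :
    ∫ y : ι → Fin p → ℝ, (∑ c' ∈ siblings row c, y c' ⬝ᵥ w) ^ 4 ∂(Measure.pi m) ≤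
      3 * V₂ ^ 2 + V₄ := by
  have hdot := (continuous_dotProduct_right w).measurable
  have hmarginal : ∀ (i : ι) {f : (Fin p → ℝ) → ℝ}, Measurable f →
      ∫ y, f ((y : ι → Fin p → ℝ) i) ∂(Measure.pi m) = ∫ x, f x ∂(m i) := fun i f hf =>
    integral_comp_eval hf.aestronglyMeasurable
  have hfour := integral_sum_pow_four_le (S := siblings row c)
    (iIndepFun_pi (X := fun _ x => x ⬝ᵥ w) fun _ => hdot.aemeasurable)
    (fun i => measurable_cell_dotProduct i w) (fun i _ => memLp_cell_dotProduct hm hw i)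
    (fun i _ => (hmarginal i hdot).trans ((hm i).mean w hw))
  have hsum₂ : ∑ i ∈ siblings row c, ∫ y, ((y : ι → Fin p → ℝ) i ⬝ᵥ w) ^ 2 ∂(Measure.pi m) ≤ V₂ :=
    sum_siblings_le (fun _ => integral_nonneg fun _ => sq_nonneg _)
      (fun i => (hmarginal i (hdot.pow_const 2)).trans_le ((hm i).sq_le w hw)) hV₂ c
  have hsum₄ : ∑ i ∈ siblings row c, ∫ y, ((y : ι → Fin p → ℝ) i ⬝ᵥ w) ^ 4 ∂(Measure.pi m) ≤ V₄ :=
    sum_siblings_le (fun _ => integral_nonneg fun _ => by positivity)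
      (fun i => (hmarginal i (hdot.pow_const 4)).trans_le ((hm i).four_le w hw)) hV₄ c
  have hsq := pow_le_pow_left₀ (Finset.sum_nonneg fun i _ => integral_nonneg fun _ =>
    sq_nonneg _) hsum₂ 2
  linarith

lemma integral_abs_rowResidual_pow_three_le :
    ∫ y, |rowResidual row e c y w| ^ 3 ∂(Measure.pi m) ≤
      4 * (1 + 3 * V₂ ^ 2 + V₄ + |e (row c)| ^ 3) := by
  have hcube : ∀ t : ℝ, |t| ^ 3 ≤ 1 + t ^ 4 := fun t => by
    rw [← Even.pow_abs (by decide : Even 4) t]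
    nlinarith [abs_nonneg t, sq_nonneg (|t| ^ 2 - |t|), sq_nonneg (|t| ^ 2 - 1),
      sq_nonneg (|t| - 1), sq_nonneg (|t| ^ 2)]
  have h_int₄ : Integrable (fun y : ι → Fin p → ℝ => (∑ c' ∈ siblings row c, y c' ⬝ᵥ w) ^ 4)
      (Measure.pi m) := integrable_pow_of_memLp (memLp_sum_siblings hm hw c) (by norm_num)
  have h_int : Integrable (fun y : ι → Fin p → ℝ =>
      (∑ c' ∈ siblings row c, y c' ⬝ᵥ w) ^ 4 + (1 + |e (row c)| ^ 3)) (Measure.pi m) :=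
    h_int₄.add (integrable_const _)
  calc ∫ y, |rowResidual row e c y w| ^ 3 ∂(Measure.pi m)
      ≤ ∫ y : ι → Fin p → ℝ, 4 * ((∑ c' ∈ siblings row c, y c' ⬝ᵥ w) ^ 4 +
          (1 + |e (row c)| ^ 3)) ∂(Measure.pi m) := by
        refine integral_mono (integrable_abs_rowResidual_pow_three hm hw e c) (h_int.const_mul 4)
          fun y => ?_
        have h := abs_add_pow_three_le (∑ c' ∈ siblings row c, y c' ⬝ᵥ w) (-e (row c))
        rw [abs_neg, ← sub_eq_add_neg] at h
        exact h.trans (by linarith [hcube (∑ c' ∈ siblings row c, y c' ⬝ᵥ w)])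
    _ = 4 * (∫ y : ι → Fin p → ℝ, (∑ c' ∈ siblings row c, y c' ⬝ᵥ w) ^ 4 ∂(Measure.pi m) +
          (1 + |e (row c)| ^ 3)) := by
        rw [integral_const_mul, integral_add h_int₄ (integrable_const _)]
        simp
    _ ≤ 4 * (1 + 3 * V₂ ^ 2 + V₄ + |e (row c)| ^ 3) := by
        linarith [integral_sum_siblings_pow_four_le hm hw c hV₂ hV₄]

end RowResidual

section Lindeberg

variable {ι : Type*} [Fintype ι] [DecidableEq ι] {n p : ℕ} {row : ι → Fin n}
  {s : Finset (Fin p → ℝ)} {B : (Fin p → ℝ) → ℝ} {c₀ : ℝ} (θ : ℝ) (ρ : (Fin p → ℝ) → ℝ)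
  (e : Fin n → ℝ)

section Residual

variable {m : ι → Measure (Fin p → ℝ)} [∀ i, IsProbabilityMeasure (m i)]

omit [DecidableEq ι] in
lemma measurable_offRowEnergy_assemble {g : ℝ → ℝ} (hg : Continuous g) (c : ι) (w : Fin p → ℝ) :
    Measurable fun y => offRowEnergy g θ ρ e (row c) (assemble row y) w :=
  ((continuous_offRowEnergy hg θ ρ e (row c) w).comp (continuous_assemble row)).measurable

-- Leaving out the whole row of `c` makes the Gibbs weights independent of the residual of that row.
lemma indepFun_gibbs_weight_rowResidual {g : ℝ → ℝ} (hg : Continuous g) (c : ι) (w : Fin p → ℝ) :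
    IndepFun (fun y => Real.exp (-offRowEnergy g θ ρ e (row c) (assemble row y) w) /
        partitionFn s (offRowEnergy g θ ρ e (row c) (assemble row y)))
      (fun y => |rowResidual row e c y w| ^ 3) (Measure.pi m) := by
  refine indepFun_pi_of_disjoint m (S := Finset.univ.filter fun c' => row c' ≠ row c)
    (T := siblings row c) ?_ ?_ ?_ ?_ ?_
  · exact (Finset.disjoint_filter_filter_not _ _ _).symm.mono_right (Finset.erase_subset _ _)
  · exact measurable_gibbs_weight s (measurable_offRowEnergy_assemble θ ρ e hg c) w
  · exact ((measurable_rowResidual row e c w).abs).pow_const 3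
  · intro y y' h
    rw [offRowEnergy_assemble_congr row g θ ρ e fun c' hc' => h c' (by simpa using hc')]
  · intro y y' h
    have hsum : ∑ c' ∈ siblings row c, y c' ⬝ᵥ w = ∑ c' ∈ siblings row c, y' c' ⬝ᵥ w :=
      Finset.sum_congr rfl fun c' hc' => by rw [h c' hc']
    simp only [rowResidual, hsum]

variable {g : ℝ → ℝ} {v₂ v₄ b : ι → ℝ} (hs : s.Nonempty) (hg : Continuous g)
  (hm : ∀ i, HasCellBounds (m i) s B c₀ (v₂ i) (v₄ i) (b i)) (c : ι)

include hs hg hm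

lemma integrable_gibbs_rowResidual :
    Integrable (fun y => gibbs s (offRowEnergy g θ ρ e (row c) (assemble row y))
      (fun w => |rowResidual row e c y w| ^ 3)) (Measure.pi m) :=
  integrable_gibbs hs (measurable_offRowEnergy_assemble θ ρ e hg c)
    (fun _ hw => integrable_abs_rowResidual_pow_three hm hw e c)
    (fun w _ => indepFun_gibbs_weight_rowResidual θ ρ e hg c w)

lemma integral_gibbs_rowResidual_le {V₂ V₄ : ℝ} (hV₂ : ∀ i, ∑ c with row c = i, v₂ c ≤ V₂)
    (hV₄ : ∀ i, ∑ c with row c = i, v₄ c ≤ V₄) :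
    ∫ y, gibbs s (offRowEnergy g θ ρ e (row c) (assemble row y))
      (fun w => |rowResidual row e c y w| ^ 3) ∂(Measure.pi m) ≤
        4 * (1 + 3 * V₂ ^ 2 + V₄ + |e (row c)| ^ 3) :=
  integral_gibbs_le hs (measurable_offRowEnergy_assemble θ ρ e hg c)
    (fun _ hw => integrable_abs_rowResidual_pow_three hm hw e c)
    (fun _ hw => integral_abs_rowResidual_pow_three_le hm hw e c hV₂ hV₄)
    (fun w _ => indepFun_gibbs_weight_rowResidual θ ρ e hg c w)

end Residual

variable {g g₁ g₂ g₃ V : ℝ → ℝ} {C k : ℝ} (hg : IsTame g g₁ g₂ g₃ V c₀ C) (hs : s.Nonempty)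
  (m : ℝ) (hθ : 1 ≤ θ) (hk : |k| ≤ 1)

include hg in
lemma IsTame.continuous : Continuous g :=
  continuous_iff_continuousAt.2 fun t => (hg.deriv₁ t).continuousAt

omit [DecidableEq ι] in
include hg hs in
lemma measurable_softTest_assemble (k : ℝ) :
    Measurable fun y => softTest s g θ ρ k m e (assemble row y) :=
  ((continuous_softTest hg.continuous θ ρ hs k m).comp
    ((continuous_assemble row).prodMk continuous_const)).measurable

section Swap

variable {μ ν : Measure (Fin p → ℝ)} {v₂ v₄ b : ℝ}

include hg hs hθ hk in
lemma abs_integral_softTest_update_sub_le (hμ : HasCellBounds μ s B c₀ v₂ v₄ b)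
    (hν : HasCellBounds ν s B c₀ v₂ v₄ b) (hB : ∀ x, ∀ w ∈ s, |x ⬝ᵥ w| ≤ B x)
    (hcov : ∀ w ∈ s, ∀ w' ∈ s,
      ∫ x, (x ⬝ᵥ w) * (x ⬝ᵥ w') ∂μ = ∫ x, (x ⬝ᵥ w) * (x ⬝ᵥ w') ∂ν)
    (y : ι → Fin p → ℝ) (c : ι) :
    |∫ x, softTest s g θ ρ k m e (assemble row (Function.update y c x)) ∂μ -
      ∫ x, softTest s g θ ρ k m e (assemble row (Function.update y c x)) ∂ν| ≤
    2 * (23 * |k| * (θ * C) ^ 3 * C * b *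
      (5 + 4 * c₀ * gibbs s (offRowEnergy g θ ρ e (row c) (assemble row y))
        (fun w => |rowResidual row e c y w| ^ 3))) := by
  have := hμ.toIsProbabilityMeasure
  have := hν.toIsProbabilityMeasure
  obtain ⟨Q, hQ, hexp⟩ := hg.exists_isQuadratic_expansion hs m hθ hk
    (offRowEnergy g θ ρ e (row c) (assemble row y)) (rowResidual row e c y)
  set Ψ := gibbs s (offRowEnergy g θ ρ e (row c) (assemble row y))
    (fun w => |rowResidual row e c y w| ^ 3)
  have hΨ : 0 ≤ Ψ := gibbs_nonneg _ fun _ _ => by positivity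
  have hC := hg.one_le
  have hK : 0 ≤ 23 * |k| * (θ * C) ^ 3 * C := by positivity
  have h_int : ∀ (m' : Measure (Fin p → ℝ)) [IsProbabilityMeasure m'], Integrable (fun x =>
      softTest s g θ ρ k m e (assemble row (Function.update y c x))) m' := fun m' _ =>
    Integrable.of_bound ((measurable_softTest_assemble θ ρ e hg hs m k).comp
      (measurable_update y)).aestronglyMeasurable 1
      (ae_of_all _ fun _ => abs_softTest_le_one θ ρ s g k m e _)
  refine abs_integral_sub_le_of_expansion (h_int μ) (h_int ν) (hμ.integrable_isQuadratic hQ)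
    (hν.integrable_isQuadratic hQ) (hμ.integral_isQuadratic_eq hν hcov hQ)
    (hμ.integrable_remainder Ψ _) (hν.integrable_remainder Ψ _)
    (hμ.integral_remainder_le Ψ hK hg.c_nonneg hΨ) (hν.integral_remainder_le Ψ hK hg.c_nonneg hΨ)
    (F₀ := Real.sigmoid (k * Real.log (partitionFn s fun w =>
      offRowEnergy g θ ρ e (row c) (assemble row y) w + θ * g (rowResidual row e c y w)) + m))
    fun x => ?_
  have henergy : energy g θ ρ e (assemble row (Function.update y c x)) = fun w =>
      offRowEnergy g θ ρ e (row c) (assemble row y) w +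
        θ * g (x ⬝ᵥ w + rowResidual row e c y w) :=
    funext fun w => energy_assemble_update row g θ ρ e y c x w
  rw [softTest, henergy]
  exact (hexp (fun w => x ⬝ᵥ w) (B x) (hB x)).trans (le_of_eq (by ring))

end Swap

omit [DecidableEq ι] in
include hg hs hθ hk in
theorem abs_integral_softTest_sub_le {μ ν : ι → Measure (Fin p → ℝ)} {v₂ v₄ b : ι → ℝ}
    (hμ : ∀ c, HasCellBounds (μ c) s B c₀ (v₂ c) (v₄ c) (b c))
    (hν : ∀ c, HasCellBounds (ν c) s B c₀ (v₂ c) (v₄ c) (b c))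
    (hB : ∀ x, ∀ w ∈ s, |x ⬝ᵥ w| ≤ B x)
    (hcov : ∀ c, ∀ w ∈ s, ∀ w' ∈ s,
      ∫ x, (x ⬝ᵥ w) * (x ⬝ᵥ w') ∂(μ c) = ∫ x, (x ⬝ᵥ w) * (x ⬝ᵥ w') ∂(ν c))
    {V₂ V₄ : ℝ} (hV₂ : ∀ i, ∑ c with row c = i, v₂ c ≤ V₂)
    (hV₄ : ∀ i, ∑ c with row c = i, v₄ c ≤ V₄) :
    |∫ y, softTest s g θ ρ k m e (assemble row y) ∂(Measure.pi μ) -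
      ∫ y, softTest s g θ ρ k m e (assemble row y) ∂(Measure.pi ν)| ≤
    ∑ c, 46 * |k| * (θ * C) ^ 3 * C * b c *
      (5 + 16 * c₀ * (1 + 3 * V₂ ^ 2 + V₄ + |e (row c)| ^ 3)) := by
  classical
  have := fun c => (hμ c).toIsProbabilityMeasure
  have := fun c => (hν c).toIsProbabilityMeasure
  have hC := hg.one_le
  have hc₀ := hg.c_nonneg
  refine abs_integral_pi_sub_le_sum μ ν _ _ fun c M hM => ?_
  have hMb : ∀ i, HasCellBounds (M i) s B c₀ (v₂ i) (v₄ i) (b i) := fun i =>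
    (hM i).elim (fun h => h ▸ hμ i) fun h => h ▸ hν i
  have := fun c => (hMb c).toIsProbabilityMeasure
  have hΨ := integrable_gibbs_rowResidual (row := row) θ ρ e hs hg.continuous hMb c
  have hbound : Integrable (fun y => 5 + 4 * c₀ * gibbs s
      (offRowEnergy g θ ρ e (row c) (assemble row y)) (fun w => |rowResidual row e c y w| ^ 3))
      (Measure.pi M) := (integrable_const _).add (hΨ.const_mul _)
  have hb₀ : 0 ≤ b c := (integral_nonneg fun x => by
    have : 0 ≤ B x := (abs_nonneg _).trans (hB x _ hs.choose_spec)
    positivity).trans (hμ c).three_le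
  refine (abs_integral_pi_update_sub_le M c (μ c) (ν c)
    (measurable_softTest_assemble θ ρ e hg hs m k) (fun _ => abs_softTest_le_one θ ρ s g k m e _)
    ((hbound.const_mul _).const_mul _)
    fun y => abs_integral_softTest_update_sub_le θ ρ e hg hs m hθ hk (hμ c) (hν c) hB (hcov c)
      y c).trans ?_
  rw [integral_const_mul, integral_const_mul, integral_add (integrable_const _) (hΨ.const_mul _),
    integral_const_mul]
  simp only [integral_const, probReal_univ, smul_eq_mul, one_mul]
  calc _ ≤ 2 * (23 * |k| * (θ * C) ^ 3 * C * b c *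
        (5 + 4 * c₀ * (4 * (1 + 3 * V₂ ^ 2 + V₄ + |e (row c)| ^ 3)))) := by
        gcongr
        exact integral_gibbs_rowResidual_le θ ρ e hs hg.continuous hMb c hV₂ hV₄
    _ = _ := by ring

end Lindeberg

section Smoothing

open scoped NNReal

/-- The average of `f` over a window of length `h` to the right of `t`. It has one derivative more
than `f`, so three successive averages turn a Lipschitz function into a thrice differentiable
one. -/
def slidingAverage (h : ℝ) (f : ℝ → ℝ) (t : ℝ) : ℝ := (∫ u in (0 : ℝ)..h, f (t + u)) / h

/-- The forward difference quotient of `f` with step `h`, which is the derivative of the sliding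
average of `f`. -/
def differenceQuotient (h : ℝ) (f : ℝ → ℝ) (t : ℝ) : ℝ := (f (t + h) - f t) / h

variable {h : ℝ} {f f' : ℝ → ℝ} {K : ℝ≥0}

lemma hasDerivAt_slidingAverage (h : ℝ) (hf : Continuous f) (t : ℝ) :
    HasDerivAt (slidingAverage h f) (differenceQuotient h f t) t := by
  have hprimitive (x : ℝ) : HasDerivAt (fun x => ∫ u in (0 : ℝ)..x, f u) (f x) x :=
    intervalIntegral.integral_hasDerivAt_right (hf.intervalIntegrable _ _)
      (hf.stronglyMeasurableAtFilter _ _) hf.continuousAt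
  have heq : slidingAverage h f =
      fun t => ((∫ u in (0 : ℝ)..(t + h), f u) - ∫ u in (0 : ℝ)..t, f u) / h := by
    ext t
    rw [slidingAverage, intervalIntegral.integral_comp_add_left,
      intervalIntegral.integral_interval_sub_left (hf.intervalIntegrable _ _)
        (hf.intervalIntegrable _ _), add_zero]
  rw [heq]
  exact (((hprimitive (t + h)).comp_add_const t h).sub (hprimitive t)).div_const h

lemma hasDerivAt_differenceQuotient (h : ℝ) (hf : ∀ t, HasDerivAt f (f' t) t) (t : ℝ) :
    HasDerivAt (differenceQuotient h f) (differenceQuotient h f' t) t :=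
  (((hf (t + h)).comp_add_const t h).sub (hf t)).div_const h

lemma lipschitzWith_slidingAverage (hh : 0 < h) (hf : LipschitzWith K f) :
    LipschitzWith K (slidingAverage h f) := by
  have h_int (s : ℝ) : IntervalIntegrable (fun u => f (s + u)) volume 0 h :=
    (hf.continuous.comp (continuous_const_add s)).intervalIntegrable _ _
  refine LipschitzWith.of_dist_le_mul fun s t => ?_
  rw [Real.dist_eq, slidingAverage, slidingAverage, ← sub_div,
    ← intervalIntegral.integral_sub (h_int s) (h_int t), abs_div, abs_of_pos hh, div_le_iff₀ hh]
  have hbound := intervalIntegral.norm_integral_le_of_norm_le_const (a := 0) (b := h)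
    (C := K * dist s t) (f := fun u => f (s + u) - f (t + u)) fun u _ => by
      simpa only [dist_add_right, Real.dist_eq, Real.norm_eq_abs] using
        hf.dist_le_mul (s + u) (t + u)
  rwa [sub_zero, abs_of_pos hh] at hbound

lemma abs_slidingAverage_sub_self_le (hh : 0 < h) (hf : LipschitzWith K f) (t : ℝ) :
    |slidingAverage h f t - f t| ≤ K * h := by
  have h_int : IntervalIntegrable (fun u => f (t + u)) volume 0 h :=
    (hf.continuous.comp (continuous_const_add t)).intervalIntegrable _ _
  have hconst : f t = (∫ _ in (0 : ℝ)..h, f t) / h := by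
    rw [intervalIntegral.integral_const, sub_zero, smul_eq_mul, mul_div_cancel_left₀ _ hh.ne']
  rw [hconst, slidingAverage, ← sub_div,
    ← intervalIntegral.integral_sub h_int intervalIntegrable_const, abs_div, abs_of_pos hh,
    div_le_iff₀ hh]
  have hbound := intervalIntegral.norm_integral_le_of_norm_le_const (a := 0) (b := h)
    (C := K * h) (f := fun u => f (t + u) - f t) fun u hu => by
      rw [Set.uIoc_of_le hh.le] at hu
      have hdist := hf.dist_le_mul (t + u) t
      rw [Real.dist_eq, Real.dist_eq, add_sub_cancel_left, abs_of_pos hu.1] at hdist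
      exact hdist.trans (mul_le_mul_of_nonneg_left hu.2 K.2)
  rwa [sub_zero, abs_of_pos hh] at hbound

lemma abs_differenceQuotient_le {B : ℝ} (hh : 0 < h) (hf : ∀ t, |f t| ≤ B) (t : ℝ) :
    |differenceQuotient h f t| ≤ 2 * B / h := by
  rw [differenceQuotient, abs_div, abs_of_pos hh, two_mul]
  gcongr
  exact (abs_sub _ _).trans (add_le_add (hf _) (hf _))

lemma abs_differenceQuotient_le_of_lipschitzWith (hh : 0 < h) (hf : LipschitzWith K f) (t : ℝ) :
    |differenceQuotient h f t| ≤ K := by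
  have hdist := hf.dist_le_mul (t + h) t
  rw [Real.dist_eq, Real.dist_eq, add_sub_cancel_left, abs_of_pos hh] at hdist
  rwa [differenceQuotient, abs_div, abs_of_pos hh, div_le_iff₀ hh]

lemma isTame_slidingAverage (hh : 0 < h) (hf : LipschitzWith K f) :
    IsTame (slidingAverage h (slidingAverage h (slidingAverage h f)))
      (differenceQuotient h (slidingAverage h (slidingAverage h f)))
      (differenceQuotient h (differenceQuotient h (slidingAverage h f)))
      (differenceQuotient h (differenceQuotient h (differenceQuotient h f)))
      (fun _ => 1) 0 (1 + K + 2 * K / h + 2 * (2 * K / h) / h) := by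
  have hf₁ := lipschitzWith_slidingAverage hh hf
  have hf₂ := lipschitzWith_slidingAverage hh hf₁
  have hb₂ : 0 ≤ 2 * (K : ℝ) / h := by positivity
  have hb₃ : 0 ≤ 2 * (2 * (K : ℝ) / h) / h := by positivity
  have hd₁ := abs_differenceQuotient_le_of_lipschitzWith hh hf₂
  have hd₂ := abs_differenceQuotient_le hh (abs_differenceQuotient_le_of_lipschitzWith hh hf₁)
  have hd₃ := abs_differenceQuotient_le hh (abs_differenceQuotient_le hh
    (abs_differenceQuotient_le_of_lipschitzWith hh hf))
  exact
    { deriv₁ := hasDerivAt_slidingAverage h hf₂.continuous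
      deriv₂ := hasDerivAt_differenceQuotient h (hasDerivAt_slidingAverage h hf₁.continuous)
      deriv₃ := hasDerivAt_differenceQuotient h (hasDerivAt_differenceQuotient h
        (hasDerivAt_slidingAverage h hf.continuous))
      one_le := by linarith [K.2]
      c_nonneg := le_rfl
      V_nonneg := fun _ => zero_le_one
      bound₁ := fun t => by linarith [hd₁ t]
      bound₂ := fun t => by linarith [hd₂ t, K.2]
      bound₃ := fun t => by linarith [hd₃ t, K.2]
      comono := fun s t => by rw [sub_self, mul_zero]
      growth := fun t => by linarith [K.2] }

lemma exists_isTame_of_lipschitzWith (hf : LipschitzWith K f) {σ : ℝ} (hσ : 0 < σ) :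
    ∃ (g g₁ g₂ g₃ V : ℝ → ℝ) (C : ℝ), IsTame g g₁ g₂ g₃ V 0 C ∧ ∀ t, |g t - f t| ≤ σ := by
  set h := σ / (3 * K + 1)
  have hh : 0 < h := by positivity
  have hKh : 3 * (K * h) ≤ σ := by
    have hσh : h * (3 * K + 1) = σ := div_mul_cancel₀ _ (by positivity)
    linarith
  have hf₁ := lipschitzWith_slidingAverage hh hf
  have hf₂ := lipschitzWith_slidingAverage hh hf₁
  refine ⟨_, _, _, _, _, _, isTame_slidingAverage hh hf, fun t => ?_⟩
  have h₁ := abs_le.1 (abs_slidingAverage_sub_self_le hh hf t)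
  have h₂ := abs_le.1 (abs_slidingAverage_sub_self_le hh hf₁ t)
  have h₃ := abs_le.1 (abs_slidingAverage_sub_self_le hh hf₂ t)
  exact abs_le.2 ⟨by linarith, by linarith⟩

lemma isTame_sq : IsTame (fun t => t ^ 2) (fun t => 2 * t) (fun _ => 2) (fun _ => 0)
    (fun t => 1 + |t|) 1 4 where
  deriv₁ t := by simpa using hasDerivAt_pow 2 t
  deriv₂ t := by simpa using (hasDerivAt_id t).const_mul 2
  deriv₃ t := hasDerivAt_const t 2
  one_le := by norm_num
  c_nonneg := zero_le_one
  V_nonneg t := by positivity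
  bound₁ t := by
    rw [abs_mul, abs_two]
    linarith [abs_nonneg t]
  bound₂ t := by
    rw [abs_two]
    nlinarith [abs_nonneg t, sq_nonneg |t|]
  bound₃ t := by
    rw [abs_zero]
    positivity
  comono s t := by
    rw [← sq_abs s, ← sq_abs t]
    rcases le_total |s| |t| with h | h
    · exact mul_nonneg_of_nonpos_of_nonpos (sub_nonpos.2 (by gcongr)) (sub_nonpos.2 (by gcongr))
    · exact mul_nonneg (sub_nonneg.2 (by gcongr)) (sub_nonneg.2 (by gcongr))
  growth t := by
    have ht := abs_nonneg t
    nlinarith [mul_nonneg (add_nonneg zero_le_one ht) (sq_nonneg (|t| - 1))]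

end Smoothing

namespace RegressionLoss

/-- `1` for the squared loss, whose derivative is unbounded, and `0` for the Lipschitz losses. It is
the constant `c` in `IsTame` for the loss. -/
def growthFlag : RegressionLoss → ℝ
  | squared => 1
  | absolute => 0
  | huber _ _ => 0

/-- A constant `K` such that the loss is `K`-Lipschitz or, for the squared loss, such that it
satisfies the local Lipschitz estimate `abs_fn_sub_le`. -/
def slope : RegressionLoss → ℝ
  | squared => 1
  | absolute => 1
  | huber η _ => η

lemma slope_pos (l : RegressionLoss) : 0 < l.slope := by
  cases l with
  | squared => exact one_pos
  | absolute => exact one_pos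
  | huber η hη => exact hη

lemma growthFlag_nonneg (l : RegressionLoss) : 0 ≤ l.growthFlag := by
  cases l with
  | squared => exact zero_le_one
  | absolute => exact le_rfl
  | huber η hη => exact le_rfl

lemma growthFlag_le_one (l : RegressionLoss) : l.growthFlag ≤ 1 := by
  cases l with
  | squared => exact le_rfl
  | absolute => exact zero_le_one
  | huber η hη => exact zero_le_one

lemma huber_sub_mem_Icc {η : ℝ} (hη : 0 < η) {u v : ℝ} (huv : |u| ≤ |v|) :
    (huber η hη).fn v - (huber η hη).fn u ∈ Set.Icc 0 (η * (|v| - |u|)) := by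
  have hu := abs_nonneg u
  simp only [fn]
  rw [← sq_abs u, ← sq_abs v]
  by_cases hvη : |v| ≤ η
  · rw [if_pos hvη, if_pos (huv.trans hvη)]
    constructor <;> nlinarith
  · rw [if_neg hvη]
    by_cases huη : |u| ≤ η
    · rw [if_pos huη]
      constructor <;> nlinarith [sq_nonneg (|u| - η)]
    · rw [if_neg huη]
      constructor <;> nlinarith

lemma abs_huber_sub_le {η : ℝ} (hη : 0 < η) (u v : ℝ) :
    |(huber η hη).fn u - (huber η hη).fn v| ≤ η * |u - v| := by
  wlog huv : |u| ≤ |v| generalizing u v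
  · rw [abs_sub_comm, abs_sub_comm u v]
    exact this v u (le_of_not_ge huv)
  have hsub := huber_sub_mem_Icc hη huv
  rw [abs_sub_comm, abs_of_nonneg hsub.1, abs_sub_comm u v]
  exact hsub.2.trans (mul_le_mul_of_nonneg_left (abs_sub_abs_le_abs_sub v u) hη.le)

lemma abs_fn_sub_le (l : RegressionLoss) (u v : ℝ) :
    |l.fn u - l.fn v| ≤ l.slope * |u - v| * (1 + l.growthFlag * (|u| + |v|)) := by
  cases l with
  | squared =>
    simp only [fn, slope, growthFlag, one_mul]
    rw [sq_sub_sq, abs_mul, mul_comm]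
    have h := abs_add_le u v
    gcongr
    linarith
  | absolute =>
    simp only [fn, slope, growthFlag, one_mul, zero_mul, add_zero, mul_one]
    exact abs_abs_sub_abs_le u v
  | huber η hη =>
    simp only [slope, growthFlag, zero_mul, add_zero, mul_one]
    exact abs_huber_sub_le hη u v

lemma exists_isTame (l : RegressionLoss) {σ : ℝ} (hσ : 0 < σ) :
    ∃ (g g₁ g₂ g₃ V : ℝ → ℝ) (C : ℝ), IsTame g g₁ g₂ g₃ V l.growthFlag C ∧
      ∀ t, |g t - l.fn t| ≤ σ := by
  cases l with
  | squared => exact ⟨_, _, _, _, _, _, isTame_sq, fun t => by simpa [fn] using hσ.le⟩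
  | absolute =>
    exact exists_isTame_of_lipschitzWith
      (LipschitzWith.of_dist_le_mul (K := 1) fun s t => by
        simpa [fn, Real.dist_eq] using abs_abs_sub_abs_le s t) hσ
  | huber η hη =>
    exact exists_isTame_of_lipschitzWith
      (LipschitzWith.of_dist_le_mul (K := ⟨η, hη.le⟩) (abs_huber_sub_le hη)) hσ

end RegressionLoss

section Net

variable {p : ℕ} {T : Set (Fin p → ℝ)} {L δ δ' : ℝ} {R : (Fin p → ℝ) → ℝ}

/-- The index of the cell containing `w` in the partition of `ℝᵖ` into half-open cubes with
side `δ`. -/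
def latticeCell (δ : ℝ) (w : Fin p → ℝ) (j : Fin p) : ℤ := ⌊w j / δ⌋

lemma abs_sub_le_of_latticeCell_eq (hδ : 0 < δ) {w w' : Fin p → ℝ}
    (h : latticeCell δ w = latticeCell δ w') (j : Fin p) : |w j - w' j| ≤ δ := by
  have hlt := Int.abs_sub_lt_one_of_floor_eq_floor (congrFun h j)
  rw [← sub_div, abs_div, abs_of_pos hδ, div_lt_one hδ] at hlt
  exact hlt.le

lemma latticeCell_mem_piFinset (hδ : 0 < δ) {w : Fin p → ℝ} (hw : ∀ j, |w j| ≤ L) :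
    latticeCell δ w ∈ Fintype.piFinset fun _ => Finset.Icc ⌊-(L / δ)⌋ ⌊L / δ⌋ := by
  refine Fintype.mem_piFinset.2 fun j => Finset.mem_Icc.2 ⟨?_, ?_⟩
  · rw [← neg_div]
    exact Int.floor_le_floor (div_le_div_of_nonneg_right (abs_le.1 (hw j)).1 hδ.le)
  · exact Int.floor_le_floor (div_le_div_of_nonneg_right (abs_le.1 (hw j)).2 hδ.le)

lemma card_Icc_floor_neg_floor_le {x : ℝ} (hx : 0 ≤ x) :
    ((Finset.Icc ⌊-x⌋ ⌊x⌋).card : ℝ) ≤ 2 * x + 2 := by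
  have hle : ⌊-x⌋ ≤ ⌊x⌋ + 1 :=
    (Int.floor_le_floor (neg_le_self hx)).trans (Int.le_add_one le_rfl)
  have hcard : ((Finset.Icc ⌊-x⌋ ⌊x⌋).card : ℝ) = ⌊x⌋ + 1 - ⌊-x⌋ := by
    exact_mod_cast Int.card_Icc_of_le _ _ hle
  linarith [Int.floor_le x, Int.lt_floor_add_one (-x)]

lemma exists_mem_forall_le_add {s : Set (Fin p → ℝ)} (hs : s.Nonempty) (hδ' : 0 < δ')
    (hR : BddBelow (R '' s)) : ∃ w₀ ∈ s, ∀ w ∈ s, R w₀ ≤ R w + δ' := by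
  obtain ⟨_, ⟨w₀, hw₀, rfl⟩, hlt⟩ := Real.lt_sInf_add_pos (hs.image R) hδ'
  exact ⟨w₀, hw₀, fun w hw => by linarith [csInf_le hR (Set.mem_image_of_mem R hw)]⟩

lemma exists_net (hT : T.Nonempty) (hL : 0 ≤ L) (hδ : 0 < δ) (hδ' : 0 < δ')
    (hbox : ∀ w ∈ T, ∀ j, |w j| ≤ L) (hR : BddBelow (R '' T)) :
    ∃ s : Finset (Fin p → ℝ), s.Nonempty ∧ (s : Set (Fin p → ℝ)) ⊆ T ∧
      (s.card : ℝ) ≤ (2 * (L / δ) + 2) ^ p ∧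
      ∀ w ∈ T, ∃ w' ∈ s, (∀ j, |w j - w' j| ≤ δ) ∧ R w' ≤ R w + δ' := by
  classical
  set I : Finset ℤ := Finset.Icc ⌊-(L / δ)⌋ ⌊L / δ⌋
  have hpick (k : latticeCell δ '' T) : ∃ w₀ ∈ T ∩ latticeCell δ ⁻¹' {k.1},
      ∀ w ∈ T ∩ latticeCell δ ⁻¹' {k.1}, R w₀ ≤ R w + δ' := by
    obtain ⟨w, hw, hwk⟩ := k.2
    exact exists_mem_forall_le_add ⟨w, hw, hwk⟩ hδ' (hR.mono (Set.image_mono Set.inter_subset_left))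
  choose pick hpick_mem hpick_le using hpick
  have hcells : latticeCell δ '' T ⊆ Fintype.piFinset fun _ : Fin p => I :=
    Set.image_subset_iff.2 fun w hw => latticeCell_mem_piFinset hδ (hbox w hw)
  have hfin : (latticeCell δ '' T).Finite := (Finset.finite_toSet _).subset hcells
  have := hfin.fintype
  refine ⟨Finset.univ.image pick, ?_, ?_, ?_, fun w hw => ?_⟩
  · have := (hT.image (latticeCell δ)).to_subtype
    exact Finset.univ_nonempty.image pick
  · rintro _ hw
    obtain ⟨k, -, rfl⟩ := Finset.mem_image.1 (Finset.mem_coe.1 hw)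
    exact (hpick_mem k).1
  · have hcard : (Finset.univ.image pick).card ≤ I.card ^ p := by
      calc (Finset.univ.image pick).card ≤ Fintype.card (latticeCell δ '' T) :=
            Finset.card_image_le
        _ = (latticeCell δ '' T).toFinset.card := (Set.toFinset_card _).symm
        _ ≤ (Fintype.piFinset fun _ : Fin p => I).card :=
            Finset.card_le_card (Set.toFinset_subset.2 hcells)
        _ = I.card ^ p := Fintype.card_piFinset_const I p
    calc ((Finset.univ.image pick).card : ℝ) ≤ (I.card : ℝ) ^ p := by exact_mod_cast hcard
      _ ≤ (2 * (L / δ) + 2) ^ p := by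
          gcongr
          exact card_Icc_floor_neg_floor_le (by positivity)
  · set k : latticeCell δ '' T := ⟨latticeCell δ w, w, hw, rfl⟩
    exact ⟨pick k, Finset.mem_image_of_mem _ (Finset.mem_univ _),
      abs_sub_le_of_latticeCell_eq hδ (hpick_mem k).2.symm, hpick_le k w ⟨hw, rfl⟩⟩

end Net

section LambdaMax

open scoped MatrixOrder in
lemma dotProduct_mulVec_le_lambdaMax {p : ℕ} {A : Matrix (Fin p) (Fin p) ℝ} (hA : A.PosSemidef)
    (u : Fin p → ℝ) : u ⬝ᵥ A.mulVec u ≤ lambdaMax A * ∑ j, u j ^ 2 := by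
  have hle : A ≤ algebraMap ℝ _ (lambdaMax A) :=
    le_algebraMap_of_spectrum_le
      (fun x hx => le_csSup (Matrix.finite_spectrum A).bddAbove hx) hA.isHermitian
  have hnonneg := (Matrix.le_iff.1 hle).dotProduct_mulVec_nonneg u
  rw [star_trivial, Matrix.sub_mulVec, dotProduct_sub, sub_nonneg] at hnonneg
  refine hnonneg.trans_eq ?_
  rw [Matrix.algebraMap_eq_diagonal, Finset.mul_sum]
  simp only [dotProduct, Matrix.mulVec_diagonal]
  refine Finset.sum_congr rfl fun j _ => ?_
  rw [Pi.algebraMap_apply, Algebra.algebraMap_self_apply]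
  ring

lemma diag_le_lambdaMax {p : ℕ} {A : Matrix (Fin p) (Fin p) ℝ} (hA : A.PosSemidef)
    (j : Fin p) : A j j ≤ lambdaMax A := by
  simpa [Pi.single_apply, ite_pow] using dotProduct_mulVec_le_lambdaMax hA (Pi.single j 1)

end LambdaMax

/-- The rows `Aᵢ` of a random design are independent with `E[Aᵢ] = 0` and `E[Aᵢ Aᵢᵀ] = Σ / n`. In
contrast to `IsDesign`, they need not be identically distributed. -/
structure IsIndepDesign {Ω : Type*} [MeasurableSpace Ω] (P : Measure Ω) {n p : ℕ}
    (A : Ω → Fin n → Fin p → ℝ) (Sig : Matrix (Fin p) (Fin p) ℝ) : Prop where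
  measurable : Measurable A
  indep : iIndepFun (fun i ω => A ω i) P
  mean : ∀ i j, ∫ ω, A ω i j ∂P = 0
  cov : ∀ i j k, ∫ ω, A ω i j * A ω i k ∂P = Sig j k / n

lemma IsDesign.isIndepDesign {Ω : Type*} [MeasurableSpace Ω] {P : Measure Ω} {n p : ℕ}
    {X : Ω → Fin n → Fin p → ℝ} {Sig : Matrix (Fin p) (Fin p) ℝ} (hX : IsDesign P X Sig) :
    IsIndepDesign P X Sig :=
  ⟨hX.measurable, hX.indep, hX.mean, hX.cov⟩

lemma measurable_row {Ω : Type*} [MeasurableSpace Ω] {n p : ℕ} {A : Ω → Fin n → Fin p → ℝ}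
    (hA : Measurable A) (i : Fin n) : Measurable fun ω => A ω i :=
  (measurable_pi_apply i).comp hA

lemma measurable_entry {Ω : Type*} [MeasurableSpace Ω] {n p : ℕ} {A : Ω → Fin n → Fin p → ℝ}
    (hA : Measurable A) (i : Fin n) (j : Fin p) : Measurable fun ω => A ω i j :=
  (measurable_pi_apply j).comp (measurable_row hA i)

section Gaussian

/-- The `L^q` norm of the standard Gaussian law. -/
def gaussianNorm (q : ENNReal) : ℝ := (eLpNorm id q (gaussianReal 0 1)).toReal

lemma gaussianNorm_nonneg (q : ENNReal) : 0 ≤ gaussianNorm q := ENNReal.toReal_nonneg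

lemma eLpNorm_id_gaussianReal_zero (v : NNReal) {q : ENNReal} (hq : q ≠ ⊤) :
    eLpNorm id q (gaussianReal 0 v) = ENNReal.ofReal (√(v : ℝ) * gaussianNorm q) := by
  have hscale : HasLaw (fun x => √(v : ℝ) * id x) (gaussianReal 0 v) (gaussianReal 0 1) := by
    convert gaussianReal_const_mul HasLaw.id √(v : ℝ) using 2
    · exact (mul_zero _).symm
    · ext
      simp
  rw [← hscale.map_eq, eLpNorm_map_measure aestronglyMeasurable_id hscale.aemeasurable,
    ENNReal.ofReal_mul (Real.sqrt_nonneg _), gaussianNorm,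
    ENNReal.ofReal_toReal (memLp_id_gaussianReal' q hq).eLpNorm_lt_top.ne,
    ← Real.enorm_eq_ofReal (Real.sqrt_nonneg _)]
  exact eLpNorm_const_smul √(v : ℝ) id q (gaussianReal 0 1)

variable {Ω : Type*} [MeasurableSpace Ω] {P : Measure Ω} {n p : ℕ} {G : Ω → Fin n → Fin p → ℝ}
  {Sig : Matrix (Fin p) (Fin p) ℝ}

lemma posSemidef_smul_inv (n : ℕ) (hS : Sig.PosSemidef) : ((1 / (n : ℝ)) • Sig).PosSemidef :=
  hS.smul (by positivity)

lemma smul_inv_apply (n : ℕ) (Sig : Matrix (Fin p) (Fin p) ℝ) (j k : Fin p) :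
    ((1 / (n : ℝ)) • Sig) j k = Sig j k / n := by
  rw [Matrix.smul_apply, smul_eq_mul, one_div_mul_eq_div]

namespace IsGaussianDesign

lemma hasLaw (hG : IsGaussianDesign P G Sig) (i : Fin n) :
    HasLaw (fun ω => WithLp.toLp 2 (G ω i)) (multivariateGaussian 0 ((1 / (n : ℝ)) • Sig)) P where
  aemeasurable :=
    ((WithLp.measurable_toLp 2 (Fin p → ℝ)).comp (measurable_row hG.measurable i)).aemeasurable
  map_eq := hG.law i

lemma hasLaw_entry (hG : IsGaussianDesign P G Sig) (hS : Sig.PosSemidef) (i : Fin n) (j : Fin p) :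
    HasLaw (fun ω => G ω i j) (gaussianReal 0 (Sig j j / n).toNNReal) P := by
  rw [← smul_inv_apply]
  exact (measurePreserving_eval_multivariateGaussian (μ := 0)
    (posSemidef_smul_inv n hS) (i := j)).hasLaw.comp (hG.hasLaw i)

lemma memLp (hG : IsGaussianDesign P G Sig) (hS : Sig.PosSemidef) (i : Fin n) (j : Fin p)
    {q : ENNReal} (hq : q ≠ ⊤) : MemLp (fun ω => G ω i j) q P := by
  have hlaw := hG.hasLaw_entry hS i j
  have hid : MemLp id q (P.map fun ω => G ω i j) := by
    rw [hlaw.map_eq]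
    exact memLp_id_gaussianReal' q hq
  exact (memLp_map_measure_iff hid.1 hlaw.aemeasurable).1 hid

lemma integral_entry (hG : IsGaussianDesign P G Sig) (hS : Sig.PosSemidef) (i : Fin n)
    (j : Fin p) : ∫ ω, G ω i j ∂P = 0 :=
  (hG.hasLaw_entry hS i j).integral_eq.trans integral_id_gaussianReal

lemma covariance_entry (hG : IsGaussianDesign P G Sig) (hS : Sig.PosSemidef) (i : Fin n)
    (j k : Fin p) : cov[fun ω => G ω i j, fun ω => G ω i k; P] = Sig j k / n := by
  have hcov := covariance_eval_multivariateGaussian (μ := 0) (posSemidef_smul_inv n hS) j k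
  rw [← hG.law i, covariance_map (by fun_prop) (by fun_prop) (hG.hasLaw i).aemeasurable,
    smul_inv_apply] at hcov
  exact hcov

lemma isIndepDesign [IsProbabilityMeasure P] (hG : IsGaussianDesign P G Sig)
    (hS : Sig.PosSemidef) : IsIndepDesign P G Sig where
  measurable := hG.measurable
  indep := hG.indep
  mean := hG.integral_entry hS
  cov i j k := by
    have hcov := covariance_eq_sub (hG.memLp hS i j ENNReal.ofNat_ne_top)
      (hG.memLp hS i k ENNReal.ofNat_ne_top)
    rw [hG.covariance_entry hS, hG.integral_entry hS, zero_mul, sub_zero] at hcov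
    exact hcov.symm

lemma eLpNorm_le (hG : IsGaussianDesign P G Sig) (hS : Sig.PosSemidef) (hn : 1 ≤ n) {M : ℝ}
    (hM : lambdaMax Sig ≤ M) (i : Fin n) (j : Fin p) {q : ENNReal} (hq : q ≠ ⊤) :
    eLpNorm (fun ω => √(n : ℝ) * G ω i j) q P ≤ ENNReal.ofReal (√M * gaussianNorm q) := by
  have hlaw : HasLaw (fun ω => √(n : ℝ) * G ω i j) (gaussianReal 0 (Sig j j).toNNReal) P := by
    convert gaussianReal_const_mul (hG.hasLaw_entry hS i j) √(n : ℝ) using 2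
    · exact (mul_zero _).symm
    · have hn₀ : (0 : ℝ) < n := by exact_mod_cast hn
      ext
      rw [NNReal.coe_mul, NNReal.coe_mk, Real.coe_toNNReal _ hS.diag_nonneg,
        Real.coe_toNNReal _ (div_nonneg hS.diag_nonneg hn₀.le), Real.sq_sqrt hn₀.le,
        mul_div_cancel₀ _ hn₀.ne']
  have hnorm : eLpNorm (fun ω => √(n : ℝ) * G ω i j) q P =
      eLpNorm id q (gaussianReal 0 (Sig j j).toNNReal) := by
    rw [← hlaw.map_eq, eLpNorm_map_measure aestronglyMeasurable_id hlaw.aemeasurable]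
    rfl
  rw [hnorm, eLpNorm_id_gaussianReal_zero _ hq, Real.coe_toNNReal _ hS.diag_nonneg]
  have hq₀ := gaussianNorm_nonneg q
  gcongr
  exact (diag_le_lambdaMax hS j).trans hM

end IsGaussianDesign

end Gaussian

section Cells

variable {Ω : Type*} [MeasurableSpace Ω] {P : Measure Ω} {n p : ℕ} {A : Ω → Fin n → Fin p → ℝ}

/-- The subvector of the `i`-th row on the cell `D`, extended by zero. -/
def cellVec (A : Ω → Fin n → Fin p → ℝ) (i : Fin n) (D : Finset (Fin p)) (ω : Ω) (j : Fin p) : ℝ :=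
  if j ∈ D then A ω i j else 0

lemma measurable_cellVec (hA : Measurable A) (i : Fin n) (D : Finset (Fin p)) :
    Measurable (cellVec A i D) :=
  measurable_pi_iff.2 fun j => (measurable_entry hA i j).ite (.const _) measurable_const

lemma measurable_extend_zero (D : Finset (Fin p)) :
    Measurable fun (z : {j : Fin p // j ∈ D} → ℝ) (j : Fin p) =>
      if h : j ∈ D then z ⟨j, h⟩ else 0 := by
  refine measurable_pi_iff.2 fun j => ?_
  by_cases h : j ∈ D
  · simpa only [dif_pos h] using measurable_pi_apply _
  · simpa only [dif_neg h] using measurable_const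

lemma iIndepFun_cellVec (hA : Measurable A)
    (hrows : iIndepFun (fun i ω => A ω i) P) (k : Fin n → ℕ)
    (B : ∀ i, Fin (k i) → Finset (Fin p))
    (hB : ∀ i, iIndepFun
      (fun (a : Fin (k i)) (ω : Ω) (j : {j : Fin p // j ∈ B i a}) => A ω i j) P) :
    iIndepFun (fun (c : (i : Fin n) × Fin (k i)) ω => cellVec A c.1 (B c.1 c.2) ω) P := by
  refine iIndepFun_uncurry (X := fun i a ω => cellVec A i (B i a) ω)
    (fun i a => measurable_cellVec hA i _) ?_ fun i => ?_
  · exact hrows.comp (fun i (x : Fin p → ℝ) (a : Fin (k i)) (j : Fin p) =>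
      if j ∈ B i a then x j else 0) fun i => measurable_pi_iff.2 fun a => measurable_pi_iff.2
        fun j => (measurable_pi_apply j).ite (.const _) measurable_const
  · have hextend := (hB i).comp (fun a z j => if h : j ∈ B i a then z ⟨j, h⟩ else 0)
      fun a => measurable_extend_zero _
    simp only [Function.comp_def, dite_eq_ite] at hextend
    exact hextend

lemma IsIndepDesign.cov_eq_zero {Sig : Matrix (Fin p) (Fin p) ℝ} (hA : IsIndepDesign P A Sig)
    (hn : 1 ≤ n) (i : Fin n) {k : ℕ} {B : Fin k → Finset (Fin p)}
    (hB : iIndepFun (fun (a : Fin k) (ω : Ω) (j : {j : Fin p // j ∈ B a}) => A ω i j) P)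
    {a b : Fin k} (hab : a ≠ b) {j l : Fin p} (hj : j ∈ B a) (hl : l ∈ B b) : Sig j l = 0 := by
  have hindep : IndepFun (fun ω => A ω i j) (fun ω => A ω i l) P :=
    (hB.indepFun hab).comp (measurable_pi_apply (⟨j, hj⟩ : {j : Fin p // j ∈ B a}))
      (measurable_pi_apply (⟨l, hl⟩ : {j : Fin p // j ∈ B b}))
  have hcov := hindep.integral_fun_mul_eq_mul_integral
    (measurable_entry hA.measurable i j).aestronglyMeasurable
    (measurable_entry hA.measurable i l).aestronglyMeasurable
  rw [hA.cov, hA.mean, zero_mul, div_eq_zero_iff] at hcov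
  exact hcov.resolve_right (Nat.cast_ne_zero.2 (Nat.one_le_iff_ne_zero.1 hn))

lemma IsGaussianDesign.iIndepFun_blocks {G : Ω → Fin n → Fin p → ℝ}
    {Sig : Matrix (Fin p) (Fin p) ℝ} (hG : IsGaussianDesign P G Sig) (hS : Sig.PosSemidef)
    (i : Fin n) {k : ℕ} {B : Fin k → Finset (Fin p)}
    (hB : ∀ a b : Fin k, a ≠ b → ∀ j ∈ B a, ∀ l ∈ B b, Sig j l = 0) :
    iIndepFun (fun (a : Fin k) (ω : Ω) (j : {j : Fin p // j ∈ B a}) => G ω i j) P := by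
  refine HasGaussianLaw.iIndepFun_of_covariance_eval
    (X := fun (a : Fin k) (j : {j : Fin p // j ∈ B a}) ω => G ω i j) ?_ fun a b hab j l => ?_
  · exact (hG.hasLaw i).hasGaussianLaw.map_fun (ContinuousLinearMap.pi fun a : Fin k =>
      ContinuousLinearMap.pi fun j : {j : Fin p // j ∈ B a} =>
        (EuclideanSpace.proj (j : Fin p) : EuclideanSpace ℝ (Fin p) →L[ℝ] ℝ))
  · rw [hG.covariance_entry hS, hB a b hab j j.2 l l.2, zero_div]

end Cells

lemma abs_dotProduct_le_mul_sum_abs {p : ℕ} (x : Fin p → ℝ) {w : Fin p → ℝ} {L : ℝ}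
    (hw : ∀ j, |w j| ≤ L) : |x ⬝ᵥ w| ≤ L * ∑ j, |x j| := by
  rw [Finset.mul_sum]
  refine (Finset.abs_sum_le_sum_abs _ _).trans (Finset.sum_le_sum fun j _ => ?_)
  rw [abs_mul, mul_comm]
  exact mul_le_mul_of_nonneg_right (hw j) (abs_nonneg _)

section CellMoments

variable {Ω : Type*} [MeasurableSpace Ω] {P : Measure Ω} {n p : ℕ}
  {A : Ω → Fin n → Fin p → ℝ} {Sig : Matrix (Fin p) (Fin p) ℝ} {q : ENNReal} {K : ℝ}

lemma integral_abs_pow_le [IsProbabilityMeasure P] {Y : Ω → ℝ} (hY : AEStronglyMeasurable Y P)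
    (hK : 0 ≤ K) (hYK : eLpNorm Y q P ≤ ENNReal.ofReal K) {m : ℕ} (hm : m ≠ 0)
    (hmq : (m : ENNReal) ≤ q) : ∫ ω, |Y ω| ^ m ∂P ≤ K ^ m := by
  have hmem : MemLp Y q P := ⟨hY, hYK.trans_lt ENNReal.ofReal_lt_top⟩
  have hnorm := (eLpNorm_le_eLpNorm_of_exponent_le hmq hY).trans hYK
  rw [(hmem.mono_exponent hmq).eLpNorm_eq_integral_rpow_norm (by exact_mod_cast hm) (by simp),
    ENNReal.ofReal_le_ofReal_iff hK] at hnorm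
  simp only [ENNReal.toReal_natCast, Real.norm_eq_abs, Real.rpow_natCast] at hnorm
  have hpos : 0 ≤ ∫ ω, |Y ω| ^ m ∂P := integral_nonneg fun _ => by positivity
  calc ∫ ω, |Y ω| ^ m ∂P = ((∫ ω, |Y ω| ^ m ∂P) ^ (m : ℝ)⁻¹) ^ m :=
        (Real.rpow_inv_natCast_pow hpos hm).symm
    _ ≤ K ^ m := by gcongr

omit [MeasurableSpace Ω] in
lemma cellVec_dotProduct (A : Ω → Fin n → Fin p → ℝ) (i : Fin n) (D : Finset (Fin p)) (ω : Ω)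
    (w : Fin p → ℝ) : cellVec A i D ω ⬝ᵥ w = ∑ j ∈ D, A ω i j * w j := by
  simp [dotProduct, cellVec, Finset.sum_ite_mem]

omit [MeasurableSpace Ω] in
lemma sum_abs_cellVec (A : Ω → Fin n → Fin p → ℝ) (i : Fin n) (D : Finset (Fin p)) (ω : Ω) :
    ∑ j, |cellVec A i D ω j| = ∑ j ∈ D, |A ω i j| := by
  simp [cellVec, apply_ite abs, Finset.sum_ite_mem]

lemma measurable_mul_sum_abs (L : ℝ) : Measurable fun x : Fin p → ℝ => L * ∑ j, |x j| := by
  fun_prop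

lemma memLp_entry (hA : Measurable A)
    (hK : ∀ i j, eLpNorm (fun ω => A ω i j) q P ≤ ENNReal.ofReal K) (i : Fin n) (j : Fin p) :
    MemLp (fun ω => A ω i j) q P :=
  ⟨(measurable_entry hA i j).aestronglyMeasurable, (hK i j).trans_lt ENNReal.ofReal_lt_top⟩

lemma eLpNorm_map_cellVec_le (hA : Measurable A) (hq : 1 ≤ q)
    (hK : ∀ i j, eLpNorm (fun ω => A ω i j) q P ≤ ENNReal.ofReal K) {L : ℝ} (hL : 0 ≤ L)
    (i : Fin n) (D : Finset (Fin p)) :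
    eLpNorm (fun x => L * ∑ j, |x j|) q (P.map (cellVec A i D)) ≤
      ENNReal.ofReal (L * (D.card * K)) := by
  rw [eLpNorm_map_measure (measurable_mul_sum_abs L).aestronglyMeasurable
    (measurable_cellVec hA i D).aemeasurable]
  have hterm (j : Fin p) : eLpNorm (fun ω => L * |A ω i j|) q P ≤ ENNReal.ofReal (L * K) := by
    rw [ENNReal.ofReal_mul hL, ← Real.enorm_of_nonneg hL]
    refine (eLpNorm_const_smul_le (c := L) (f := fun ω => |A ω i j|)).trans ?_
    gcongr
    exact (eLpNorm_norm fun ω => A ω i j).trans_le (hK i j)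
  have hsum : (fun x => L * ∑ j, |x j|) ∘ cellVec A i D = ∑ j ∈ D, fun ω => L * |A ω i j| := by
    ext ω
    simp only [Function.comp_apply, sum_abs_cellVec, Finset.sum_apply]
    exact Finset.mul_sum ..
  rw [hsum]
  refine (eLpNorm_sum_le (fun j _ =>
    ((measurable_entry hA i j).abs.const_mul L).aestronglyMeasurable) hq).trans ?_
  refine (Finset.sum_le_card_nsmul D _ _ fun j _ => hterm j).trans_eq ?_
  rw [nsmul_eq_mul, ← ENNReal.ofReal_natCast, ← ENNReal.ofReal_mul (Nat.cast_nonneg _)]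
  congr 1
  ring

lemma IsIndepDesign.integral_map_cellVec_mul (hA : IsIndepDesign P A Sig)
    (hL2 : ∀ i j, MemLp (fun ω => A ω i j) 2 P) (i : Fin n) (D : Finset (Fin p))
    (w w' : Fin p → ℝ) :
    ∫ x, (x ⬝ᵥ w) * (x ⬝ᵥ w') ∂(P.map (cellVec A i D)) =
      ∑ j ∈ D, ∑ l ∈ D, w j * w' l * (Sig j l / n) := by
  have h_int (j l : Fin p) : Integrable (fun ω => w j * w' l * (A ω i j * A ω i l)) P :=
    ((hL2 i j).integrable_mul (hL2 i l)).const_mul _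
  have hexpand (ω : Ω) : (∑ j ∈ D, A ω i j * w j) * (∑ j ∈ D, A ω i j * w' j) =
      ∑ j ∈ D, ∑ l ∈ D, w j * w' l * (A ω i j * A ω i l) := by
    rw [Finset.sum_mul_sum]
    exact Finset.sum_congr rfl fun j _ => Finset.sum_congr rfl fun l _ => by ring
  rw [integral_map (measurable_cellVec hA.measurable i D).aemeasurable
    (by fun_prop : Continuous fun x : Fin p → ℝ => (x ⬝ᵥ w) * (x ⬝ᵥ w')).aestronglyMeasurable]
  simp_rw [cellVec_dotProduct, hexpand]
  rw [integral_finsetSum _ fun j _ => integrable_finsetSum _ fun l _ => h_int j l]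
  refine Finset.sum_congr rfl fun j _ => ?_
  rw [integral_finsetSum _ fun l _ => h_int j l]
  exact Finset.sum_congr rfl fun l _ => by rw [integral_const_mul, hA.cov]

lemma IsIndepDesign.integral_map_cellVec (hA : IsIndepDesign P A Sig)
    (h_int : ∀ i j, Integrable (fun ω => A ω i j) P) (i : Fin n) (D : Finset (Fin p))
    (w : Fin p → ℝ) : ∫ x, x ⬝ᵥ w ∂(P.map (cellVec A i D)) = 0 := by
  rw [integral_map (measurable_cellVec hA.measurable i D).aemeasurable
    (continuous_dotProduct_right w).aestronglyMeasurable]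
  simp only [cellVec_dotProduct]
  rw [integral_finsetSum _ fun j _ => (h_int i j).mul_const _]
  exact Finset.sum_eq_zero fun j _ => by rw [integral_mul_const, hA.mean, zero_mul]

lemma sum_cell_mul_le {M L : ℝ} (hS : Sig.PosSemidef) (hM : lambdaMax Sig ≤ M) (hM0 : 0 ≤ M)
    (D : Finset (Fin p)) {w : Fin p → ℝ} (hw : ∀ j, |w j| ≤ L) :
    ∑ j ∈ D, ∑ l ∈ D, w j * w l * (Sig j l / n) ≤ M * (D.card * L ^ 2) / n := by
  set u : Fin p → ℝ := fun j => if j ∈ D then w j else 0 with hu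
  have hquad : ∑ j ∈ D, ∑ l ∈ D, w j * w l * (Sig j l / n) = (u ⬝ᵥ Sig.mulVec u) / n := by
    simp only [hu, Matrix.mulVec, dotProduct, ite_mul, mul_ite, zero_mul, mul_zero,
      Finset.sum_ite_mem, Finset.univ_inter]
    simp only [Finset.sum_div, Finset.mul_sum]
    exact Finset.sum_congr rfl fun j _ => Finset.sum_congr rfl fun l _ => by ring
  have hnorm : ∑ j, u j ^ 2 ≤ D.card * L ^ 2 := by
    simp only [hu, ite_pow, zero_pow two_ne_zero, Finset.sum_ite_mem, Finset.univ_inter]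
    refine (Finset.sum_le_card_nsmul D _ (L ^ 2) fun j _ => ?_).trans_eq (nsmul_eq_mul _ _)
    exact sq_le_sq' (abs_le.1 (hw j)).1 (abs_le.1 (hw j)).2
  rw [hquad]
  refine div_le_div_of_nonneg_right ((dotProduct_mulVec_le_lambdaMax hS u).trans ?_)
    (Nat.cast_nonneg n)
  exact mul_le_mul hM hnorm (Finset.sum_nonneg fun _ _ => sq_nonneg _) hM0

lemma hasCellBounds_of_eLpNorm_le {ν : Measure (Fin p → ℝ)} [IsProbabilityMeasure ν]
    {s : Finset (Fin p → ℝ)} {B : (Fin p → ℝ) → ℝ} {c₀ v₂ r : ℝ} (hq : 4 ≤ q)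
    (hc₀ : c₀ = 0 ∨ c₀ = 1 ∧ 6 ≤ q) (hB : AEStronglyMeasurable B ν) (hB0 : ∀ x, 0 ≤ B x)
    (hle : ∀ w ∈ s, ∀ x, |x ⬝ᵥ w| ≤ B x) (hr0 : 0 ≤ r) (hr : r ≤ 1)
    (hnorm : eLpNorm B q ν ≤ ENNReal.ofReal r) (hmean : ∀ w ∈ s, ∫ x, x ⬝ᵥ w ∂ν = 0)
    (hsq : ∀ w ∈ s, ∫ x, (x ⬝ᵥ w) ^ 2 ∂ν ≤ v₂) :
    HasCellBounds ν s B c₀ v₂ (r ^ 4) (r ^ 3) := by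
  have hBq : MemLp B q ν := ⟨hB, hnorm.trans_lt ENNReal.ofReal_lt_top⟩
  have hdot (w : Fin p → ℝ) := (continuous_dotProduct_right w).aestronglyMeasurable (μ := ν)
  have hq3 : ((3 : ℕ) : ENNReal) ≤ q := le_trans (by norm_num) hq
  have hle' (w) (hw : w ∈ s) (x : Fin p → ℝ) : ‖x ⬝ᵥ w‖ ≤ ‖B x‖ :=
    (hle w hw x).trans (le_abs_self _)
  have hpow {m : ℕ} (hm : m ≠ 0) (hmq : (m : ENNReal) ≤ q) : ∫ x, B x ^ m ∂ν ≤ r ^ m := by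
    simpa only [abs_of_nonneg (hB0 _)] using integral_abs_pow_le hB hr0 hnorm hm hmq
  refine ⟨‹_›, fun w hw => (hBq.mono (hdot w) (ae_of_all _ (hle' w hw))).mono_exponent hq, hmean,
    hsq, fun w hw => ?_, integrable_pow_of_memLp hBq hq3, ?_, hpow three_ne_zero hq3, ?_⟩
  · simpa only [(by decide : Even 4).pow_abs] using integral_abs_pow_le (hdot w) hr0
      ((eLpNorm_mono (hle' w hw)).trans hnorm) four_ne_zero hq
  · rcases hc₀ with rfl | ⟨rfl, hq6⟩
    · simp
    · simpa only [one_mul] using integrable_pow_of_memLp hBq hq6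
  · rcases hc₀ with rfl | ⟨rfl, hq6⟩
    · simpa using by positivity
    · simp only [one_mul]
      exact (hpow (by norm_num) hq6).trans (pow_le_pow_of_le_one hr0 hr (by norm_num))

theorem IsIndepDesign.hasCellBounds [IsProbabilityMeasure P] (hA : IsIndepDesign P A Sig)
    (hS : Sig.PosSemidef) {M : ℝ} (hM : lambdaMax Sig ≤ M) (hM0 : 0 ≤ M) (hq : 4 ≤ q)
    (hK0 : 0 ≤ K) (hK : ∀ i j, eLpNorm (fun ω => A ω i j) q P ≤ ENNReal.ofReal K) {c₀ : ℝ}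
    (hc₀ : c₀ = 0 ∨ c₀ = 1 ∧ 6 ≤ q) {s : Finset (Fin p → ℝ)} {L : ℝ} (hL : 0 ≤ L)
    (hs : ∀ w ∈ s, ∀ j, |w j| ≤ L) (i : Fin n) (D : Finset (Fin p))
    (hr : L * (D.card * K) ≤ 1) :
    HasCellBounds (P.map (cellVec A i D)) s (fun x => L * ∑ j, |x j|) c₀
      (M * (D.card * L ^ 2) / n) ((L * (D.card * K)) ^ 4) ((L * (D.card * K)) ^ 3) := by
  have := Measure.isProbabilityMeasure_map (μ := P)
    (measurable_cellVec hA.measurable i D).aemeasurable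
  have hentry := memLp_entry hA.measurable hK
  refine hasCellBounds_of_eLpNorm_le hq hc₀ (measurable_mul_sum_abs L).aestronglyMeasurable
    (fun x => by positivity) (fun w hw x => abs_dotProduct_le_mul_sum_abs x (hs w hw))
    (by positivity) hr
    (eLpNorm_map_cellVec_le hA.measurable (le_trans (by norm_num) hq) hK hL i D)
    (fun w _ => hA.integral_map_cellVec
      (fun i j => (hentry i j).integrable (le_trans (by norm_num) hq)) i D w) fun w hw => ?_
  simp only [sq (_ ⬝ᵥ w)]
  rw [hA.integral_map_cellVec_mul fun i j =>
    (hentry i j).mono_exponent (le_trans (by norm_num) hq)]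
  exact sum_cell_mul_le hS hM hM0 D (hs w hw)

end CellMoments

/-- A partition of the coordinates into cells with at most `d` elements each. -/
structure IsCellPartition {k p : ℕ} (B : Fin k → Finset (Fin p)) (d : ℕ) : Prop where
  disjoint : Pairwise fun a b => Disjoint (B a) (B b)
  cover : ∀ j, ∃ a, j ∈ B a
  card_le : ∀ a, (B a).card ≤ d

section Comparison

variable {Ω : Type*} [MeasurableSpace Ω] {P : Measure Ω} {n p : ℕ}

lemma IsCellPartition.sum_card_pow_le {k d : ℕ} {B : Fin k → Finset (Fin p)}
    (hB : IsCellPartition B d) (m : ℕ) : ∑ a, (B a).card ^ (m + 1) ≤ d ^ m * p := by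
  have hsum : ∑ a, (B a).card ≤ p := by
    rw [← Finset.card_biUnion fun a _ b _ hab => hB.disjoint hab]
    exact (Finset.card_le_univ _).trans_eq (Fintype.card_fin p)
  calc ∑ a, (B a).card ^ (m + 1) ≤ ∑ a, d ^ m * (B a).card :=
        Finset.sum_le_sum fun a _ => by
          rw [pow_succ]
          gcongr
          exact hB.card_le a
    _ = d ^ m * ∑ a, (B a).card := by rw [Finset.mul_sum]
    _ ≤ d ^ m * p := by gcongr

lemma IsCellPartition.sum_mul_card_pow_le {k d : ℕ} {B : Fin k → Finset (Fin p)}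
    (hB : IsCellPartition B d) {L K : ℝ} (hL : 0 ≤ L) (hK : 0 ≤ K) (m : ℕ) :
    ∑ a, (L * ((B a).card * K)) ^ (m + 1) ≤ (L * K) ^ (m + 1) * (d ^ m * p) := by
  calc ∑ a, (L * ((B a).card * K)) ^ (m + 1)
      = (L * K) ^ (m + 1) * ((∑ a, (B a).card ^ (m + 1) : ℕ) : ℝ) := by
        push_cast
        rw [Finset.mul_sum]
        exact Finset.sum_congr rfl fun a _ => by ring
    _ ≤ _ := by
        gcongr
        exact_mod_cast hB.sum_card_pow_le m

lemma sum_filter_sigma_fst {k : Fin n → ℕ} (f : (i : Fin n) × Fin (k i) → ℝ) (i : Fin n) :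
    ∑ c : (i : Fin n) × Fin (k i) with c.1 = i, f c = ∑ a, f ⟨i, a⟩ := by
  rw [Finset.sum_filter, Fintype.sum_sigma, Finset.sum_eq_single i]
  · simp
  · intro i' _ hi
    simp [hi]
  · simp

variable {k : Fin n → ℕ} {d : ℕ} {B : ∀ i, Fin (k i) → Finset (Fin p)}

omit [MeasurableSpace Ω] in
lemma assemble_cellVec (A : Ω → Fin n → Fin p → ℝ) (hB : ∀ i, IsCellPartition (B i) d) (ω : Ω) :
    assemble (Sigma.fst : ((i : Fin n) × Fin (k i)) → Fin n)
      (fun c => cellVec A c.1 (B c.1 c.2) ω) = A ω := by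
  ext i j
  obtain ⟨a, ha⟩ := (hB i).cover j
  rw [assemble, Finset.sum_eq_single ⟨i, a⟩]
  · simp [cellVec, ha]
  · rintro ⟨i', a'⟩ - hne
    rcases eq_or_ne i' i with rfl | hi
    · have haa' : a' ≠ a := fun h => hne (by rw [h])
      simp [cellVec, Finset.disjoint_right.1 ((hB i').disjoint haa') ha]
    · simp [hi]
  · simp

variable [IsProbabilityMeasure P]

lemma integral_comp_design_eq {A : Ω → Fin n → Fin p → ℝ} (hA : Measurable A)
    (hrows : iIndepFun (fun i ω => A ω i) P) (hB : ∀ i, IsCellPartition (B i) d)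
    (hcells : ∀ i, iIndepFun
      (fun (a : Fin (k i)) (ω : Ω) (j : {j : Fin p // j ∈ B i a}) => A ω i j) P)
    {f : (Fin n → Fin p → ℝ) → ℝ} (hf : Measurable f) :
    ∫ ω, f (A ω) ∂P = ∫ y, f (assemble Sigma.fst y)
      ∂(Measure.pi fun c : (i : Fin n) × Fin (k i) => P.map (cellVec A c.1 (B c.1 c.2))) := by
  have hm (c : (i : Fin n) × Fin (k i)) := measurable_cellVec hA c.1 (B c.1 c.2)
  rw [← (iIndepFun_iff_map_fun_eq_pi_map fun c => (hm c).aemeasurable).1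
    (iIndepFun_cellVec hA hrows k B hcells), integral_map]
  · simp_rw [assemble_cellVec A hB]
  · exact (measurable_pi_iff.2 hm).aemeasurable
  · exact (hf.comp (continuous_assemble _).measurable).aestronglyMeasurable

/-- `n` independent rows, each of them with independent subvectors on the cells of a partition, and
entries with a `q`-th moment controlled by `K`. -/
structure IsBlockDesign (P : Measure Ω) (A : Ω → Fin n → Fin p → ℝ)
    (Sig : Matrix (Fin p) (Fin p) ℝ) (B : ∀ i, Fin (k i) → Finset (Fin p)) (q : ENNReal) (K : ℝ) :
    Prop extends IsIndepDesign P A Sig where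
  indep_cells : ∀ i, iIndepFun
    (fun (a : Fin (k i)) (ω : Ω) (j : {j : Fin p // j ∈ B i a}) => A ω i j) P
  eLpNorm_le : ∀ i j, eLpNorm (fun ω => A ω i j) q P ≤ ENNReal.ofReal K

variable {X G : Ω → Fin n → Fin p → ℝ} {Sig : Matrix (Fin p) (Fin p) ℝ} {M K L c₀ C : ℝ}
  {q : ENNReal} {g g₁ g₂ g₃ V : ℝ → ℝ} {s : Finset (Fin p → ℝ)} {θ t : ℝ}

theorem abs_integral_softTest_design_sub_le_sum (hX : IsBlockDesign P X Sig B q K)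
    (hG : IsBlockDesign P G Sig B q K) (hB : ∀ i, IsCellPartition (B i) d) (hS : Sig.PosSemidef)
    (hM : lambdaMax Sig ≤ M) (hM0 : 0 ≤ M) (hq : 4 ≤ q) (hK : 0 ≤ K)
    (hg : IsTame g g₁ g₂ g₃ V c₀ C) (hc₀ : c₀ = 0 ∨ c₀ = 1 ∧ 6 ≤ q) (hs : s.Nonempty) (hL : 0 ≤ L)
    (hsL : ∀ w ∈ s, ∀ j, |w j| ≤ L) (hr : L * (d * K) ≤ 1) (m : ℝ) (hθ : 1 ≤ θ) (ht : |t| ≤ 1)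
    (ρ : (Fin p → ℝ) → ℝ) (e : Fin n → ℝ) :
    |∫ ω, softTest s g θ ρ t m e (X ω) ∂P - ∫ ω, softTest s g θ ρ t m e (G ω) ∂P| ≤
      ∑ c : (i : Fin n) × Fin (k i),
        46 * |t| * (θ * C) ^ 3 * C * (L * ((B c.1 c.2).card * K)) ^ 3 *
        (5 + 16 * c₀ * (1 + 3 * (M * (p * L ^ 2) / n) ^ 2 + (L * K) ^ 4 * (d ^ 3 * p) +
          |e c.1| ^ 3)) := by
  have hmeas : Measurable fun A : Fin n → Fin p → ℝ => softTest s g θ ρ t m e A :=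
    ((continuous_softTest hg.continuous θ ρ hs t m).comp
      (continuous_id.prodMk continuous_const)).measurable
  have hr' (c : (i : Fin n) × Fin (k i)) : L * ((B c.1 c.2).card * K) ≤ 1 := by
    refine le_trans ?_ hr
    gcongr
    exact (hB c.1).card_le c.2
  rw [integral_comp_design_eq hX.measurable hX.indep hB hX.indep_cells hmeas,
    integral_comp_design_eq hG.measurable hG.indep hB hG.indep_cells hmeas]
  refine abs_integral_softTest_sub_le θ ρ e hg hs m hθ ht
    (fun c => hX.hasCellBounds hS hM hM0 hq hK hX.eLpNorm_le hc₀ hL hsL _ _ (hr' c))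
    (fun c => hG.hasCellBounds hS hM hM0 hq hK hG.eLpNorm_le hc₀ hL hsL _ _ (hr' c))
    (fun x w hw => abs_dotProduct_le_mul_sum_abs x (hsL w hw)) (fun c w _ w' _ => ?_)
    (fun i => ?_) fun i => ?_
  · have hL2 {A : Ω → Fin n → Fin p → ℝ} (hA : IsBlockDesign P A Sig B q K) (i : Fin n)
        (j : Fin p) : MemLp (fun ω => A ω i j) 2 P :=
      (memLp_entry hA.measurable hA.eLpNorm_le i j).mono_exponent (le_trans (by norm_num) hq)
    rw [hX.integral_map_cellVec_mul (hL2 hX), hG.integral_map_cellVec_mul (hL2 hG)]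
  · have hcard := (hB i).sum_card_pow_le 0
    simp only [zero_add, pow_one, pow_zero, one_mul] at hcard
    rw [sum_filter_sigma_fst, ← Finset.sum_div, ← Finset.mul_sum, ← Finset.sum_mul]
    gcongr
    exact_mod_cast hcard
  · rw [sum_filter_sigma_fst]
    exact (hB i).sum_mul_card_pow_le hL hK 3

theorem abs_integral_softTest_design_sub_le (hX : IsBlockDesign P X Sig B q K)
    (hG : IsBlockDesign P G Sig B q K) (hB : ∀ i, IsCellPartition (B i) d) (hS : Sig.PosSemidef)
    (hM : lambdaMax Sig ≤ M) (hM0 : 0 ≤ M) (hq : 4 ≤ q) (hK : 0 ≤ K)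
    (hg : IsTame g g₁ g₂ g₃ V c₀ C) (hc₀ : c₀ = 0 ∨ c₀ = 1 ∧ 6 ≤ q) (hs : s.Nonempty) (hL : 0 ≤ L)
    (hsL : ∀ w ∈ s, ∀ j, |w j| ≤ L) (hr : L * (d * K) ≤ 1) (m : ℝ) (hθ : 1 ≤ θ) (ht : |t| ≤ 1)
    (ρ : (Fin p → ℝ) → ℝ) (e : Fin n → ℝ) :
    |∫ ω, softTest s g θ ρ t m e (X ω) ∂P - ∫ ω, softTest s g θ ρ t m e (G ω) ∂P| ≤
      46 * |t| * (θ * C) ^ 3 * C * ((L * K) ^ 3 * (d ^ 2 * p)) *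
        ∑ i, (5 + 16 * c₀ * (1 + 3 * (M * (p * L ^ 2) / n) ^ 2 + (L * K) ^ 4 * (d ^ 3 * p) +
          |e i| ^ 3)) := by
  refine (abs_integral_softTest_design_sub_le_sum hX hG hB hS hM hM0 hq hK hg hc₀ hs hL hsL hr m hθ
    ht ρ e).trans ?_
  rw [Fintype.sum_sigma, Finset.mul_sum]
  refine Finset.sum_le_sum fun i _ => ?_
  simp only [← Finset.sum_mul, ← Finset.mul_sum]
  have hC := hg.one_le
  have hc := hg.c_nonneg
  gcongr
  exact (hB i).sum_mul_card_pow_le hL hK 2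

end Comparison

section Events

variable {Ω : Type*} [MeasurableSpace Ω] {P : Measure Ω} [IsProbabilityMeasure P]

lemma integrable_of_mem_Icc {f : Ω → ℝ} (hf : AEStronglyMeasurable f P)
    (hfI : ∀ ω, f ω ∈ Set.Icc (0 : ℝ) 1) : Integrable f P :=
  Integrable.of_bound hf 1 (ae_of_all _ fun ω => by
    rw [Real.norm_eq_abs, abs_of_nonneg (hfI ω).1]; exact (hfI ω).2)

lemma measureReal_one_sub_le_le {f : Ω → ℝ} (hf : Measurable f)
    (hfI : ∀ ω, f ω ∈ Set.Icc (0 : ℝ) 1) {η : ℝ} (hη : 0 ≤ η) :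
    P.real {ω | 1 - η ≤ f ω} ≤ ∫ ω, f ω ∂P + η := by
  have markov := mul_meas_ge_le_integral_of_nonneg (ae_of_all P fun ω => (hfI ω).1)
    (integrable_of_mem_Icc hf.aestronglyMeasurable hfI) (1 - η)
  have hle : η * P.real {ω | 1 - η ≤ f ω} ≤ η := mul_le_of_le_one_right hη measureReal_le_one
  linarith

lemma integral_le_add_measureReal_lt {h : Ω → ℝ} (hh : Measurable h)
    (hhI : ∀ ω, h ω ∈ Set.Icc (0 : ℝ) 1) {η : ℝ} (hη : 0 ≤ η) :
    ∫ ω, h ω ∂P ≤ η + P.real {ω | η < h ω} := by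
  have hs : MeasurableSet {ω | η < h ω} := measurableSet_lt measurable_const hh
  have hi : Integrable ({ω | η < h ω}.indicator fun _ => (1 : ℝ)) P :=
    (integrable_const _).indicator hs
  calc ∫ ω, h ω ∂P ≤ ∫ ω, (η + {ω | η < h ω}.indicator (fun _ => (1 : ℝ)) ω) ∂P := by
        refine integral_mono (integrable_of_mem_Icc hh.aestronglyMeasurable hhI)
          ((integrable_const _).add hi) fun ω => ?_
        by_cases hω : η < h ω
        · simp only [Set.indicator_of_mem (show ω ∈ {ω | η < h ω} from hω)]
          linarith [(hhI ω).2]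
        · simp only [Set.indicator_of_notMem (show ω ∉ {ω | η < h ω} from hω)]
          linarith
    _ = _ := by
        rw [integral_add (integrable_const _) hi, integral_indicator_const _ hs]
        simp

lemma measureReal_le_add_of_diff_subset {S T N : Set Ω} (h : S \ N ⊆ T) :
    P.real S ≤ P.real T + P.real N :=
  (measureReal_mono (Set.sdiff_subset_iff.1 h) (measure_ne_top _ _)).trans
    ((measureReal_union_le _ _).trans_eq (add_comm _ _))

lemma measureReal_le_of_integral_le {f h : Ω → ℝ} (hf : Measurable f) (hh : Measurable h)
    (hfI : ∀ ω, f ω ∈ Set.Icc (0 : ℝ) 1) (hhI : ∀ ω, h ω ∈ Set.Icc (0 : ℝ) 1)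
    {η E : ℝ} (hη : 0 ≤ η) (hE : ∫ ω, f ω ∂P ≤ ∫ ω, h ω ∂P + E) {S T N N' : Set Ω}
    (hS : ∀ ω ∈ S, ω ∉ N → 1 - η ≤ f ω) (hT : ∀ ω, η < h ω → ω ∉ N' → ω ∈ T) :
    P.real S ≤ P.real T + (P.real N + P.real N') + E + 2 * η := by
  have hSf : P.real S ≤ P.real {ω | 1 - η ≤ f ω} + P.real N :=
    measureReal_le_add_of_diff_subset fun ω hω => hS ω hω.1 hω.2
  have hhT : P.real {ω | η < h ω} ≤ P.real T + P.real N' :=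
    measureReal_le_add_of_diff_subset fun ω hω => hT ω hω.1 hω.2
  linarith [measureReal_one_sub_le_le (P := P) hf hfI hη,
    integral_le_add_measureReal_lt (P := P) hh hhI hη]

variable {α β : Type*} [MeasurableSpace α] [MeasurableSpace β] {X G Y : Ω → α} {ξ : Ω → β}
  {f : α × β → ℝ}

omit [IsProbabilityMeasure P] in
lemma integral_comp_eq_integral_map (hY : Measurable Y) (hf : Measurable f) (e : β) :
    ∫ ω, f (Y ω, e) ∂P = ∫ x, f (x, e) ∂(P.map Y) :=
  (integral_map (f := fun x => f (x, e)) hY.aemeasurable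
    (hf.comp (measurable_id.prodMk measurable_const)).aestronglyMeasurable).symm

lemma integrable_integral_comp (hY : Measurable Y) (hξ : Measurable ξ) (hf : Measurable f)
    (hfI : ∀ z, f z ∈ Set.Icc (0 : ℝ) 1) :
    Integrable (fun e => ∫ ω, f (Y ω, e) ∂P) (P.map ξ) := by
  have := Measure.isProbabilityMeasure_map (μ := P) hξ.aemeasurable
  have := Measure.isProbabilityMeasure_map (μ := P) hY.aemeasurable
  simp_rw [integral_comp_eq_integral_map hY hf]
  exact (integrable_of_mem_Icc (P := (P.map Y).prod (P.map ξ)) hf.aestronglyMeasurable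
    hfI).integral_prod_right

lemma integral_comp_prodMk_of_indepFun (hY : Measurable Y) (hξ : Measurable ξ)
    (hYξ : IndepFun Y ξ P) (hf : Measurable f) (hfI : ∀ z, f z ∈ Set.Icc (0 : ℝ) 1) :
    ∫ ω, f (Y ω, ξ ω) ∂P = ∫ e, ∫ ω, f (Y ω, e) ∂P ∂(P.map ξ) := by
  have := Measure.isProbabilityMeasure_map (μ := P) hξ.aemeasurable
  have := Measure.isProbabilityMeasure_map (μ := P) hY.aemeasurable
  simp_rw [integral_comp_eq_integral_map hY hf]
  rw [← integral_prod_symm _ (integrable_of_mem_Icc hf.aestronglyMeasurable hfI),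
    ← (indepFun_iff_map_prod_eq_prod_map_map hY.aemeasurable hξ.aemeasurable).1 hYξ,
    integral_map (hY.prodMk hξ).aemeasurable hf.aestronglyMeasurable]

lemma abs_integral_comp_sub_le_one (hX : Measurable X) (hG : Measurable G) (hf : Measurable f)
    (hfI : ∀ z, f z ∈ Set.Icc (0 : ℝ) 1) (e : β) :
    |∫ ω, f (X ω, e) ∂P - ∫ ω, f (G ω, e) ∂P| ≤ 1 := by
  have hmem : ∀ Y : Ω → α, Measurable Y → ∫ ω, f (Y ω, e) ∂P ∈ Set.Icc (0 : ℝ) 1 := fun Y hY => by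
    refine ⟨integral_nonneg fun _ => (hfI _).1, ?_⟩
    have hi := integrable_of_mem_Icc (P := P) (f := fun ω => f (Y ω, e))
      (hf.comp (hY.prodMk measurable_const)).aestronglyMeasurable fun _ => hfI _
    simpa using integral_mono hi (integrable_const (1 : ℝ)) fun ω => (hfI (Y ω, e)).2
  simpa [Real.dist_eq] using Real.dist_le_of_mem_Icc (hmem X hX) (hmem G hG)

lemma abs_integral_comp_noise_sub_le (hX : Measurable X) (hG : Measurable G) (hξ : Measurable ξ)
    (hXξ : IndepFun X ξ P) (hGξ : IndepFun G ξ P) (hf : Measurable f)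
    (hfI : ∀ z, f z ∈ Set.Icc (0 : ℝ) 1) {N : Set β} (hN : MeasurableSet N) {E₀ : ℝ}
    (hE₀ : 0 ≤ E₀)
    (h : ∀ e ∉ N, |∫ ω, f (X ω, e) ∂P - ∫ ω, f (G ω, e) ∂P| ≤ E₀) :
    |∫ ω, f (X ω, ξ ω) ∂P - ∫ ω, f (G ω, ξ ω) ∂P| ≤ E₀ + P.real (ξ ⁻¹' N) := by
  have := Measure.isProbabilityMeasure_map (μ := P) hξ.aemeasurable
  have hXi := integrable_integral_comp (P := P) hX hξ hf hfI
  have hGi := integrable_integral_comp (P := P) hG hξ hf hfI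
  rw [integral_comp_prodMk_of_indepFun hX hξ hXξ hf hfI,
    integral_comp_prodMk_of_indepFun hG hξ hGξ hf hfI, ← integral_sub hXi hGi]
  have hi : Integrable (N.indicator fun _ => (1 : ℝ)) (P.map ξ) := (integrable_const _).indicator hN
  refine abs_integral_le_integral_abs.trans ?_
  calc ∫ e, |∫ ω, f (X ω, e) ∂P - ∫ ω, f (G ω, e) ∂P| ∂(P.map ξ)
      ≤ ∫ e, (E₀ + N.indicator (fun _ => (1 : ℝ)) e) ∂(P.map ξ) := by
        refine integral_mono (hXi.sub hGi).abs ((integrable_const _).add hi) fun e => ?_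
        by_cases he : e ∈ N
        · simp only [Set.indicator_of_mem he]
          exact (abs_integral_comp_sub_le_one hX hG hf hfI e).trans (by linarith)
        · simp only [Set.indicator_of_notMem he, add_zero]
          exact h e he
    _ = _ := by
        rw [integral_add (integrable_const _) hi, integral_indicator_const _ hN,
          map_measureReal_apply hξ hN]
        simp

end Events

section SoftMin

variable {n p : ℕ}

lemma neg_le_log_partitionFn {κ : Type*} {s : Finset κ} (E : κ → ℝ) {w : κ} (hw : w ∈ s) :
    -E w ≤ Real.log (partitionFn s E) := by
  rw [Real.le_log_iff_exp_le (partitionFn_pos ⟨w, hw⟩ E)]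
  exact Finset.single_le_sum (f := fun w => Real.exp (-E w)) (fun _ _ => (Real.exp_pos _).le) hw

lemma log_partitionFn_le {κ : Type*} {s : Finset κ} (hs : s.Nonempty) {E : κ → ℝ} {a : ℝ}
    (ha : ∀ w ∈ s, a ≤ E w) : Real.log (partitionFn s E) ≤ Real.log s.card - a := by
  have hcard : (0 : ℝ) < s.card := by exact_mod_cast hs.card_pos
  rw [Real.log_le_iff_le_exp (partitionFn_pos hs E), sub_eq_add_neg, Real.exp_add,
    Real.exp_log hcard, partitionFn]
  refine (Finset.sum_le_card_nsmul s _ (Real.exp (-a)) fun w hw => ?_).trans (by simp)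
  exact Real.exp_le_exp.2 (neg_le_neg (ha w hw))

lemma risk_eq (l : RegressionLoss) (R : (Fin p → ℝ) → ℝ) (A : Fin n → Fin p → ℝ) (e : Fin n → ℝ)
    (w : Fin p → ℝ) : risk l R A e w = 1 / (n : ℝ) * ∑ i, l.fn (A i ⬝ᵥ w - e i) + R w := rfl

lemma abs_energy_sub_risk_le (l : RegressionLoss) (R : (Fin p → ℝ) → ℝ) {g : ℝ → ℝ} {θ : ℝ}
    (hn : 1 ≤ n) (A : Fin n → Fin p → ℝ) (e : Fin n → ℝ) (w : Fin p → ℝ) {σ : ℝ} (hθ : 0 ≤ θ)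
    (hg : ∀ t, |g t - l.fn t| ≤ σ) :
    |energy g θ (fun w => θ * n * R w) e A w - θ * n * risk l R A e w| ≤ θ * n * σ := by
  have hn0 : (n : ℝ) ≠ 0 := by positivity
  have hdiff : energy g θ (fun w => θ * n * R w) e A w - θ * n * risk l R A e w =
      θ * ∑ i, (g (A i ⬝ᵥ w - e i) - l.fn (A i ⬝ᵥ w - e i)) := by
    rw [risk_eq, energy, ← Finset.mul_sum, Finset.sum_sub_distrib]
    field_simp
    ring
  rw [hdiff, abs_mul, abs_of_nonneg hθ, mul_assoc]
  refine mul_le_mul_of_nonneg_left ?_ hθ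
  refine (Finset.abs_sum_le_sum_abs _ _).trans ?_
  exact (Finset.sum_le_card_nsmul _ _ σ fun i _ => hg _).trans (by simp)

/-- The smooth indicator `softTest` with parameters chosen so that it is close to `1` when the risk
exceeds the level `m` on `s` and close to `0` when the risk falls below `m` somewhere on `s`; `θ` is
the inverse temperature of the soft minimum and `K` the steepness of the indicator. -/
def levelTest (s : Finset (Fin p → ℝ)) (g : ℝ → ℝ) (θ : ℝ) (R : (Fin p → ℝ) → ℝ) (K m : ℝ)
    (e : Fin n → ℝ) (A : Fin n → Fin p → ℝ) : ℝ :=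
  softTest s g θ (fun w => θ * n * R w) (-(K / (θ * n))) (-(K * m)) e A

lemma levelTest_eq (s : Finset (Fin p → ℝ)) (g : ℝ → ℝ) (θ : ℝ) (R : (Fin p → ℝ) → ℝ) (K m : ℝ)
    (e : Fin n → ℝ) (A : Fin n → Fin p → ℝ) :
    levelTest s g θ R K m e A = Real.sigmoid (K * (-(Real.log
      (partitionFn s (energy g θ (fun w => θ * n * R w) e A)) / (θ * n)) - m)) := by
  unfold levelTest softTest
  congr 1
  ring

lemma levelTest_mem_Icc (s : Finset (Fin p → ℝ)) (g : ℝ → ℝ) (θ : ℝ) (R : (Fin p → ℝ) → ℝ)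
    (K m : ℝ) (e : Fin n → ℝ) (A : Fin n → Fin p → ℝ) :
    levelTest s g θ R K m e A ∈ Set.Icc (0 : ℝ) 1 :=
  ⟨Real.sigmoid_nonneg _, Real.sigmoid_le_one _⟩

section

variable (l : RegressionLoss) (R : (Fin p → ℝ) → ℝ) {g : ℝ → ℝ} {θ σ γ K : ℝ} (hn : 1 ≤ n)
  (A : Fin n → Fin p → ℝ) (e : Fin n → ℝ) (hθ : 0 < θ) (hg : ∀ t, |g t - l.fn t| ≤ σ)
  (hσ : σ ≤ γ / 2) (hK : 0 ≤ K) {s : Finset (Fin p → ℝ)} {m : ℝ}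
include hn hθ hg hσ hK

lemma le_levelTest_of_le_risk (hs : s.Nonempty) (hcard : Real.log s.card ≤ θ * n * (γ / 2))
    (h : ∀ w ∈ s, m + 2 * γ ≤ risk l R A e w) :
    1 - Real.sigmoid (-(K * γ)) ≤ levelTest s g θ R K m e A := by
  have hβ : 0 < θ * n := mul_pos hθ (by exact_mod_cast hn)
  have hlog : Real.log (partitionFn s (energy g θ (fun w => θ * n * R w) e A)) ≤
      Real.log s.card - θ * n * (m + 2 * γ - γ / 2) := by
    refine log_partitionFn_le hs fun w hw => ?_
    nlinarith [(abs_le.1 (abs_energy_sub_risk_le l R hn A e w hθ.le hg)).1,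
      mul_le_mul_of_nonneg_left (h w hw) hβ.le, mul_le_mul_of_nonneg_left hσ hβ.le]
  have hdiv : Real.log (partitionFn s (energy g θ (fun w => θ * n * R w) e A)) / (θ * n) ≤
      -m - γ := by
    rw [div_le_iff₀ hβ]
    nlinarith
  rw [levelTest_eq, Real.sigmoid_neg, sub_sub_cancel]
  exact Real.sigmoid_le (mul_le_mul_of_nonneg_left (by linarith) hK)

lemma levelTest_le_of_risk_le (hγ : 0 ≤ γ) {w : Fin p → ℝ} (hw : w ∈ s)
    (hle : risk l R A e w ≤ m - 2 * γ) :
    levelTest s g θ R K m e A ≤ Real.sigmoid (-(K * γ)) := by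
  have hβ : 0 < θ * n := mul_pos hθ (by exact_mod_cast hn)
  have hdiv : -m + γ ≤
      Real.log (partitionFn s (energy g θ (fun w => θ * n * R w) e A)) / (θ * n) := by
    rw [le_div_iff₀ hβ]
    nlinarith [neg_le_log_partitionFn (energy g θ (fun w => θ * n * R w) e A) hw,
      (abs_le.1 (abs_energy_sub_risk_le l R hn A e w hθ.le hg)).2,
      mul_le_mul_of_nonneg_left hle hβ.le, mul_le_mul_of_nonneg_left hσ hβ.le,
      mul_nonneg hβ.le hγ]
  rw [levelTest_eq, ← mul_neg]
  exact Real.sigmoid_le (mul_le_mul_of_nonneg_left (by linarith) hK)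

end

section

variable (l : RegressionLoss) {L δ : ℝ} (hL : 0 ≤ L) (hδ : 0 ≤ δ)
  {w w' : Fin p → ℝ} (hw : ∀ j, |w j| ≤ L) (hw' : ∀ j, |w' j| ≤ L)
  (hclose : ∀ j, |w j - w' j| ≤ δ)
include hL hδ hw hw' hclose

lemma fn_residual_le_of_close (x : Fin p → ℝ) (b : ℝ) :
    l.fn (x ⬝ᵥ w' - b) ≤ l.fn (x ⬝ᵥ w - b) +
      l.slope * δ * (3 + (3 + 2 * L) * (∑ j, |x j|) ^ 2 + 2 * (l.growthFlag * |b| ^ 3)) := by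
  have hc0 := l.growthFlag_nonneg
  have hc := l.growthFlag_le_one
  have hsl := l.slope_pos
  set c := l.growthFlag
  set S := ∑ j, |x j|
  have hdiff : |x ⬝ᵥ w' - b - (x ⬝ᵥ w - b)| ≤ δ * S := by
    rw [sub_sub_sub_cancel_right, ← dotProduct_sub]
    exact abs_dotProduct_le_mul_sum_abs x fun j => by
      rw [Pi.sub_apply, abs_sub_comm]; exact hclose j
  have hsize : |x ⬝ᵥ w' - b| + |x ⬝ᵥ w - b| ≤ 2 * L * S + 2 * |b| := by
    linarith [abs_sub (x ⬝ᵥ w') b, abs_sub (x ⬝ᵥ w) b, abs_dotProduct_le_mul_sum_abs x hw,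
      abs_dotProduct_le_mul_sum_abs x hw']
  have hpoly : S * (1 + c * (2 * L * S + 2 * |b|)) ≤
      3 + (3 + 2 * L) * S ^ 2 + 2 * (c * |b| ^ 3) := by
    have hsq : |b| ^ 2 ≤ 1 + |b| ^ 3 := by
      nlinarith [mul_nonneg (abs_nonneg b) (sq_nonneg (|b| - 1)), sq_nonneg (|b| - 1)]
    have hSb : 2 * (S * |b|) ≤ S ^ 2 + (1 + |b| ^ 3) := by nlinarith [sq_nonneg (S - |b|)]
    have hcube : 0 ≤ c * |b| ^ 3 := by positivity
    nlinarith [sq_nonneg (S - 1), mul_le_mul_of_nonneg_left hSb hc0,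
      mul_le_mul_of_nonneg_right hc (show 0 ≤ 2 * L * S ^ 2 by positivity),
      mul_le_mul_of_nonneg_right hc (sq_nonneg S)]
  have hlip : l.slope * |x ⬝ᵥ w' - b - (x ⬝ᵥ w - b)| *
      (1 + c * (|x ⬝ᵥ w' - b| + |x ⬝ᵥ w - b|)) ≤
      l.slope * (δ * S) * (1 + c * (2 * L * S + 2 * |b|)) := by
    gcongr
  linarith [(abs_le.1 (l.abs_fn_sub_le (x ⬝ᵥ w' - b) (x ⬝ᵥ w - b))).2,
    mul_le_mul_of_nonneg_left hpoly (mul_nonneg hsl.le hδ)]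

lemma risk_le_of_close (hn : 1 ≤ n) (R : (Fin p → ℝ) → ℝ) (A : Fin n → Fin p → ℝ)
    (e : Fin n → ℝ) {δ' K₀ : ℝ} (hR : R w' ≤ R w + δ')
    (hA : ∑ i, (∑ j, |A i j|) ^ 2 ≤ (n : ℝ) ^ 3)
    (he : l.growthFlag * ∑ i, |e i| ^ 3 ≤ K₀ * n) :
    risk l R A e w' ≤ risk l R A e w + l.slope * δ * (3 + (3 + 2 * L) * n ^ 2 + 2 * K₀) + δ' := by
  have hsum := Finset.sum_le_sum fun i (_ : i ∈ Finset.univ) =>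
    fn_residual_le_of_close l hL hδ hw hw' hclose (A i) (e i)
  rw [Finset.sum_add_distrib, ← Finset.mul_sum, Finset.sum_add_distrib, Finset.sum_add_distrib,
    ← Finset.mul_sum, ← Finset.mul_sum, ← Finset.mul_sum, Finset.sum_const, Finset.card_univ,
    Fintype.card_fin, nsmul_eq_mul] at hsum
  have hbracket : (n : ℝ) * 3 + (3 + 2 * L) * ∑ i, (∑ j, |A i j|) ^ 2 +
      2 * (l.growthFlag * ∑ i, |e i| ^ 3) ≤ n * (3 + (3 + 2 * L) * n ^ 2 + 2 * K₀) := by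
    nlinarith [mul_le_mul_of_nonneg_left hA (show 0 ≤ 3 + 2 * L by positivity)]
  have hloss : (1 / (n : ℝ)) * ∑ i, l.fn (A i ⬝ᵥ w' - e i) ≤
      (1 / (n : ℝ)) * ∑ i, l.fn (A i ⬝ᵥ w - e i) +
      l.slope * δ * (3 + (3 + 2 * L) * n ^ 2 + 2 * K₀) := by
    refine (mul_le_mul_of_nonneg_left (hsum.trans (add_le_add_right (mul_le_mul_of_nonneg_left
      hbracket (mul_nonneg l.slope_pos.le hδ)) _)) (by positivity)).trans_eq ?_
    field_simp
  rw [risk_eq, risk_eq]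
  linarith

end

end SoftMin

section Transfer

variable {Ω : Type*} [MeasurableSpace Ω] {P : Measure Ω} [IsProbabilityMeasure P] {n p : ℕ}

/-- The designs whose rows are too large for the risk to be controlled by its values on a fine
net. -/
def largeDesign (n p : ℕ) : Set (Fin n → Fin p → ℝ) :=
  {A | (n : ℝ) ^ 3 < ∑ i, (∑ j, |A i j|) ^ 2}

/-- The noise vectors whose empirical third moment exceeds `K₀`; there are none of them if the loss
is Lipschitz, that is, if `l.growthFlag = 0`, and `K₀ ≥ 0`. -/
def largeNoise (l : RegressionLoss) (n : ℕ) (K₀ : ℝ) : Set (Fin n → ℝ) :=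
  {e | K₀ * n < l.growthFlag * ∑ i, |e i| ^ 3}

lemma measurableSet_largeNoise (l : RegressionLoss) (n : ℕ) (K₀ : ℝ) :
    MeasurableSet (largeNoise l n K₀) :=
  measurableSet_lt measurable_const (by fun_prop)

section

variable {A : Ω → Fin n → Fin p → ℝ} {q : ENNReal} {K : ℝ} (hA : Measurable A) (hq : 2 ≤ q)
  (hK : 0 ≤ K) (hAK : ∀ i j, eLpNorm (fun ω => A ω i j) q P ≤ ENNReal.ofReal K)
include hA hq hAK

lemma integrable_sum_abs_sq (i : Fin n) : Integrable (fun ω => (∑ j, |A ω i j|) ^ 2) P :=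
  (memLp_finsetSum _ fun j _ => ((memLp_entry hA hAK i j).mono_exponent hq).abs).integrable_sq

include hK

lemma integral_sum_abs_sq_le (i : Fin n) : ∫ ω, (∑ j, |A ω i j|) ^ 2 ∂P ≤ (p * K) ^ 2 := by
  have hvec := measurable_cellVec hA i Finset.univ
  have := Measure.isProbabilityMeasure_map (μ := P) hvec.aemeasurable
  have hnorm := eLpNorm_map_cellVec_le hA (one_le_two.trans hq) hAK zero_le_one i Finset.univ
  have h_int := integral_abs_pow_le (measurable_mul_sum_abs 1).aestronglyMeasurable (by positivity)
    hnorm two_ne_zero hq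
  rw [integral_map hvec.aemeasurable
    ((measurable_mul_sum_abs 1).abs.pow_const 2).aestronglyMeasurable] at h_int
  simpa only [sum_abs_cellVec, sq_abs, one_mul, Finset.card_univ, Fintype.card_fin] using h_int

lemma measureReal_largeDesign_le :
    P.real (A ⁻¹' largeDesign n p) ≤ n * (p * K) ^ 2 / (n : ℝ) ^ 3 := by
  rcases n.eq_zero_or_pos with rfl | hn
  · simp [largeDesign]
  have h_int : ∫ ω, ∑ i, (∑ j, |A ω i j|) ^ 2 ∂P ≤ n * (p * K) ^ 2 := by
    rw [integral_finsetSum _ fun i _ => integrable_sum_abs_sq hA hq hAK i]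
    exact (Finset.sum_le_card_nsmul _ _ _ fun i _ => integral_sum_abs_sq_le hA hq hK hAK i).trans
      (by simp)
  have hsum : Integrable (fun ω => ∑ i, (∑ j, |A ω i j|) ^ 2) P :=
    integrable_finsetSum _ fun i _ => integrable_sum_abs_sq hA hq hAK i
  have markov := mul_meas_ge_le_integral_of_nonneg
    (ae_of_all P fun ω => Finset.sum_nonneg fun i _ => sq_nonneg (∑ j, |A ω i j|)) hsum
    ((n : ℝ) ^ 3)
  rw [le_div_iff₀ (by positivity), mul_comm]
  refine (mul_le_mul_of_nonneg_left (measureReal_mono fun ω hω => ?_) (by positivity)).trans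
    (markov.trans h_int)
  exact (show (n : ℝ) ^ 3 < _ from hω).le

end

lemma measurable_levelTest {g : ℝ → ℝ} (hg : Continuous g) {s : Finset (Fin p → ℝ)}
    (hs : s.Nonempty) (θ : ℝ) (R : (Fin p → ℝ) → ℝ) (K m : ℝ) :
    Measurable fun z : (Fin n → Fin p → ℝ) × (Fin n → ℝ) => levelTest s g θ R K m z.2 z.1 :=
  (continuous_softTest hg θ _ hs _ _).measurable

lemma exists_risk_net (l : RegressionLoss) (hn : 1 ≤ n)
    {R : (Fin p → ℝ) → ℝ} {T : Set (Fin p → ℝ)} (hT : T.Nonempty) {L δ γ K₀ : ℝ} (hL : 0 ≤ L)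
    (hδ : 0 < δ) (hγ : 0 < γ) (hTL : T ⊆ Metric.closedBall 0 L) (hR : BddBelow (R '' T))
    (hmod : l.slope * δ * (3 + (3 + 2 * L) * n ^ 2 + 2 * K₀) ≤ γ / 2) :
    ∃ s : Finset (Fin p → ℝ), s.Nonempty ∧ ↑s ⊆ T ∧
      Real.log s.card ≤ p * Real.log (2 * (L / δ) + 2) ∧
      ∀ A ∉ largeDesign n p, ∀ e ∉ largeNoise l n K₀, ∀ w ∈ T, ∃ w' ∈ s,
        risk l R A e w' ≤ risk l R A e w + γ := by
  have hbox : ∀ w ∈ T, ∀ j, |w j| ≤ L := fun w hw =>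
    (pi_norm_le_iff_of_nonneg hL).1 (mem_closedBall_zero_iff.1 (hTL hw))
  obtain ⟨s, hs, hsT, hcard, hnet⟩ := exists_net hT hL hδ (half_pos hγ) hbox hR
  refine ⟨s, hs, hsT, ?_, fun A hA e he w hw => ?_⟩
  · rw [← Real.log_pow]
    exact Real.log_le_log (by exact_mod_cast hs.card_pos) hcard
  · obtain ⟨w', hw', hclose, hRw⟩ := hnet w hw
    refine ⟨w', hw', ?_⟩
    linarith [risk_le_of_close l hL hδ.le (hbox w hw) (hbox w' (hsT hw')) hclose hn R A e hRw
      (not_lt.1 hA) (not_lt.1 he)]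

section

variable (l : RegressionLoss) (R : (Fin p → ℝ) → ℝ) (hn : 1 ≤ n)
  {X G : Ω → Fin n → Fin p → ℝ} {ξ : Ω → Fin n → ℝ} (hX : Measurable X) (hG : Measurable G)
  (hξ : Measurable ξ) {g : ℝ → ℝ} (hgc : Continuous g) {σ γ K θ K₀ E : ℝ}
  (hg : ∀ t, |g t - l.fn t| ≤ σ) (hσ : σ ≤ γ / 2) (hγ : 0 ≤ γ) (hK : 0 ≤ K) (hθ : 0 < θ)
  {T : Set (Fin p → ℝ)} {s : Finset (Fin p → ℝ)} (hs : s.Nonempty) (hsT : ↑s ⊆ T)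
  (hcard : Real.log s.card ≤ θ * n * (γ / 2))
  (hnet : ∀ A ∉ largeDesign n p, ∀ e ∉ largeNoise l n K₀, ∀ w ∈ T, ∃ w' ∈ s,
    risk l R A e w' ≤ risk l R A e w + γ) {m : ℝ}
  (hE : |∫ ω, levelTest s g θ R K m (ξ ω) (X ω) ∂P -
    ∫ ω, levelTest s g θ R K m (ξ ω) (G ω) ∂P| ≤ E)
include hn hX hG hξ hgc hg hσ hγ hK hθ hs hsT hcard hnet hE

lemma measureReal_forall_le_risk_le :
    P.real {ω | ∀ w ∈ T, m + 2 * γ ≤ risk l R (X ω) (ξ ω) w} ≤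
      P.real {ω | ∀ w ∈ T, m - 3 * γ ≤ risk l R (G ω) (ξ ω) w} +
        (P.real (G ⁻¹' largeDesign n p) + P.real (ξ ⁻¹' largeNoise l n K₀)) + E +
        2 * Real.sigmoid (-(K * γ)) := by
  have hφ := measurable_levelTest (n := n) hgc hs θ R K m
  have hbound := measureReal_le_of_integral_le (P := P) (hφ.comp (hX.prodMk hξ))
    (hφ.comp (hG.prodMk hξ)) (fun _ => levelTest_mem_Icc ..) (fun _ => levelTest_mem_Icc ..)
    (Real.sigmoid_nonneg (-(K * γ))) (sub_le_iff_le_add'.1 (le_of_abs_le hE))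
    (S := {ω | ∀ w ∈ T, m + 2 * γ ≤ risk l R (X ω) (ξ ω) w})
    (T := {ω | ∀ w ∈ T, m - 3 * γ ≤ risk l R (G ω) (ξ ω) w}) (N := ∅)
    (N' := G ⁻¹' largeDesign n p ∪ ξ ⁻¹' largeNoise l n K₀)
    (fun ω hω _ => le_levelTest_of_le_risk l R hn (X ω) (ξ ω) hθ hg hσ hK hs hcard
      fun w hw => hω w (hsT hw))
    (fun ω hω hN w hw => by
      rw [Set.mem_union, not_or] at hN
      obtain ⟨w', hw', hle⟩ := hnet (G ω) hN.1 (ξ ω) hN.2 w hw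
      by_contra! hlt
      exact hω.not_ge
        (levelTest_le_of_risk_le l R hn (G ω) (ξ ω) hθ hg hσ hK hγ hw' (by linarith)))
  rw [measureReal_empty, zero_add] at hbound
  linarith [measureReal_union_le (μ := P) (G ⁻¹' largeDesign n p) (ξ ⁻¹' largeNoise l n K₀)]

lemma measureReal_exists_risk_le_le :
    P.real {ω | ∃ w ∈ T, risk l R (X ω) (ξ ω) w ≤ m - 3 * γ} ≤
      P.real {ω | ∃ w ∈ T, risk l R (G ω) (ξ ω) w ≤ m + 2 * γ} +
        (P.real (X ⁻¹' largeDesign n p) + P.real (ξ ⁻¹' largeNoise l n K₀)) + E +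
        2 * Real.sigmoid (-(K * γ)) := by
  have hφ := measurable_levelTest (n := n) hgc hs θ R K m
  have hφI : ∀ (A : Fin n → Fin p → ℝ) e, levelTest s g θ R K m e A ∈ Set.Icc (0 : ℝ) 1 :=
    fun A e => levelTest_mem_Icc ..
  have h_int : ∀ Y : Ω → Fin n → Fin p → ℝ, Measurable Y →
      ∫ ω, (1 - levelTest s g θ R K m (ξ ω) (Y ω)) ∂P =
        1 - ∫ ω, levelTest s g θ R K m (ξ ω) (Y ω) ∂P := fun Y hY => by
    have hYint : Integrable (fun ω => levelTest s g θ R K m (ξ ω) (Y ω)) P :=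
      integrable_of_mem_Icc (hφ.comp (hY.prodMk hξ)).aestronglyMeasurable fun _ => hφI _ _
    simp [integral_sub (integrable_const (1 : ℝ)) hYint]
  have hflip : ∫ ω, (1 - levelTest s g θ R K m (ξ ω) (X ω)) ∂P ≤
      ∫ ω, (1 - levelTest s g θ R K m (ξ ω) (G ω)) ∂P + E := by
    rw [h_int X hX, h_int G hG]
    linarith [neg_le_of_abs_le hE]
  have hbound := measureReal_le_of_integral_le (P := P) ((hφ.comp (hX.prodMk hξ)).const_sub 1)
    ((hφ.comp (hG.prodMk hξ)).const_sub 1)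
    (fun _ => Set.Icc.mem_iff_one_sub_mem.1 (hφI _ _))
    (fun _ => Set.Icc.mem_iff_one_sub_mem.1 (hφI _ _)) (Real.sigmoid_nonneg (-(K * γ))) hflip
    (S := {ω | ∃ w ∈ T, risk l R (X ω) (ξ ω) w ≤ m - 3 * γ})
    (T := {ω | ∃ w ∈ T, risk l R (G ω) (ξ ω) w ≤ m + 2 * γ})
    (N := X ⁻¹' largeDesign n p ∪ ξ ⁻¹' largeNoise l n K₀) (N' := ∅)
    (fun ω ⟨w, hw, hle⟩ hN => by
      rw [Set.mem_union, not_or] at hN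
      obtain ⟨w', hw', hle'⟩ := hnet (X ω) hN.1 (ξ ω) hN.2 w hw
      exact sub_le_sub_left
        (levelTest_le_of_risk_le l R hn (X ω) (ξ ω) hθ hg hσ hK hγ hw' (by linarith)) 1)
    (fun ω hω _ => by
      by_contra hne
      have hlt := fun w hw => lt_of_not_ge fun hle => hne ⟨w, hsT hw, hle⟩
      exact hω.not_ge (sub_le_comm.1 (le_levelTest_of_le_risk l R hn (G ω) (ξ ω) hθ hg hσ hK hs
        hcard fun w hw => (hlt w hw).le)))
  rw [measureReal_empty, add_zero] at hbound
  linarith [measureReal_union_le (μ := P) (X ⁻¹' largeDesign n p) (ξ ⁻¹' largeNoise l n K₀)]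

end

/-- One-sided comparison, with slack `r` and error `E`, of the minimal risks under the designs `X`
and `G` over arbitrary nonempty sets of coefficient vectors with entries bounded by `L`. The events
are phrased without infima, so that risks unbounded below need no special treatment. -/
structure RiskComparison (P : Measure Ω) (l : RegressionLoss) (R : (Fin p → ℝ) → ℝ)
    (X G : Ω → Fin n → Fin p → ℝ) (ξ : Ω → Fin n → ℝ) (L r E : ℝ) : Prop where
  forall_le : ∀ T : Set (Fin p → ℝ), T.Nonempty → T ⊆ Metric.closedBall 0 L → ∀ m : ℝ,
    P.real {ω | ∀ w ∈ T, m + r ≤ risk l R (X ω) (ξ ω) w} ≤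
      P.real {ω | ∀ w ∈ T, m ≤ risk l R (G ω) (ξ ω) w} + E
  exists_le : ∀ T : Set (Fin p → ℝ), T.Nonempty → T ⊆ Metric.closedBall 0 L → ∀ m : ℝ,
    P.real {ω | ∃ w ∈ T, risk l R (X ω) (ξ ω) w ≤ m} ≤
      P.real {ω | ∃ w ∈ T, risk l R (G ω) (ξ ω) w ≤ m + r} + E

theorem riskComparison_of_abs_integral_sub_le (l : RegressionLoss)
    (hn : 1 ≤ n) {R : (Fin p → ℝ) → ℝ} (hR : ∀ T, Bornology.IsBounded T → BddBelow (R '' T))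
    {X G : Ω → Fin n → Fin p → ℝ} {ξ : Ω → Fin n → ℝ} (hX : Measurable X) (hG : Measurable G)
    (hξ : Measurable ξ) (hXξ : IndepFun X ξ P) (hGξ : IndepFun G ξ P) {g : ℝ → ℝ}
    (hgc : Continuous g) {σ γ K θ L δ K₀ E₀ πA πe : ℝ} (hg : ∀ t, |g t - l.fn t| ≤ σ)
    (hσ : σ ≤ γ / 2) (hγ : 0 < γ) (hK : 0 ≤ K) (hθ : 0 < θ) (hL : 0 ≤ L) (hδ : 0 < δ)
    (hE₀ : 0 ≤ E₀) (hcard : p * Real.log (2 * (L / δ) + 2) ≤ θ * n * (γ / 2))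
    (hmod : l.slope * δ * (3 + (3 + 2 * L) * n ^ 2 + 2 * K₀) ≤ γ / 2)
    (hcomp : ∀ s : Finset (Fin p → ℝ), s.Nonempty → ↑s ⊆ Metric.closedBall (0 : Fin p → ℝ) L →
      ∀ m, ∀ e ∉ largeNoise l n K₀,
        |∫ ω, levelTest s g θ R K m e (X ω) ∂P - ∫ ω, levelTest s g θ R K m e (G ω) ∂P| ≤ E₀)
    (hbX : P.real (X ⁻¹' largeDesign n p) ≤ πA) (hbG : P.real (G ⁻¹' largeDesign n p) ≤ πA)
    (hbξ : P.real (ξ ⁻¹' largeNoise l n K₀) ≤ πe) :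
    RiskComparison P l R X G ξ L (5 * γ) (πA + 2 * πe + E₀ + 2 * Real.sigmoid (-(K * γ))) := by
  have hnoise : ∀ s : Finset (Fin p → ℝ), s.Nonempty → ↑s ⊆ Metric.closedBall (0 : Fin p → ℝ) L →
      ∀ m, |∫ ω, levelTest s g θ R K m (ξ ω) (X ω) ∂P -
        ∫ ω, levelTest s g θ R K m (ξ ω) (G ω) ∂P| ≤ E₀ + P.real (ξ ⁻¹' largeNoise l n K₀) :=
    fun s hs hsL m => abs_integral_comp_noise_sub_le hX hG hξ hXξ hGξ
      (measurable_levelTest hgc hs θ R K m) (fun _ => levelTest_mem_Icc ..)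
      (measurableSet_largeNoise l n K₀) hE₀ (hcomp s hs hsL m)
  constructor <;> intro T hT hTL m <;>
    obtain ⟨s, hs, hsT, hlog, hnet⟩ := exists_risk_net l hn hT hL hδ hγ hTL
      (hR T (Metric.isBounded_closedBall.subset hTL)) hmod
  · have := measureReal_forall_le_risk_le l R hn hX hG hξ hgc hg hσ hγ.le hK hθ hs hsT
      (hlog.trans hcard) hnet (hnoise s hs (hsT.trans hTL) (m + 3 * γ))
    rw [add_assoc m, add_sub_cancel_right, ← add_mul] at this
    norm_num1 at this
    linarith
  · have := measureReal_exists_risk_le_le l R hn hX hG hξ hgc hg hσ hγ.le hK hθ hs hsT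
      (hlog.trans hcard) hnet (hnoise s hs (hsT.trans hTL) (m + 3 * γ))
    rw [add_assoc m, add_sub_cancel_right, ← add_mul] at this
    norm_num1 at this
    linarith

end Transfer

section Estimator

variable {Ω : Type*} [MeasurableSpace Ω] {P : Measure Ω} [IsProbabilityMeasure P] {n p : ℕ}
  {l : RegressionLoss} {R : (Fin p → ℝ) → ℝ}

lemma le_minRisk_iff {A : Fin n → Fin p → ℝ} {e : Fin n → ℝ} {S : Set (Fin p → ℝ)} {a : ℝ} :
    (a : EReal) ≤ minRisk l R A e S ↔ ∀ w ∈ S, a ≤ risk l R A e w := by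
  simp [minRisk, le_iInf_iff]

lemma minRisk_le_of_mem {A : Fin n → Fin p → ℝ} {e : Fin n → ℝ} {S : Set (Fin p → ℝ)}
    {w : Fin p → ℝ} (hw : w ∈ S) : minRisk l R A e S ≤ (risk l R A e w : EReal) := iInf₂_le w hw

lemma measureReal_le_add_of_ae_subset_union {S T U : Set Ω} (h : ∀ᵐ ω ∂P, ω ∈ S → ω ∈ T ∪ U) :
    P.real S ≤ P.real T + P.real U :=
  (ENNReal.toReal_mono (measure_ne_top _ _) (measure_mono_ae h)).trans (measureReal_union_le _ _)

section

variable {A : Ω → Fin n → Fin p → ℝ} {ξ : Ω → Fin n → ℝ} {w : Ω → Fin p → ℝ}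
  (hw : ∀ᵐ ω ∂P, IsMinOn (risk l R (A ω) (ξ ω)) Set.univ (w ω))
include hw

lemma measureReal_minimizer_mem_le (S : Set (Fin p → ℝ)) {a b : ℝ} (hab : a ≤ b) :
    P.real {ω | w ω ∈ S} ≤ P.real {ω | (a : EReal) ≤ minRisk l R (A ω) (ξ ω) Set.univ} +
      P.real {ω | minRisk l R (A ω) (ξ ω) S ≤ (b : EReal)} := by
  refine measureReal_le_add_of_ae_subset_union ?_
  filter_upwards [hw] with ω hmin hS
  rcases le_total a (risk l R (A ω) (ξ ω) (w ω)) with h | h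
  · exact Or.inl (le_minRisk_iff.2 fun w' _ => h.trans (hmin (Set.mem_univ w')))
  · exact Or.inr ((minRisk_le_of_mem hS).trans (EReal.coe_le_coe_iff.2 (h.trans hab)))

lemma measureReal_forall_closedBall_le_risk_le (L a : ℝ) :
    P.real {ω | ∀ v ∈ Metric.closedBall 0 L, a ≤ risk l R (A ω) (ξ ω) v} ≤
      P.real {ω | (a : EReal) ≤ minRisk l R (A ω) (ξ ω) Set.univ} + P.real {ω | L < ‖w ω‖} := by
  refine measureReal_le_add_of_ae_subset_union ?_
  filter_upwards [hw] with ω hmin hball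
  refine or_iff_not_imp_right.2 fun h => le_minRisk_iff.2 fun v _ => ?_
  exact (hball _ (mem_closedBall_zero_iff.2 (not_lt.1 h))).trans (hmin (Set.mem_univ v))

lemma measureReal_minimizer_mem_le_of_norm_le (S : Set (Fin p → ℝ)) (L a : ℝ) :
    P.real {ω | w ω ∈ S} ≤ P.real {ω | L < ‖w ω‖} +
      (P.real {ω | ∃ v ∈ S ∩ Metric.closedBall 0 L, risk l R (A ω) (ξ ω) v ≤ a} +
        P.real {ω | ∀ v ∈ Metric.closedBall 0 L, a ≤ risk l R (A ω) (ξ ω) v}) := by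
  refine (measureReal_le_add_of_ae_subset_union ?_).trans
    (add_le_add_right (measureReal_union_le _ _) _)
  filter_upwards [hw] with ω hmin hS
  refine or_iff_not_imp_left.2 fun h => ?_
  rcases le_total (risk l R (A ω) (ξ ω) (w ω)) a with hle | hle
  · exact Or.inl ⟨w ω, ⟨hS, mem_closedBall_zero_iff.2 (not_lt.1 h)⟩, hle⟩
  · exact Or.inr fun v _ => hle.trans (hmin (Set.mem_univ v))

end

-- The level `z + 3 * r` in the proof separates the two levels at which the minimal risks under the
-- Gaussian design are controlled, and lies at distance `r` from each of them.
theorem RiskComparison.abs_measureReal_mem_sub_le {X G : Ω → Fin n → Fin p → ℝ}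
    {ξ : Ω → Fin n → ℝ} {L r E : ℝ} (hXG : RiskComparison P l R X G ξ L r E)
    {wX wG : Ω → Fin p → ℝ} (hwX : ∀ᵐ ω ∂P, IsMinOn (risk l R (X ω) (ξ ω)) Set.univ (wX ω))
    (hwG : ∀ᵐ ω ∂P, IsMinOn (risk l R (G ω) (ξ ω)) Set.univ (wG ω))
    {S : Set (Fin p → ℝ)} {ε z : ℝ} (hr : 0 ≤ r) (hL : 0 ≤ L) (hE : 0 ≤ E)
    (hXL : P.real {ω | L < ‖wX ω‖} ≤ ε) (hGL : P.real {ω | L < ‖wG ω‖} ≤ ε)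
    (hall : P.real {ω | ((z + 2 * r : ℝ) : EReal) ≤ minRisk l R (G ω) (ξ ω) Set.univ} ≤ ε)
    (hS : P.real {ω | minRisk l R (G ω) (ξ ω) S ≤ ((z + 4 * r : ℝ) : EReal)} ≤ ε) :
    |P.real {ω | wX ω ∈ S} - P.real {ω | wG ω ∈ S}| ≤ 4 * ε + 2 * E := by
  have hG := measureReal_minimizer_mem_le hwG S (show z + 2 * r ≤ z + 4 * r by linarith)
  have hX := measureReal_minimizer_mem_le_of_norm_le hwX S L (z + 3 * r)
  have hlow : P.real {ω | ∀ v ∈ Metric.closedBall 0 L, z + 3 * r ≤ risk l R (X ω) (ξ ω) v} ≤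
      2 * ε + E := by
    have := hXG.forall_le _ (Metric.nonempty_closedBall.2 hL) subset_rfl (z + 2 * r)
    rw [show z + 2 * r + r = z + 3 * r by ring] at this
    linarith [measureReal_forall_closedBall_le_risk_le hwG L (z + 2 * r)]
  have hε : 0 ≤ ε := measureReal_nonneg.trans hS
  have hSX : P.real {ω | ∃ v ∈ S ∩ Metric.closedBall 0 L,
      risk l R (X ω) (ξ ω) v ≤ z + 3 * r} ≤ ε + E := by
    rcases (S ∩ Metric.closedBall 0 L).eq_empty_or_nonempty with hempty | hne
    · simpa [hempty] using add_nonneg hε hE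
    have := hXG.exists_le _ hne Set.inter_subset_right (z + 3 * r)
    rw [show z + 3 * r + r = z + 4 * r by ring] at this
    refine this.trans (add_le_add_left ((measureReal_mono ?_).trans hS) E)
    rintro ω ⟨v, hv, hle⟩
    exact (minRisk_le_of_mem hv.1).trans (EReal.coe_le_coe_iff.2 hle)
  refine abs_le.2 ⟨?_, ?_⟩
  · linarith [measureReal_nonneg (μ := P) (s := {ω | wX ω ∈ S})]
  · linarith [measureReal_nonneg (μ := P) (s := {ω | wG ω ∈ S})]

end Estimator

lemma bddBelow_image_of_convexOn {p : ℕ} {R : (Fin p → ℝ) → ℝ} (hR : ConvexOn ℝ Set.univ R)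
    {T : Set (Fin p → ℝ)} (hT : Bornology.IsBounded T) : BddBelow (R '' T) := by
  have hcont : Continuous R := continuousOn_univ.1 (hR.continuousOn isOpen_univ)
  exact (hT.isCompact_closure.image hcont).bddBelow.mono (Set.image_mono subset_closure)

namespace RegressionLoss

/-- The exponent `q̄₀` as a natural number. -/
def growthExponent : RegressionLoss → ℕ
  | squared => 4
  | absolute => 0
  | huber _ _ => 0

lemma qBold_squared : qBold squared = 3 / 2 := by
  norm_num [qBold, qOne, qTwo, qThree]

lemma qBar_eq (l : RegressionLoss) : l.qBar = l.growthExponent := by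
  cases l with
  | squared =>
    have hceil : ⌈(3 / 2 : ℝ)⌉ = 2 := by rw [Int.ceil_eq_iff]; norm_num
    rw [qBar, qBold_squared]
    norm_num [qZero, growthExponent, hceil]
  | absolute => norm_num [qBar, qZero, qBold, qOne, qTwo, qThree, growthExponent]
  | huber η hη => norm_num [qBar, qZero, qBold, qOne, qTwo, qThree, growthExponent]

lemma four_le_ofReal_qStar (l : RegressionLoss) : 4 ≤ ENNReal.ofReal l.qStar := by
  rw [qStar, qBar_eq]
  cases l <;> norm_num [growthExponent]

lemma growthFlag_eq_zero_or (l : RegressionLoss) :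
    l.growthFlag = 0 ∨ l.growthFlag = 1 ∧ 6 ≤ ENNReal.ofReal l.qStar := by
  cases l with
  | squared =>
    refine Or.inr ⟨rfl, ?_⟩
    rw [qStar, qBar_eq]
    norm_num [growthExponent]
  | absolute => exact Or.inl rfl
  | huber η hη => exact Or.inl rfl

lemma growthFlag_mul_sum_le (l : RegressionLoss) {n : ℕ} {e b : Fin n → ℝ} (hb : ∀ i, 0 ≤ b i)
    (h : ∀ i, ∀ x : ℝ, |l.fn (x - e i)| / (1 + |x| ^ l.qZero) ≤ b i) :
    l.growthFlag * ∑ i, |e i| ^ 3 ≤ ∑ i, b i ^ l.qBold := by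
  have hnonneg : 0 ≤ ∑ i, b i ^ l.qBold := Finset.sum_nonneg fun i _ => Real.rpow_nonneg (hb i) _
  cases l with
  | squared =>
    rw [growthFlag, one_mul]
    refine Finset.sum_le_sum fun i _ => ?_
    have hsq : e i ^ 2 ≤ b i := by simpa [fn, qZero] using h i 0
    rw [qBold_squared]
    calc |e i| ^ 3 = (e i ^ 2) ^ (3 / 2 : ℝ) := by
          rw [← sq_abs, ← Real.rpow_natCast |e i| 2, ← Real.rpow_mul (abs_nonneg _)]
          norm_num
      _ ≤ b i ^ (3 / 2 : ℝ) := Real.rpow_le_rpow (sq_nonneg _) hsq (by norm_num)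
  | absolute => simpa [growthFlag] using hnonneg
  | huber η hη => simpa [growthFlag] using hnonneg

end RegressionLoss

section FixedDimension

variable {Ω : Type*} [MeasurableSpace Ω] {P : Measure Ω} {n p d : ℕ}

lemma eLpNorm_le_div_sqrt_of_eLpNorm_sqrt_mul_le (hn : 1 ≤ n) {f : Ω → ℝ} {q : ENNReal} {M : ℝ}
    (hf : eLpNorm (fun ω => √(n : ℝ) * f ω) q P ≤ ENNReal.ofReal M) :
    eLpNorm f q P ≤ ENNReal.ofReal (M / √(n : ℝ)) := by
  have hn₀ : 0 < √(n : ℝ) := Real.sqrt_pos.2 (by exact_mod_cast hn)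
  rw [ENNReal.ofReal_div_of_pos hn₀, ENNReal.le_div_iff_mul_le (by simp [hn₀]) (by simp), mul_comm,
    ← Real.enorm_of_nonneg hn₀.le, ← eLpNorm_const_smul]
  exact hf

lemma exists_isBlockDesign [IsProbabilityMeasure P] (hn : 1 ≤ n)
    {Sig : Matrix (Fin p) (Fin p) ℝ} (hS : Sig.PosSemidef) {X G : Ω → Fin n → Fin p → ℝ}
    (hX : IsIndepDesign P X Sig) (hG : IsGaussianDesign P G Sig)
    (hd : ∀ i, BlockDependent P (fun ω => X ω i) d) {q : ENNReal} {K : ℝ}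
    (hXK : ∀ i j, eLpNorm (fun ω => X ω i j) q P ≤ ENNReal.ofReal K)
    (hGK : ∀ i j, eLpNorm (fun ω => G ω i j) q P ≤ ENNReal.ofReal K) :
    ∃ (k : Fin n → ℕ) (B : ∀ i, Fin (k i) → Finset (Fin p)), (∀ i, IsCellPartition (B i) d) ∧
      IsBlockDesign P X Sig B q K ∧ IsBlockDesign P G Sig B q K := by
  choose k _ B hdisj hcov hcard hcells using hd
  refine ⟨k, B, fun i => ⟨hdisj i, hcov i, hcard i⟩, ⟨hX, hcells, hXK⟩,
    ⟨hG.isIndepDesign hS, fun i => ?_, hGK⟩⟩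
  exact hG.iIndepFun_blocks hS i fun a b hab j hj m hm => hX.cov_eq_zero hn i (hcells i) hab hj hm

lemma sum_add_mul_pow_le_of_notMem_largeNoise {l : RegressionLoss}
    (hl : l.growthFlag = 0 ∨ l.growthFlag = 1) {K₀ : ℝ} {e : Fin n → ℝ}
    (he : e ∉ largeNoise l n K₀) (b : ℝ) :
    ∑ i, (5 + 16 * l.growthFlag * (b + |e i| ^ 3)) ≤ n * (5 + 16 * l.growthFlag * (b + K₀)) := by
  have he' : l.growthFlag * ∑ i, |e i| ^ 3 ≤ K₀ * n := not_lt.1 he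
  rw [Finset.sum_add_distrib, ← Finset.mul_sum, Finset.sum_add_distrib, Finset.sum_const,
    Finset.sum_const, Finset.card_univ, Fintype.card_fin, nsmul_eq_mul, nsmul_eq_mul]
  rcases hl with h | h <;> rw [h] at he' ⊢ <;> linarith

lemma moment_factor_le (l : RegressionLoss) {n p d L M M' c K₀ : ℝ} (hn : 0 < n) (hp : 0 ≤ p)
    (hpn : p / n ≤ c) (hdn : d ^ 3 ≤ n) (hL : 1 ≤ L) (hM : 0 ≤ M) (hK₀ : 0 ≤ K₀) :
    5 + 16 * l.growthFlag * (1 + 3 * (M * (p * L ^ 2) / n) ^ 2 +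
        (L * (M' / √n)) ^ 4 * (d ^ 3 * p) + K₀) ≤
      (5 + 16 * (1 + 3 * (M * c) ^ 2 + M' ^ 4 * c + K₀)) * L ^ l.growthExponent := by
  have hpn₀ : 0 ≤ p / n := by positivity
  have hc : 0 ≤ c := hpn₀.trans hpn
  have hL4 : 1 ≤ L ^ 4 := one_le_pow₀ hL
  have hcov : (M * (p * L ^ 2) / n) ^ 2 ≤ (M * c) ^ 2 * L ^ 4 := by
    calc (M * (p * L ^ 2) / n) ^ 2 = (M * (p / n)) ^ 2 * L ^ 4 := by ring
      _ ≤ (M * c) ^ 2 * L ^ 4 := by gcongr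
  have hcell : (L * (M' / √n)) ^ 4 * (d ^ 3 * p) ≤ M' ^ 4 * c * L ^ 4 := by
    have hsq : √n ^ 4 = n ^ 2 := by rw [show 4 = 2 * 2 from rfl, pow_mul, Real.sq_sqrt hn.le]
    calc (L * (M' / √n)) ^ 4 * (d ^ 3 * p) = M' ^ 4 * (d ^ 3 / n * (p / n)) * L ^ 4 := by
          rw [mul_pow, div_pow, hsq]
          field_simp
      _ ≤ M' ^ 4 * (1 * c) * L ^ 4 := by
          have := (div_le_one hn).2 hdn
          gcongr
      _ = M' ^ 4 * c * L ^ 4 := by rw [one_mul]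
  set b := 1 + 3 * (M * c) ^ 2 + M' ^ 4 * c + K₀
  have hb : 0 ≤ b := by positivity
  have hsum : 1 + 3 * (M * (p * L ^ 2) / n) ^ 2 + (L * (M' / √n)) ^ 4 * (d ^ 3 * p) + K₀ ≤
      b * L ^ 4 := by
    linarith [mul_le_mul_of_nonneg_left hL4 hK₀]
  cases l with
  | squared =>
    simp only [RegressionLoss.growthFlag, RegressionLoss.growthExponent]
    linarith
  | absolute => simp [RegressionLoss.growthFlag, RegressionLoss.growthExponent, hb]
  | huber η hη => simp [RegressionLoss.growthFlag, RegressionLoss.growthExponent, hb]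

lemma abs_integral_levelTest_sub_le [IsProbabilityMeasure P] (l : RegressionLoss) (hn : 1 ≤ n)
    {k : Fin n → ℕ} {B : ∀ i, Fin (k i) → Finset (Fin p)} (hB : ∀ i, IsCellPartition (B i) d)
    {Sig : Matrix (Fin p) (Fin p) ℝ} (hS : Sig.PosSemidef) {X G : Ω → Fin n → Fin p → ℝ}
    {q : ENNReal} {M M' : ℝ} (hX : IsBlockDesign P X Sig B q (M' / √(n : ℝ)))
    (hG : IsBlockDesign P G Sig B q (M' / √(n : ℝ))) (hq : 4 ≤ q)
    (hl : l.growthFlag = 0 ∨ l.growthFlag = 1 ∧ 6 ≤ q) (hSM : lambdaMax Sig ≤ M) (hM : 0 ≤ M)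
    (hM' : 0 ≤ M') {g g₁ g₂ g₃ V : ℝ → ℝ} {C : ℝ} (hg : IsTame g g₁ g₂ g₃ V l.growthFlag C)
    {L c θ K K₀ : ℝ} (hpc : (p : ℝ) / n ≤ c) (hdn : (d : ℝ) ^ 3 ≤ n) (hL : 1 ≤ L)
    (hr : L * (d * (M' / √(n : ℝ))) ≤ 1) (hθ : 1 ≤ θ) (hK : 0 ≤ K) (hKθ : K ≤ θ * n)
    (hK₀ : 0 ≤ K₀) {s : Finset (Fin p → ℝ)} (hs : s.Nonempty)
    (hsL : ↑s ⊆ Metric.closedBall (0 : Fin p → ℝ) L) (R : (Fin p → ℝ) → ℝ) (m : ℝ) {e : Fin n → ℝ}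
    (he : e ∉ largeNoise l n K₀) :
    |∫ ω, levelTest s g θ R K m e (X ω) ∂P - ∫ ω, levelTest s g θ R K m e (G ω) ∂P| ≤
      46 * K * C ^ 4 * M' ^ 3 * c * (5 + 16 * (1 + 3 * (M * c) ^ 2 + M' ^ 4 * c + K₀)) *
        (θ ^ 2 * (d ^ 2 * L ^ (l.growthExponent + 3)) / √(n : ℝ)) := by
  have hn₀ : (0 : ℝ) < n := by exact_mod_cast hn
  have hL₀ : 0 < L := one_pos.trans_le hL
  have hC : 0 < C := one_pos.trans_le hg.one_le
  have ht : |(-(K / (θ * n)))| = K / (θ * n) := by rw [abs_neg, abs_of_nonneg (by positivity)]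
  have hbox : ∀ w ∈ s, ∀ j, |w j| ≤ L := fun w hw =>
    (pi_norm_le_iff_of_nonneg hL₀.le).1 (mem_closedBall_zero_iff.1 (hsL hw))
  have hlind := abs_integral_softTest_design_sub_le hX hG hB hS hSM hM hq (by positivity) hg hl hs
    hL₀.le hbox hr (-(K * m)) hθ (ht.trans_le ((div_le_one (by positivity)).2 hKθ))
    (fun w => θ * n * R w) e
  rw [ht] at hlind
  refine hlind.trans ?_
  have hnoise := sum_add_mul_pow_le_of_notMem_largeNoise (hl.imp_right And.left) he
    (1 + 3 * (M * (p * L ^ 2) / n) ^ 2 + (L * (M' / √(n : ℝ))) ^ 4 * (d ^ 3 * p))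
  have hfactor := moment_factor_le l (M' := M') hn₀ p.cast_nonneg hpc hdn hL hM hK₀
  set b := 5 + 16 * (1 + 3 * (M * c) ^ 2 + M' ^ 4 * c + K₀)
  have hb : 0 ≤ b * L ^ l.growthExponent := le_trans (by positivity [l.growthFlag_nonneg]) hfactor
  set u := √(n : ℝ)
  have hun : (n : ℝ) = u ^ 2 := (Real.sq_sqrt hn₀.le).symm
  have hu : 0 < u := Real.sqrt_pos.2 hn₀
  calc _ ≤ 46 * (K / (θ * n)) * (θ * C) ^ 3 * C * ((L * (M' / u)) ^ 3 * (d ^ 2 * p)) *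
        (n * (b * L ^ l.growthExponent)) := by
        gcongr
        exact hnoise.trans (by gcongr)
    _ = 46 * K * C ^ 4 * M' ^ 3 * (p / n) * (b * L ^ l.growthExponent) *
        (θ ^ 2 * (d ^ 2 * L ^ 3) / u) := by
        rw [hun]
        field_simp
    _ ≤ 46 * K * C ^ 4 * M' ^ 3 * c * (b * L ^ l.growthExponent) *
        (θ ^ 2 * (d ^ 2 * L ^ 3) / u) := by gcongr
    _ = _ := by ring

theorem riskComparison_of_blockDependent [IsProbabilityMeasure P] (l : RegressionLoss)
    (hn : 1 ≤ n) {Sig : Matrix (Fin p) (Fin p) ℝ} (hS : Sig.PosSemidef)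
    {X G : Ω → Fin n → Fin p → ℝ} (hX : IsIndepDesign P X Sig) (hG : IsGaussianDesign P G Sig)
    (hd : ∀ i, BlockDependent P (fun ω => X ω i) d) {q : ENNReal} {M M' : ℝ} (hq : 4 ≤ q)
    (hqt : q ≠ ⊤) (hl : l.growthFlag = 0 ∨ l.growthFlag = 1 ∧ 6 ≤ q) (hSM : lambdaMax Sig ≤ M)
    (hM : 0 ≤ M)
    (hXM : ∀ i j, eLpNorm (fun ω => √(n : ℝ) * X ω i j) q P ≤ ENNReal.ofReal M')
    (hGM : √M * gaussianNorm q ≤ M') {ξ : Ω → Fin n → ℝ} (hξ : Measurable ξ)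
    (hXξ : IndepFun X ξ P) (hGξ : IndepFun G ξ P) {R : (Fin p → ℝ) → ℝ}
    (hR : ∀ T, Bornology.IsBounded T → BddBelow (R '' T)) {g g₁ g₂ g₃ V : ℝ → ℝ} {C : ℝ}
    (hg : IsTame g g₁ g₂ g₃ V l.growthFlag C) {σ γ L c θ K K₀ δ πe : ℝ}
    (hgl : ∀ t, |g t - l.fn t| ≤ σ) (hσ : σ ≤ γ / 2) (hγ : 0 < γ) (hpc : (p : ℝ) / n ≤ c)
    (hdn : (d : ℝ) ^ 3 ≤ n) (hL : 1 ≤ L) (hr : L * (d * (M' / √(n : ℝ))) ≤ 1) (hθ : 1 ≤ θ)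
    (hK : 0 ≤ K) (hKθ : K ≤ θ * n) (hK₀ : 0 ≤ K₀) (hδ : 0 < δ)
    (hcard : p * Real.log (2 * (L / δ) + 2) ≤ θ * n * (γ / 2))
    (hmod : l.slope * δ * (3 + (3 + 2 * L) * n ^ 2 + 2 * K₀) ≤ γ / 2)
    (hπe : P.real (ξ ⁻¹' largeNoise l n K₀) ≤ πe) :
    RiskComparison P l R X G ξ L (5 * γ) (n * (p * (M' / √(n : ℝ))) ^ 2 / (n : ℝ) ^ 3 + 2 * πe +
      46 * K * C ^ 4 * M' ^ 3 * c * (5 + 16 * (1 + 3 * (M * c) ^ 2 + M' ^ 4 * c + K₀)) *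
        (θ ^ 2 * (d ^ 2 * L ^ (l.growthExponent + 3)) / √(n : ℝ)) +
      2 * Real.sigmoid (-(K * γ))) := by
  have hL₀ : 0 ≤ L := zero_le_one.trans hL
  have hc : 0 ≤ c := le_trans (by positivity) hpc
  have hM' : 0 ≤ M' := (mul_nonneg (Real.sqrt_nonneg M) (gaussianNorm_nonneg q)).trans hGM
  obtain ⟨k, B, hB, hXB, hGB⟩ := exists_isBlockDesign hn hS hX hG hd
    (fun i j => eLpNorm_le_div_sqrt_of_eLpNorm_sqrt_mul_le hn (hXM i j))
    (fun i j => eLpNorm_le_div_sqrt_of_eLpNorm_sqrt_mul_le hn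
      ((hG.eLpNorm_le hS hn hSM i j hqt).trans (ENNReal.ofReal_le_ofReal hGM)))
  have hq₂ : 2 ≤ q := le_trans (by norm_num) hq
  refine riskComparison_of_abs_integral_sub_le l hn hR hX.measurable hG.measurable hξ hXξ hGξ
    hg.continuous hgl hσ hγ hK (one_pos.trans_le hθ) hL₀ hδ (by positivity) hcard hmod
    (fun s hs hsL m e he => abs_integral_levelTest_sub_le l hn hB hS hXB hGB hq hl hSM hM hM' hg
      hpc hdn hL hr hθ hK hKθ hK₀ hs hsL R m he)
    (measureReal_largeDesign_le hX.measurable hq₂ (by positivity) hXB.eLpNorm_le)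
    (measureReal_largeDesign_le hG.measurable hq₂ (by positivity) hGB.eLpNorm_le) hπe

end FixedDimension

section Asymptotics

/-- The rate of the comparison, where `r` stands for `q̄₀`: the error caused by replacing the design
is at most a constant multiple of it. -/
def comparisonRate (r n d : ℕ) (L : ℝ) : ℝ :=
  Real.log n ^ 2 * (d ^ 2 * L ^ (r + 3)) / √(n : ℝ)

lemma sq_mul_pow_growth_le {r : ℕ} {α κ n t : ℝ} (hκ : 0 ≤ κ) (hn : 0 < n) (ht : 1 ≤ t) :
    (n ^ (1 / 4 - (r + 3) * α / 2) / t ^ (6 + (2 * r + 6) * κ)) ^ 2 *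
      (n ^ α * t ^ κ) ^ (r + 3) ≤ √n / t ^ 2 := by
  have ht₀ : 0 < t := one_pos.trans_le ht
  have hexp : (n ^ (1 / 4 - (r + 3) * α / 2) / t ^ (6 + (2 * r + 6) * κ)) ^ 2 *
      (n ^ α * t ^ κ) ^ (r + 3) = √n * t ^ (-12 - (3 * r + 9) * κ) := by
    simp only [← Real.rpow_natCast, Real.sqrt_eq_rpow]
    rw [Real.div_rpow (by positivity) (by positivity),
      Real.mul_rpow (by positivity) (by positivity), ← Real.rpow_mul hn.le, ← Real.rpow_mul hn.le,
      ← Real.rpow_mul ht₀.le, ← Real.rpow_mul ht₀.le, div_eq_mul_inv, ← Real.rpow_neg ht₀.le,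
      mul_mul_mul_comm, ← Real.rpow_add hn, ← Real.rpow_add ht₀]
    congr 2 <;> push_cast <;> ring
  have hlog : t ^ (-12 - (3 * r + 9) * κ) ≤ (t ^ 2)⁻¹ := by
    rw [← Real.rpow_natCast, ← Real.rpow_neg ht₀.le]
    refine Real.rpow_le_rpow_of_exponent_le ht ?_
    have : 0 ≤ (3 * (r : ℝ) + 9) * κ := by positivity
    push_cast
    linarith
  rw [hexp, div_eq_mul_inv]
  gcongr

lemma tendsto_log_natCast_atTop : Tendsto (fun n : ℕ => Real.log n) atTop atTop :=
  Real.tendsto_log_atTop.comp tendsto_natCast_atTop_atTop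

lemma tendsto_comparisonRate {r : ℕ} {L : ℕ → ℝ} {d : ℕ → ℕ} {α κ : ℝ} (hκ : 0 ≤ κ)
    (hL : L =O[atTop] fun n => (n : ℝ) ^ α * Real.log n ^ κ)
    (hd : (fun n => (d n : ℝ)) =o[atTop] fun n =>
      (n : ℝ) ^ (1 / 4 - (r + 3) * α / 2) / Real.log n ^ (6 + (2 * r + 6) * κ)) :
    Tendsto (fun n => comparisonRate r n (d n) (L n)) atTop (𝓝 0) := by
  have hsmall : (fun n : ℕ => (d n : ℝ) ^ 2 * L n ^ (r + 3)) =o[atTop]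
      fun n : ℕ => √(n : ℝ) / Real.log n ^ 2 := by
    refine ((hd.pow two_pos).mul_isBigO (hL.pow (r + 3))).trans_isBigO (IsBigO.of_bound 1 ?_)
    filter_upwards [tendsto_log_natCast_atTop.eventually_ge_atTop 1, eventually_gt_atTop 0]
      with n hlog hn
    rw [one_mul, Real.norm_of_nonneg (by positivity), Real.norm_of_nonneg (by positivity)]
    exact sq_mul_pow_growth_le hκ (by exact_mod_cast hn) hlog
  refine hsmall.tendsto_div_nhds_zero.congr fun n => ?_
  rw [comparisonRate, div_div_eq_mul_div, mul_comm (_ * _)]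

lemma tendsto_const_mul_comparisonRate {r : ℕ} {L : ℕ → ℝ} {d : ℕ → ℕ} (b Θ : ℝ)
    (h : Tendsto (fun n => comparisonRate r n (d n) (L n)) atTop (𝓝 0)) :
    Tendsto (fun n : ℕ => b * ((Θ * Real.log n) ^ 2 * (d n ^ 2 * L n ^ (r + 3)) / √(n : ℝ))) atTop
      (𝓝 0) := by
  have := h.const_mul (b * Θ ^ 2)
  rw [mul_zero] at this
  exact this.congr fun n => by rw [comparisonRate]; ring

lemma sq_mul_cube_div_sqrt_le_comparisonRate (r : ℕ) {n d : ℕ} {L : ℝ} (ht : 1 ≤ Real.log n)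
    (hL : 1 ≤ L) : d ^ 2 * L ^ 3 / √(n : ℝ) ≤ comparisonRate r n d L := by
  have hpow : L ^ 3 ≤ L ^ (r + 3) := pow_le_pow_right₀ hL (by lia)
  refine div_le_div_of_nonneg_right ?_ (Real.sqrt_nonneg _)
  calc (d : ℝ) ^ 2 * L ^ 3 ≤ 1 * (d ^ 2 * L ^ (r + 3)) := by rw [one_mul]; gcongr
    _ ≤ _ := by gcongr; exact one_le_pow₀ ht

lemma le_of_sq_mul_cube_le_sqrt {n d L : ℝ} (hn : 1 ≤ n) (hd : 1 ≤ d) (hL : 1 ≤ L)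
    (h : d ^ 2 * L ^ 3 ≤ √n) : L ≤ n :=
  calc L ≤ L ^ 3 := le_self_pow₀ hL three_ne_zero
    _ ≤ d ^ 2 * L ^ 3 := le_mul_of_one_le_left (by positivity) (one_le_pow₀ hd)
    _ ≤ √n := h
    _ ≤ n := Real.sqrt_le_self_iff.2 (.inr hn)

lemma cube_le_of_sq_mul_cube_le_sqrt {n d L : ℝ} (hn : 0 ≤ n) (hd : 1 ≤ d) (hL : 1 ≤ L)
    (h : d ^ 2 * L ^ 3 ≤ √n) : d ^ 3 ≤ n :=
  calc d ^ 3 ≤ d ^ 4 := pow_le_pow_right₀ hd (by norm_num)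
    _ = (d ^ 2) ^ 2 := by ring
    _ ≤ √n ^ 2 := by
      have := (le_mul_of_one_le_right (sq_nonneg d) (one_le_pow₀ hL)).trans h
      gcongr
    _ = n := Real.sq_sqrt hn

lemma mul_mul_div_sqrt_le_one {n d L K : ℝ} (hd : 1 ≤ d) (hL : 1 ≤ L) (hK : 0 ≤ K)
    (h : d ^ 2 * L ^ 3 / √n ≤ 1 / (K + 1)) : L * (d * (K / √n)) ≤ 1 := by
  have hdd : d ≤ d ^ 2 := le_self_pow₀ hd two_ne_zero
  have hLL : L ≤ L ^ 3 := le_self_pow₀ hL three_ne_zero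
  calc L * (d * (K / √n)) = d * L / √n * K := by ring
    _ ≤ d ^ 2 * L ^ 3 / √n * K := by gcongr
    _ ≤ 1 / (K + 1) * K := by gcongr
    _ ≤ 1 := by
      rw [one_div_mul_eq_div, div_le_one (by positivity)]
      linarith

lemma eventually_size_bounds {r : ℕ} {L : ℕ → ℝ} {d : ℕ → ℕ} {K : ℝ} (hL : ∀ n, 1 ≤ n → 1 ≤ L n)
    (hK : 0 ≤ K) (h : Tendsto (fun n => comparisonRate r n (d n) (L n)) atTop (𝓝 0)) :
    ∀ᶠ n : ℕ in atTop, 1 ≤ d n →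
      L n ≤ n ∧ (d n : ℝ) ^ 3 ≤ n ∧ L n * (d n * (K / √(n : ℝ))) ≤ 1 := by
  filter_upwards [tendsto_log_natCast_atTop.eventually_ge_atTop 1, eventually_ge_atTop 1,
    h.eventually_le_const one_pos,
    h.eventually_le_const (show 0 < 1 / (K + 1) by positivity)] with n hlog hn hone hK' hd
  have hrate := sq_mul_cube_div_sqrt_le_comparisonRate r (d := d n) hlog (hL n hn)
  have hn' : (1 : ℝ) ≤ n := by exact_mod_cast hn
  have hd' : (1 : ℝ) ≤ d n := by exact_mod_cast hd
  have hsqrt : (d n : ℝ) ^ 2 * L n ^ 3 ≤ √(n : ℝ) :=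
    (div_le_one (by positivity)).1 (hrate.trans hone)
  exact ⟨le_of_sq_mul_cube_le_sqrt hn' hd' (hL n hn) hsqrt,
    cube_le_of_sq_mul_cube_le_sqrt n.cast_nonneg hd' (hL n hn) hsqrt,
    mul_mul_div_sqrt_le_one hd' (hL n hn) hK (hrate.trans hK')⟩

lemma mul_log_net_card_le {n p L c : ℝ} (hn : 2 ≤ n) (hp₀ : 0 ≤ p) (hp : p ≤ c * n)
    (hL₀ : 0 ≤ L) (hL : L ≤ n) :
    p * Real.log (2 * (L / (1 / n ^ 4)) + 2) ≤ 7 * c * Real.log n * n := by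
  have hcard : 2 * (L / (1 / n ^ 4)) + 2 ≤ n ^ 7 :=
    calc 2 * (L / (1 / n ^ 4)) + 2 = 2 * (L * n ^ 4) + 2 * 1 := by
          rw [div_div_eq_mul_div, div_one, mul_one]
      _ ≤ 2 * (n * n ^ 4) + 2 * n ^ 5 := by
          gcongr
          exact one_le_pow₀ (by linarith)
      _ = 2 ^ 2 * n ^ 5 := by ring
      _ ≤ n ^ 2 * n ^ 5 := by gcongr
      _ = n ^ 7 := by ring
  have hlog : Real.log (2 * (L / (1 / n ^ 4)) + 2) ≤ 7 * Real.log n := by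
    have := Real.log_le_log (by positivity) hcard
    rwa [Real.log_pow] at this
  have hlog₀ : 0 ≤ Real.log (2 * (L / (1 / n ^ 4)) + 2) :=
    Real.log_nonneg (by linarith [show 0 ≤ L / (1 / n ^ 4) by positivity])
  have hcn : 0 ≤ c * n := hp₀.trans hp
  calc p * Real.log (2 * (L / (1 / n ^ 4)) + 2) ≤ c * n * (7 * Real.log n) := by gcongr
    _ = 7 * c * Real.log n * n := by ring

lemma eventually_net_error_le (l : RegressionLoss) {K₀ γ : ℝ} (hK₀ : 0 ≤ K₀) (hγ : 0 < γ) :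
    ∀ᶠ n : ℕ in atTop, ∀ L : ℝ, L ≤ n →
      l.slope * (1 / (n : ℝ) ^ 4) * (3 + (3 + 2 * L) * n ^ 2 + 2 * K₀) ≤ γ := by
  have hslope := l.slope_pos
  filter_upwards [eventually_ge_atTop 1,
    tendsto_natCast_atTop_atTop.eventually_ge_atTop (l.slope * (8 + 2 * K₀) / γ)] with n hn hnγ L hL
  have hn' : (1 : ℝ) ≤ n := by exact_mod_cast hn
  have hcube : (1 : ℝ) ≤ n ^ 3 := one_le_pow₀ hn'
  calc l.slope * (1 / (n : ℝ) ^ 4) * (3 + (3 + 2 * L) * n ^ 2 + 2 * K₀)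
      ≤ l.slope * (1 / (n : ℝ) ^ 4) *
          (3 * n ^ 3 + (3 * n + 2 * n) * n ^ 2 + 2 * (K₀ * n ^ 3)) := by
        gcongr <;> nlinarith
    _ = l.slope * (8 + 2 * K₀) / n := by field_simp; ring
    _ ≤ γ := by rwa [div_le_comm₀ (by positivity) hγ]

lemma eventually_largeDesign_error_le (c K : ℝ) {η : ℝ} (hη : 0 < η) :
    ∀ᶠ n : ℕ in atTop, ∀ p : ℝ, 0 ≤ p → p ≤ c * n →
      n * (p * (K / √(n : ℝ))) ^ 2 / (n : ℝ) ^ 3 ≤ η := by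
  filter_upwards [eventually_gt_atTop 0,
    tendsto_natCast_atTop_atTop.eventually_ge_atTop ((c * K) ^ 2 / η)] with n hn hnη p hp₀ hp
  have hn' : (0 : ℝ) < n := by exact_mod_cast hn
  calc n * (p * (K / √(n : ℝ))) ^ 2 / (n : ℝ) ^ 3
      = p ^ 2 * K ^ 2 / (n : ℝ) ^ 3 := by
        rw [mul_pow, div_pow, Real.sq_sqrt hn'.le]
        field_simp
    _ ≤ (c * n) ^ 2 * K ^ 2 / (n : ℝ) ^ 3 := by gcongr
    _ = (c * K) ^ 2 / n := by field_simp
    _ ≤ η := by rwa [div_le_comm₀ hn' hη]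

lemma exists_sigmoid_neg_mul_le {γ η : ℝ} (hγ : 0 < γ) (hη : 0 < η) :
    ∃ K, 0 ≤ K ∧ Real.sigmoid (-(K * γ)) ≤ η := by
  have h : Tendsto (fun K : ℝ => Real.sigmoid (-(K * γ))) atTop (𝓝 0) :=
    Real.tendsto_sigmoid_atBot.comp
      (tendsto_neg_atTop_atBot.comp (tendsto_id.atTop_mul_const hγ))
  exact ((eventually_ge_atTop 0).and (h.eventually_le_const hη)).exists

lemma exists_tendsto_zero_of_eventually_le_add {a b : ℕ → ℝ}
    (h : ∀ η : ℝ, 0 < η → ∀ᶠ n in atTop, a n ≤ b n + η) :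
    ∃ r : ℕ → ℝ, Tendsto r atTop (𝓝 0) ∧ ∀ n, a n ≤ b n + r n := by
  refine ⟨fun n => max 0 (a n - b n), ?_, fun n => ?_⟩
  · refine tendsto_order.2 ⟨fun x hx => .of_forall fun n => hx.trans_le (le_max_left _ _),
      fun x hx => ?_⟩
    filter_upwards [h (x / 2) (half_pos hx)] with n hn
    exact max_lt hx (by linarith)
  · linarith [le_max_right 0 (a n - b n)]

lemma isBigO_natCast_of_div_le {p : ℕ → ℕ} {c : ℝ} (h : ∀ n : ℕ, 1 ≤ n → (p n : ℝ) / n ≤ c) :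
    (fun n => (p n : ℝ)) =O[atTop] fun n => (n : ℝ) := by
  refine IsBigO.of_bound c (eventually_atTop.2 ⟨1, fun n hn => ?_⟩)
  rw [Real.norm_of_nonneg (p n).cast_nonneg, Real.norm_of_nonneg n.cast_nonneg]
  exact (div_le_iff₀ (by exact_mod_cast hn)).1 (h n hn)

end Asymptotics

lemma BlockDependent.one_le {Ω : Type*} [MeasurableSpace Ω] {P : Measure Ω} {p : ℕ}
    {Z : Ω → Fin p → ℝ} {d : ℕ} (h : BlockDependent P Z d) (hp : 0 < p) : 1 ≤ d := by
  obtain ⟨k, -, B, -, hcov, hcard, -⟩ := h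
  obtain ⟨a, ha⟩ := hcov ⟨0, hp⟩
  exact (Finset.card_pos.2 ⟨_, ha⟩).trans_le (hcard a)

namespace RiskComparison

variable {Ω : Type*} [MeasurableSpace Ω] {P : Measure Ω} [IsProbabilityMeasure P] {n p : ℕ}
  {l : RegressionLoss} {R : (Fin p → ℝ) → ℝ} {ξ : Ω → Fin n → ℝ} {L r E : ℝ}

omit [IsProbabilityMeasure P] in
lemma mono {X G : Ω → Fin n → Fin p → ℝ} {E' : ℝ} (h : RiskComparison P l R X G ξ L r E)
    (hE : E ≤ E') : RiskComparison P l R X G ξ L r E' where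
  forall_le T hT hTL m := (h.forall_le T hT hTL m).trans (by gcongr)
  exists_le T hT hTL m := (h.exists_le T hT hTL m).trans (by gcongr)

lemma of_dim_eq_zero (X G : Ω → Fin n → Fin p → ℝ) (hp : p = 0) (hr : 0 ≤ r) (hE : 0 ≤ E) :
    RiskComparison P l R X G ξ L r E := by
  subst hp
  rw [Subsingleton.elim X G]
  constructor <;> intro T _ _ m <;> refine le_add_of_le_of_nonneg (measureReal_mono ?_) hE
  · exact fun ω hω w hw => (le_add_of_nonneg_right hr).trans (hω w hw)
  · exact fun ω ⟨w, hw, hle⟩ => ⟨w, hw, hle.trans (le_add_of_nonneg_right hr)⟩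

end RiskComparison

section Sequences

variable {Ω : ℕ → Type*} [∀ n, MeasurableSpace (Ω n)] {P : ∀ n, Measure (Ω n)}

lemma BoundedInProbability.mono [∀ n, IsFiniteMeasure (P n)] {A B : ∀ n, Ω n → ℝ}
    (hB : BoundedInProbability P B) (h : ∀ᶠ n in atTop, ∀ ω, |A n ω| ≤ |B n ω|) :
    BoundedInProbability P A := fun η hη => by
  obtain ⟨K, hK⟩ := hB η hη
  refine ⟨K, ?_⟩
  filter_upwards [hK, h] with n hKn hn
  exact (measureReal_mono fun ω hω => lt_of_lt_of_le hω (hn ω)).trans hKn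

lemma boundedInProbability_noise [∀ n, IsFiniteMeasure (P n)] (l : RegressionLoss)
    {ξ b : ∀ n, Ω n → Fin n → ℝ} (hb : ∀ n, 1 ≤ n → ∀ ω i, 1 ≤ b n ω i)
    (h : ∀ n, 1 ≤ n → ∀ ω i, ∀ x : ℝ, |l.fn (x - ξ n ω i)| / (1 + |x| ^ l.qZero) ≤ b n ω i)
    (hAv : BoundedInProbability P fun n ω => (1 / (n : ℝ)) * ∑ i, b n ω i ^ l.qBold) :
    BoundedInProbability P fun n ω => (1 / (n : ℝ)) * (l.growthFlag * ∑ i, |ξ n ω i| ^ 3) := by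
  refine hAv.mono (eventually_atTop.2 ⟨1, fun n hn ω => ?_⟩)
  have hflag := l.growthFlag_nonneg
  refine abs_le_abs_of_nonneg (by positivity) ?_
  gcongr
  exact l.growthFlag_mul_sum_le (fun i => zero_le_one.trans (hb n hn ω i)) (h n hn ω)

lemma exists_eventually_measureReal_largeNoise_le [∀ n, IsFiniteMeasure (P n)] {l : RegressionLoss}
    {ξ : ∀ n, Ω n → Fin n → ℝ} (h : BoundedInProbability P
      fun n ω => (1 / (n : ℝ)) * (l.growthFlag * ∑ i, |ξ n ω i| ^ 3)) {η : ℝ} (hη : 0 < η) :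
    ∃ K₀, 0 ≤ K₀ ∧ ∀ᶠ n in atTop, (P n).real (ξ n ⁻¹' largeNoise l n K₀) ≤ η := by
  obtain ⟨K, hK⟩ := h η hη
  refine ⟨max K 0, le_max_right _ _, ?_⟩
  filter_upwards [hK, eventually_gt_atTop 0] with n hKn hn
  refine (measureReal_mono fun ω hω => ?_).trans hKn
  have hω' : max K 0 * n < l.growthFlag * ∑ i, |ξ n ω i| ^ 3 := hω
  have hlt : max K 0 < (1 / (n : ℝ)) * (l.growthFlag * ∑ i, |ξ n ω i| ^ 3) := by
    rwa [one_div_mul_eq_div, lt_div_iff₀ (by exact_mod_cast hn)]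
  exact (le_max_left K 0).trans_lt (hlt.trans_le (le_abs_self _))

theorem eventually_riskComparison [∀ n, IsProbabilityMeasure (P n)] (l : RegressionLoss)
    {p d : ℕ → ℕ} (hp : (fun n => (p n : ℝ)) =O[atTop] fun n => (n : ℝ))
    {Sig : ∀ n, Matrix (Fin (p n)) (Fin (p n)) ℝ} (hSig : ∀ n, 1 ≤ n → (Sig n).PosSemidef)
    {X G : ∀ n, Ω n → Fin n → Fin (p n) → ℝ} (hX : ∀ n, 1 ≤ n → IsIndepDesign (P n) (X n) (Sig n))
    (hG : ∀ n, 1 ≤ n → IsGaussianDesign (P n) (G n) (Sig n)) {ξ : ∀ n, Ω n → Fin n → ℝ}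
    (hξ : ∀ n, 1 ≤ n → Measurable (ξ n)) (hξX : ∀ n, 1 ≤ n → IndepFun (X n) (ξ n) (P n))
    (hξG : ∀ n, 1 ≤ n → IndepFun (G n) (ξ n) (P n)) {q : ENNReal} (hq : 4 ≤ q) (hqt : q ≠ ⊤)
    (hl : l.growthFlag = 0 ∨ l.growthFlag = 1 ∧ 6 ≤ q) {M : ℝ} (hM₀ : 0 ≤ M)
    (hM : ∀ n : ℕ, 1 ≤ n → ∀ i j,
      eLpNorm (fun ω => √(n : ℝ) * X n ω i j) q (P n) ≤ ENNReal.ofReal M)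
    (hSigM : ∀ n, 1 ≤ n → lambdaMax (Sig n) ≤ M)
    (hd : ∀ n, 1 ≤ n → ∀ i, BlockDependent (P n) (fun ω => X n ω i) (d n))
    (hnoise : BoundedInProbability P
      fun n ω => (1 / (n : ℝ)) * (l.growthFlag * ∑ i, |ξ n ω i| ^ 3))
    {R : ∀ n, (Fin (p n) → ℝ) → ℝ}
    (hR : ∀ n, 1 ≤ n → ∀ T, Bornology.IsBounded T → BddBelow (R n '' T))
    {L : ℕ → ℝ} (hL : ∀ n, 1 ≤ n → 1 ≤ L n)
    (hrate : Tendsto (fun n => comparisonRate l.growthExponent n (d n) (L n)) atTop (𝓝 0))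
    {γ η : ℝ} (hγ : 0 < γ) (hη : 0 < η) :
    ∀ᶠ n in atTop, RiskComparison (P n) l (R n) (X n) (G n) (ξ n) (L n) (5 * γ) η := by
  obtain ⟨c, hc, hpc⟩ := hp.exists_pos
  obtain ⟨g, g₁, g₂, g₃, V, C, hg, hgl⟩ := l.exists_isTame (half_pos hγ)
  obtain ⟨K, hK, hKη⟩ := exists_sigmoid_neg_mul_le hγ (show 0 < η / 8 by positivity)
  obtain ⟨K₀, hK₀, hbξ⟩ :=
    exists_eventually_measureReal_largeNoise_le hnoise (show 0 < η / 8 by positivity)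
  set M' := max M (√M * gaussianNorm q)
  have hM' : 0 ≤ M' := hM₀.trans (le_max_left _ _)
  set Θ := 7 * c / (γ / 2) with hΘ
  set b := 46 * K * C ^ 4 * M' ^ 3 * c * (5 + 16 * (1 + 3 * (M * c) ^ 2 + M' ^ 4 * c + K₀))
  filter_upwards [hbξ, hpc.bound, tendsto_log_natCast_atTop.eventually_ge_atTop (1 / Θ),
    tendsto_natCast_atTop_atTop.eventually_ge_atTop (max 2 K),
    eventually_net_error_le l hK₀ (half_pos hγ),
    eventually_largeDesign_error_le c M' (show 0 < η / 4 by positivity),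
    eventually_size_bounds hL hM' hrate,
    (tendsto_const_mul_comparisonRate b Θ hrate).eventually_le_const (show 0 < η / 4 by positivity)]
    with n hbξ hpn hlog hnK hmod hdes hsize hb
  obtain ⟨hn₂, hnK⟩ := max_le_iff.1 hnK
  have hn : 1 ≤ n := by exact_mod_cast one_le_two.trans hn₂
  have hn₀ : (0 : ℝ) < n := by exact_mod_cast hn
  rw [Real.norm_of_nonneg (p n).cast_nonneg, Real.norm_of_nonneg hn₀.le] at hpn
  obtain hp₀ | hp₀ := (p n).eq_zero_or_pos
  · exact .of_dim_eq_zero (X n) (G n) hp₀ (by positivity) hη.le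
  obtain ⟨hLn, hdn, hr⟩ := hsize ((hd n hn ⟨0, hn⟩).one_le hp₀)
  have hθ : 1 ≤ Θ * Real.log n := by rwa [div_le_iff₀' (by positivity)] at hlog
  have hcard := mul_log_net_card_le hn₂ (p n).cast_nonneg hpn (zero_le_one.trans (hL n hn)) hLn
  refine (riskComparison_of_blockDependent (M' := M') l hn (hSig n hn) (hX n hn) (hG n hn) (hd n hn)
    hq hqt hl (hSigM n hn) hM₀
    (fun i j => (hM n hn i j).trans (ENNReal.ofReal_le_ofReal (le_max_left _ _)))
    (le_max_right _ _) (hξ n hn) (hξX n hn) (hξG n hn) (hR n hn) hg hgl le_rfl hγ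
    ((div_le_iff₀ hn₀).2 hpn) hdn (hL n hn) hr hθ hK
    (hnK.trans (le_mul_of_one_le_left hn₀.le hθ)) hK₀ (by positivity) (hcard.trans_eq ?_)
    (hmod _ hLn) hbξ).mono ?_
  · rw [hΘ]
    field_simp
  · have := hdes _ (p n).cast_nonneg hpn
    change _ + _ + b * _ + _ ≤ η
    linarith

end Sequences

end BlockUniversality

end

open BlockUniversality

theorem corollary2_general (l : RegressionLoss)
    (p : ℕ → ℕ) (hp : (fun n => (p n : ℝ)) =O[atTop] fun n => (n : ℝ))
    {Ω : ℕ → Type*} [∀ n, MeasurableSpace (Ω n)]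
    (P : ∀ n, Measure (Ω n)) [∀ n, IsProbabilityMeasure (P n)]
    (Sig : ∀ n, Matrix (Fin (p n)) (Fin (p n)) ℝ) (hSig : ∀ n, 1 ≤ n → (Sig n).PosSemidef)
    (X G : ∀ n, Ω n → Fin n → Fin (p n) → ℝ)
    (hX : ∀ n, 1 ≤ n → IsIndepDesign (P n) (X n) (Sig n))
    (hG : ∀ n, 1 ≤ n → IsGaussianDesign (P n) (G n) (Sig n))
    (ξ : ∀ n, Ω n → Fin n → ℝ) (hξ : ∀ n, 1 ≤ n → Measurable (ξ n))
    (hξX : ∀ n, 1 ≤ n → IndepFun (X n) (ξ n) (P n))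
    (hξG : ∀ n, 1 ≤ n → IndepFun (G n) (ξ n) (P n))
    (q : ENNReal) (hq : 4 ≤ q) (hqt : q ≠ ⊤) (hl : l.growthFlag = 0 ∨ l.growthFlag = 1 ∧ 6 ≤ q)
    (M : ℝ)
    (hM : ∀ n : ℕ, 1 ≤ n → ∀ i j,
      eLpNorm (fun ω => √(n : ℝ) * X n ω i j) q (P n) ≤ ENNReal.ofReal M)
    (hSigM : ∀ n, 1 ≤ n → lambdaMax (Sig n) ≤ M)
    (d : ℕ → ℕ) (hd : ∀ n, 1 ≤ n → ∀ i, BlockDependent (P n) (fun ω => X n ω i) (d n))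
    (hnoise : BoundedInProbability P
      fun n ω => (1 / (n : ℝ)) * (l.growthFlag * ∑ i, |ξ n ω i| ^ 3))
    (R : ∀ n, (Fin (p n) → ℝ) → ℝ)
    (hR : ∀ n, 1 ≤ n → ∀ T, Bornology.IsBounded T → BddBelow (R n '' T))
    (wX wG : ∀ n, Ω n → Fin (p n) → ℝ)
    (hwX : ∀ n, 1 ≤ n → ∀ᵐ ω ∂P n, IsMinOn (risk l (R n) (X n ω) (ξ n ω)) Set.univ (wX n ω))
    (hwG : ∀ n, 1 ≤ n → ∀ᵐ ω ∂P n, IsMinOn (risk l (R n) (G n ω) (ξ n ω)) Set.univ (wG n ω))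
    (S : ∀ n, Set (Fin (p n) → ℝ)) (ε z : ℕ → ℝ) (ρ₀ : ℝ) (hρ₀ : 0 < ρ₀)
    (L : ℕ → ℝ) (hL : ∀ n, 1 ≤ n → 1 ≤ L n)
    (h_i : ∀ n, 1 ≤ n →
      max ((P n).real {ω | L n < ‖wG n ω‖}) ((P n).real {ω | L n < ‖wX n ω‖}) ≤ ε n)
    (h_ii : ∀ n, 1 ≤ n →
      max
        ((P n).real {ω | ((z n + ρ₀ : ℝ) : EReal) ≤ minRisk l (R n) (G n ω) (ξ n ω) Set.univ})
        ((P n).real {ω | minRisk l (R n) (G n ω) (ξ n ω) (S n) ≤ ((z n + 2 * ρ₀ : ℝ) : EReal)})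
        ≤ ε n)
    (α κ : ℝ) (hκ : 0 ≤ κ) (hL_order : L =O[atTop] fun n => (n : ℝ) ^ α * Real.log n ^ κ)
    (hd_order : (fun n => (d n : ℝ)) =o[atTop] fun n =>
      (n : ℝ) ^ (1 / 4 - (l.qBar + 3) * α / 2) / Real.log n ^ (6 + (2 * l.qBar + 6) * κ)) :
    ∃ r : ℕ → ℝ, Tendsto r atTop (nhds 0) ∧
      ∀ n, 1 ≤ n →
        |(P n).real {ω | wX n ω ∈ S n} - (P n).real {ω | wG n ω ∈ S n}| ≤ 4 * ε n + r n := by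
  rw [l.qBar_eq] at hd_order
  have hrate := tendsto_comparisonRate hκ hL_order hd_order
  refine (exists_tendsto_zero_of_eventually_le_add fun η hη => ?_).imp fun r hr =>
    ⟨hr.1, fun n _ => hr.2 n⟩
  filter_upwards [eventually_ge_atTop 1,
    eventually_riskComparison l hp hSig hX hG hξ hξX hξG hq hqt hl (le_max_right M 0)
      (fun n hn i j => (hM n hn i j).trans (ENNReal.ofReal_le_ofReal (le_max_left M 0)))
      (fun n hn => (hSigM n hn).trans (le_max_left M 0)) hd hnoise hR hL hrate
      (show 0 < ρ₀ / 10 by positivity) (half_pos hη)] with n hn hcomp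
  have hlow : z n + ρ₀ = z n + 2 * (5 * (ρ₀ / 10)) := by ring
  have hhigh : z n + 2 * ρ₀ = z n + 4 * (5 * (ρ₀ / 10)) := by ring
  obtain ⟨hGL, hXL⟩ := max_le_iff.1 (h_i n hn)
  obtain ⟨hall, hSn⟩ := max_le_iff.1 (h_ii n hn)
  have hmem := hcomp.abs_measureReal_mem_sub_le (hwX n hn) (hwG n hn) (S := S n) (ε := ε n)
    (z := z n) (by positivity) (zero_le_one.trans (hL n hn)) (half_pos hη).le hXL hGL
    (by rwa [← hlow]) (by rwa [← hhigh])
  rwa [mul_div_cancel₀ η two_ne_zero] at hmem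

theorem corollary2
    -- the loss, the dimensions `p = p(n)` and the proportional regime
    (l : BlockUniversality.RegressionLoss)
    (p : ℕ → ℕ) (τ : ℝ) (hτ : τ ∈ Set.Ioo (0 : ℝ) 1)
    (hp : ∀ n, 1 ≤ n → τ ≤ (p n : ℝ) / n ∧ (p n : ℝ) / n ≤ 1 / τ)
    -- probability spaces, covariance, design, Gaussian design, noise
    {Ω : ℕ → Type*} [∀ n, MeasurableSpace (Ω n)]
    (P : ∀ n, MeasureTheory.Measure (Ω n)) [∀ n, MeasureTheory.IsProbabilityMeasure (P n)]
    (Sig : ∀ n, Matrix (Fin (p n)) (Fin (p n)) ℝ) (hSig : ∀ n, 1 ≤ n → (Sig n).PosDef)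
    (X G : ∀ n, Ω n → Fin n → Fin (p n) → ℝ)
    (hX : ∀ n, 1 ≤ n → BlockUniversality.IsDesign (P n) (X n) (Sig n))
    (hG : ∀ n, 1 ≤ n → BlockUniversality.IsGaussianDesign (P n) (G n) (Sig n))
    (ξ : ∀ n, Ω n → Fin n → ℝ) (hξ : ∀ n, 1 ≤ n → Measurable (ξ n))
    (hξX : ∀ n, 1 ≤ n → ProbabilityTheory.IndepFun (X n) (ξ n) (P n))
    (hξG : ∀ n, 1 ≤ n → ProbabilityTheory.IndepFun (G n) (ξ n) (P n))
    -- moments of the rescaled covariates `√n Xᵢ`, and the largest eigenvalue of `Σ`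
    (M : ℝ)
    (hM : ∀ n : ℕ, 1 ≤ n → ∀ i j,
      MeasureTheory.eLpNorm (fun ω => √(n : ℝ) * X n ω i j) (ENNReal.ofReal l.qStar) (P n)
        ≤ ENNReal.ofReal M)
    (hSigM : ∀ n, 1 ≤ n → BlockUniversality.lambdaMax (Sig n) ≤ M)
    -- block dependence
    (d : ℕ → ℕ)
    (hd : ∀ n, 1 ≤ n → ∀ i, BlockUniversality.BlockDependent (P n) (fun ω => X n ω i) (d n))
    -- growth constants `L_{ℓᵢ}` of the losses `ℓᵢ(x) = ℓ(x - ξᵢ)`, with `Av({L_{ℓᵢ}^𝐪}) = O(1)`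
    (Lloss : ∀ n, Ω n → Fin n → ℝ)
    (hLloss_one : ∀ n, 1 ≤ n → ∀ ω i, 1 ≤ Lloss n ω i)
    (hLloss : ∀ n, 1 ≤ n → ∀ ω i, ∀ x : ℝ,
      |l.fn (x - ξ n ω i)| / (1 + |x| ^ l.qZero) ≤ Lloss n ω i)
    (hAv : BlockUniversality.BoundedInProbability P
      (fun n ω => (1 / (n : ℝ)) * ∑ i, Lloss n ω i ^ l.qBold))
    -- convex regularizer, and the estimators
    (R : ∀ n, (Fin (p n) → ℝ) → ℝ) (hR : ∀ n, 1 ≤ n → ConvexOn ℝ Set.univ (R n))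
    (wX wG : ∀ n, Ω n → Fin (p n) → ℝ)
    (hwX_meas : ∀ n, 1 ≤ n → Measurable (wX n)) (hwG_meas : ∀ n, 1 ≤ n → Measurable (wG n))
    (hwX : ∀ n, 1 ≤ n → ∀ᵐ ω ∂(P n),
      IsMinOn (BlockUniversality.risk l (R n) (X n ω) (ξ n ω)) Set.univ (wX n ω))
    (hwG : ∀ n, 1 ≤ n → ∀ᵐ ω ∂(P n),
      IsMinOn (BlockUniversality.risk l (R n) (G n ω) (ξ n ω)) Set.univ (wG n ω))
    -- the sets `Sₙ` and conditions (i), (ii); `‖·‖` is the sup norm on `Fin (p n) → ℝ`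
    (S : ∀ n, Set (Fin (p n) → ℝ)) (hS : ∀ n, 1 ≤ n → MeasurableSet (S n))
    (ε : ℕ → ℝ) (hε : ∀ n, 1 ≤ n → ε n ∈ Set.Ico (0 : ℝ) (1 / 4))
    (z : ℕ → ℝ) (ρ₀ : ℝ) (hρ₀ : 0 < ρ₀)
    (L : ℕ → ℝ) (hL : ∀ n, 1 ≤ n → 1 ≤ L n)
    (h_i : ∀ n, 1 ≤ n →
      max ((P n).real {ω | L n < ‖wG n ω‖}) ((P n).real {ω | L n < ‖wX n ω‖}) ≤ ε n)
    (h_ii : ∀ n, 1 ≤ n →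
      max
        ((P n).real {ω | ((z n + ρ₀ : ℝ) : EReal) ≤
          BlockUniversality.minRisk l (R n) (G n ω) (ξ n ω) Set.univ})
        ((P n).real {ω | BlockUniversality.minRisk l (R n) (G n ω) (ξ n ω) (S n) ≤
          ((z n + 2 * ρ₀ : ℝ) : EReal)}) ≤ ε n)
    -- the orders of `Lₙ` and `d`
    (α κ : ℝ) (hα : α ∈ Set.Icc (0 : ℝ) (1 / (2 * l.qBar + 6))) (hκ : 0 ≤ κ)
    (hL_order : L =O[Filter.atTop] fun n => (n : ℝ) ^ α * Real.log n ^ κ)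
    (hd_order : (fun n => (d n : ℝ)) =o[Filter.atTop] fun n =>
      (n : ℝ) ^ (1 / 4 - (l.qBar + 3) * α / 2) / Real.log n ^ (6 + (2 * l.qBar + 6) * κ)) :
    ∃ r : ℕ → ℝ, Filter.Tendsto r Filter.atTop (nhds 0) ∧
      ∀ n, 1 ≤ n →
        |(P n).real {ω | wX n ω ∈ S n} - (P n).real {ω | wG n ω ∈ S n}| ≤ 4 * ε n + r n :=
  corollary2_general l p (isBigO_natCast_of_div_le fun n hn => (hp n hn).2) P Sig
    (fun n hn => (hSig n hn).posSemidef) X G (fun n hn => (hX n hn).isIndepDesign) hG ξ hξ hξX hξG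
    (ENNReal.ofReal l.qStar) l.four_le_ofReal_qStar ENNReal.ofReal_ne_top l.growthFlag_eq_zero_or
    M hM hSigM d hd (boundedInProbability_noise l hLloss_one hLloss hAv) R
    (fun n hn _ => bddBelow_image_of_convexOn (hR n hn)) wX wG hwX hwG S ε z ρ₀ hρ₀ L hL h_i h_ii
    α κ hκ hL_order hd_order
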